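/- A pseudo-triangle is a simple polygon $\mathcal{P}$ in the plane (with its closed region, also denoted $\mathcal{P}$) with exactly three vertices $A,B,C$, called corners, at which the interior angle is less than $\pi$, while the interior angle at every other vertex is greater than $\pi$; the corners split the boundary into three side-chains $AB$, $BC$, $AC$ (each possibly a single edge). A tower polygon with base edge $e$ is a pseudo-triangle one of whose side-chains is the single edge $e$; its corner opposite to $e$ is called the corner of the tower. The visibility graph $\mathcal{G}$ of $\mathcal{P}$ has the vertices of $\mathcal{P}$ as its vertices, two distinct ones being adjacent (seeing each other) if and only if the line segment between them is contained in $\mathcal{P}$; the boundary order of the vertices gives a Hamiltonian cycle $\mathcal{H}$ of $\mathcal{G}$. Call a vertex detected if its two neighbours on $\mathcal{H}$ are adjacent in $\mathcal{G}$; this depends only on the pair $(\mathcal{G},\mathcal{H})$. Lemma 1. Let $\mathcal{P}$ be a pseudo-triangle with visibility graph $\mathcal{G}$ and boundary Hamiltonian cycle $\mathcal{H}$. Every detected vertex is a corner, and at least two of the three corners are detected. Moreover, suppose that a corner $A$ is not detected, and let $u$ and $v$ be the neighbours of $A$ on the side-chains $AB$ and $AC$. Then $B$ and $C$ are both detected,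 and both are isolated vertices of the graph obtained from $\mathcal{G}$ by removing the edges of $\mathcal{H}$. Furthermore, there are vertices $w,w'$ on $BC$, different from $B$ and $C$, with $w$ equal to $w'$ or closer to $B$ than $w'$ along $BC$, such that $(u,w)$ and $(w',v)$ are edges of $\mathcal{G}$ and the path from $u$ to $v$ composed of the segment $uw$, the subchain $[w,\ldots,w']$ of $BC$ and the segment $w'v$ is a shortest Euclidean path from $u$ to $v$ inside $\mathcal{P}$, and such that the following holds. Either $u\neq B$ and $\langle u,\ldots,B,\ldots,w\rangle$ is a tower polygon with base $(u,w)$ and corner $B$, and $B$ is the only isolated vertex of the graph obtained from the visibility graph of this tower by removing all its boundary edges except the base; or $u=B$ and $w$ is the neighbour of $B$ on $BC$. Symmetrically, either $v\neq C$ and $\langle w',\ldots,C,\ldots,v\rangle$ is a tower polygon with base $(w',v)$ and corner $C$, and $C$ is the only isolated vertex of the graph obtained from the visibility graph of this tower by removing all its boundary edges except the base; or $v=C$ and $w'$ is the neighbour of $C$ on $BC$. -/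

import Mathlib

open scoped Topology ENNReal

/-- The Euclidean plane. -/
abbrev Plane : Type := EuclideanSpace ℝ (Fin 2)

/-! ### Combinatorics of a graph with a Hamiltonian cycle -/

/-- The vertices picked out by the neighbour test in a graph `G` with a Hamiltonian cycle `H`
(given as a graph on the same vertices): those whose two neighbours along `H` are adjacent in `G`.
The rule uses nothing but `G` and `H`. -/
def detected {V : Type*} (G H : SimpleGraph V) : Set V :=
  {x | ∃ y z, y ≠ z ∧ H.Adj x y ∧ H.Adj x z ∧ G.Adj y z}

/-! ### Polygonal paths and shortest paths in a set -/

/-- The length of the polygonal path through the listed points. -/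
noncomputable def polylineLength : List Plane → ℝ≥0∞
  | [] => 0
  | [_] => 0
  | x :: y :: l => edist x y + polylineLength (y :: l)

/-- The polygonal path through the points of `L` is a shortest path from `x` to `y` inside `S`:
it goes from `x` to `y`, stays in `S`, and no continuous curve in `S` from `x` to `y` is shorter
(the length of a curve is its total variation). -/
def IsShortestPath (S : Set Plane) (x y : Plane) (L : List Plane) : Prop :=
  L.head? = some x ∧ L.getLast? = some y ∧
  L.IsChain (fun p q => segment ℝ p q ⊆ S) ∧
  ∀ γ : ℝ → Plane, ContinuousOn γ (Set.Icc 0 1) → γ 0 = x → γ 1 = y →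
    (∀ t ∈ Set.Icc (0 : ℝ) 1, γ t ∈ S) →
    polylineLength L ≤ eVariationOn γ (Set.Icc 0 1)

namespace Polygon

/-! ### Simple polygons in the plane

The vertices are indexed cyclically by `Fin n` (so `i + 1` and `i - 1` are the two boundary
neighbours of `i`), and the polygon may be traversed clockwise or counterclockwise. -/

/-- A simple polygon: at least three vertices, all distinct, and two different edges meet at most
in a common endpoint of consecutive edges. -/
def IsSimple {n : ℕ} [NeZero n] (P : Polygon Plane n) : Prop :=
  3 ≤ n ∧ Function.Injective P.vertices ∧
  ∀ i j : Fin n, i ≠ j → ∀ x ∈ P.edgeSet ℝ i ∩ P.edgeSet ℝ j,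
    (j = i + 1 ∧ x = P j) ∨ (i = j + 1 ∧ x = P i)

/-- The edge from `P i` to `P (i + 1)` crosses the horizontal ray that starts at `x` and goes in
the direction of increasing first coordinate. (An edge contains its lower endpoint but not its
upper one for this purpose, and horizontal edges do not count.) -/
def CrossesRay {n : ℕ} [NeZero n] (P : Polygon Plane n) (x : Plane) (i : Fin n) : Prop :=
  ((P i 1 ≤ x 1 ∧ x 1 < P (i + 1) 1) ∨ (P (i + 1) 1 ≤ x 1 ∧ x 1 < P i 1)) ∧
  ∃ z ∈ segment ℝ (P i) (P (i + 1)), z 1 = x 1 ∧ x 0 < z 0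

/-- The closed region bounded by a simple polygon: the boundary together with the interior, that
is, the points from which a ray crosses the boundary an odd number of times. -/
def region {n : ℕ} [NeZero n] (P : Polygon Plane n) : Set Plane :=
  P.boundary ℝ ∪ {x | Odd (Set.ncard {i | P.CrossesRay x i})}

/-- The interior angle at the vertex `P i` is strictly between `0` and `π`: the two edges there are
not collinear, and the wedge between them (represented by the points near `P i` on the median
through `P i` of the triangle of `P i` and its boundary neighbours) lies inside the polygon. -/
def IsConvexVertex {n : ℕ} [NeZero n] (P : Polygon Plane n) (i : Fin n) : Prop :=
  ¬ Collinear ℝ {P (i - 1), P i, P (i + 1)} ∧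
  ∀ᶠ t : ℝ in 𝓝[>] 0, P i + t • ((P (i - 1) - P i) + (P (i + 1) - P i)) ∈ P.region

/-- The interior angle at the vertex `P i` is strictly between `π` and `2π`: the two edges there are
not collinear, and the wedge between them lies outside the polygon. -/
def IsReflexVertex {n : ℕ} [NeZero n] (P : Polygon Plane n) (i : Fin n) : Prop :=
  ¬ Collinear ℝ {P (i - 1), P i, P (i + 1)} ∧
  ∀ᶠ t : ℝ in 𝓝[>] 0, P i + t • ((P (i - 1) - P i) + (P (i + 1) - P i)) ∉ P.region

/-- `P` is a pseudo-triangle with corners `P a`, `P b`, `P c`, met in this order on the boundary: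
a simple polygon whose corners are convex vertices and whose other vertices, the interior vertices
of the three side-chains from `a` to `b`, from `b` to `c` and from `c` to `a`, are all reflex.
The order on `Fin n` of `b - a` and `c - a` compares distances along the boundary from `a`. -/
def IsPseudoTriangle {n : ℕ} [NeZero n] (P : Polygon Plane n) (a b c : Fin n) : Prop :=
  P.IsSimple ∧ 0 < b - a ∧ b - a < c - a ∧
  P.IsConvexVertex a ∧ P.IsConvexVertex b ∧ P.IsConvexVertex c ∧
  ∀ i, i ≠ a → i ≠ b → i ≠ c → P.IsReflexVertex i

/-- `P` is a tower polygon with corner `P a` and base edge from `P b` to `P c`: a pseudo-triangle in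
which the side-chain from `b` to `c` is a single edge. -/
def IsTower {n : ℕ} [NeZero n] (P : Polygon Plane n) (a b c : Fin n) : Prop :=
  P.IsPseudoTriangle a b c ∧ c = b + 1

/-- The visibility graph: two distinct vertices are adjacent when the line segment between them
lies in the closed polygonal region. -/
def visibilityGraph {n : ℕ} [NeZero n] (P : Polygon Plane n) : SimpleGraph (Fin n) where
  Adj i j := i ≠ j ∧ segment ℝ (P i) (P j) ⊆ P.region
  symm := ⟨fun i j h => ⟨h.1.symm, by rw [segment_symm]; exact h.2⟩⟩
  loopless := ⟨fun _ h => h.1 rfl⟩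

/-- The vertices met on the boundary when going forward from `i` to `j`, both included. -/
def boundaryChain {n : ℕ} [NeZero n] (P : Polygon Plane n) (i j : Fin n) : List Plane :=
  (List.range ((j - i).val + 1)).map (fun k => P (i + Fin.ofNat n k))

/-- The polygon cut off by the chord from `P j` to `P i`: its vertices are those met on the boundary
when going forward from `i` to `j`, and its last edge is the chord. -/
def subPolygon {n : ℕ} [NeZero n] (P : Polygon Plane n) (i j : Fin n) :
    Polygon Plane ((j - i).val + 1) :=
  ⟨fun k => P (i + Fin.ofNat n k.val)⟩

/-- The polygon cut off by the chord from `P j` to `P i` is a tower polygon whose base is the chord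
and whose corner is `P x`, where `x` lies on the boundary between `i` and `j`. Moreover, this corner
is the only isolated vertex of the graph left when the edges of the two side-chains of the tower
(all its boundary edges except the base) are removed from its visibility graph. -/
def CutsOffTower {n : ℕ} [NeZero n] (P : Polygon Plane n) (i j x : Fin n) : Prop :=
  x - i ≤ j - i ∧
  (P.subPolygon i j).IsTower (Fin.ofNat _ (x - i).val) (Fin.last _) 0 ∧
  ∀ y, ((P.subPolygon i j).visibilityGraph \ SimpleGraph.pathGraph _).IsIsolated y ↔
    y = Fin.ofNat _ (x - i).val

end Polygon

/-! ### Angles between complex numbers -/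

/-! Read the boundary as a periodic sequence of points starting at a corner. Everything rests on a
description of a pseudo-triangle by signs of areas alone, `TriChain`: along one side-chain any two
edges turn to one side, and any edge turns to the other side against every edge of the preceding
chain. To reach it, the region, given by the parity of ray crossings, is tied to the winding angle
(`Polygon.exists_windingAngle_eq`). A discrete form of Hopf's Umlaufsatz (`Complex.sum_turning_eq`)
shows that the turning angles of a simple polygon add up to `2π` or `-2π`, and the winding angle
next to a vertex shows that convex vertices turn in the sense of the orientation and reflex ones
against it (`Polygon.exists_orientation`). Three turns in `(0, π)`, all others negative and a total
of `2π` bound every partial sum of turns, hence fix the sign of the area spanned by any two edges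
(`Polygon.IsPseudoTriangle.exists_triChain`). In these terms the region is explicit
(`Polygon.region_eq_enclosed`): for each chain, a point must be on the inner side of its chord and
on the inner side of at least one of its edges. So two vertices see each other as soon as each chain
has an edge with both of them on its inner side, and they do not if some point between them is
strictly beyond all edges of one chain. In particular vertices of one chain that are not consecutive
never see each other, so only corners can be detected. Suppose that the neighbours `u`, `v` of `A`
do not see each other. Only `BC` can be in the way, and some point of `uv` is beyond all its edges.
Let `w` be the first vertex of `BC` whose outgoing edge no longer has `u` strictly on its inner
side, and `w'` its mirror image; blocking forces `w` and `w'` to be interior and in order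
(`TriChain.exists_tangents`). The vector `w - u` lies in the cone of the two edges at `w`, and the
remaining signs follow: `u` sees `w`, the neighbours of `B` see each other, the interior vertices of
`AC` are beyond the first edge of `BC` and so hidden from `B`, and the chord `uw` closes up a new
`TriChain`, which is a tower by the converse `Polygon.isPseudoTriangle_of_triChain`. In a tower
every interior vertex of a side-chain sees a vertex of the opposite one (`TriChain.exists_sees`), so
that only the corner is isolated. For the shortest path, let `M` be the midpoint of the chord `BC`.
The rays from the vertices of `[w, ..., w']` through `M` avoid the region, so a curve from `u` to
`v` must meet the extension of each segment of the path in turn, and the triangle inequality does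
the rest (`polylineLength_le_of_turns`). -/

open Complex in
lemma Complex.arg_div_eq_arg_sub_arg {z w : ℂ} (hz : z ≠ 0) (hw : w ≠ 0)
    (h : arg w - arg z ∈ Set.Ioc (-Real.pi) Real.pi) : arg (w / z) = arg w - arg z := by
  have h1 := arg_div_coe_angle hw hz
  rw [← Real.Angle.coe_sub] at h1
  have h2 := congrArg Real.Angle.toReal h1
  rwa [arg_coe_angle_toReal_eq_arg, Real.Angle.toReal_coe_eq_self_iff_mem_Ioc.2 h] at h2

open Complex in
lemma Complex.ne_zero_of_div_mem_slitPlane {z w : ℂ} (h : w / z ∈ slitPlane) :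
    z ≠ 0 ∧ w ≠ 0 := by
  have := slitPlane_ne_zero h
  constructor <;> rintro rfl <;> simp at this

open Complex in
/-- Arguments may be subtracted in a closed half plane. -/
lemma Complex.arg_div_of_im_nonneg {u z w : ℂ} (hu : u ≠ 0) (hz : 0 ≤ (z / u).im)
    (hw : 0 ≤ (w / u).im) (h : w / z ∈ slitPlane) :
    arg (w / z) = arg (w / u) - arg (z / u) := by
  obtain ⟨hz0, hw0⟩ := ne_zero_of_div_mem_slitPlane h
  have e : w / z = (w / u) / (z / u) := by field_simp
  have h1 := arg_nonneg_iff.2 hz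
  have h2 := arg_nonneg_iff.2 hw
  have h3 := arg_le_pi (z / u)
  have h4 := arg_le_pi (w / u)
  have hzu : z / u ≠ 0 := div_ne_zero hz0 hu
  have hwu : w / u ≠ 0 := div_ne_zero hw0 hu
  rw [e] at h ⊢
  -- Both arguments lie in `[0, π]`, so only the difference `-π` must be excluded; it would put the
  -- quotient on the negative real axis.
  refine arg_div_eq_arg_sub_arg hzu hwu ⟨lt_of_le_of_ne (by linarith) fun hne => ?_, by linarith⟩
  have h5 := arg_div_coe_angle hwu hzu
  rw [← Real.Angle.coe_sub, ← hne, Real.Angle.coe_neg, Real.Angle.neg_coe_pi] at h5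
  have h6 := congrArg Real.Angle.toReal h5
  rw [arg_coe_angle_toReal_eq_arg, Real.Angle.toReal_pi] at h6
  exact (mem_slitPlane_iff_arg.1 h).1 h6

-- A telescoping sum; the common half plane keeps the branch cut out of play.
open Complex in
lemma Complex.sum_arg_div_of_im_nonneg {u : ℂ} (hu : u ≠ 0) (z : ℕ → ℂ) {a b : ℕ} (hab : a ≤ b)
    (hz : ∀ k, a ≤ k → k ≤ b → 0 ≤ (z k / u).im)
    (h : ∀ k, a ≤ k → k < b → z (k + 1) / z k ∈ slitPlane) :
    ∑ k ∈ Finset.Ico a b, arg (z (k + 1) / z k) = arg (z b / u) - arg (z a / u) := by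
  induction b, hab using Nat.le_induction with
  | base => simp
  | succ b hb ih =>
    rw [Finset.sum_Ico_succ_top hb, ih (fun k h1 h2 => hz k h1 (by omega))
      (fun k h1 h2 => h k h1 (by omega)), arg_div_of_im_nonneg hu (hz b hb (by omega))
      (hz _ (by omega) le_rfl) (h b hb (by omega))]
    ring

open Complex in
lemma Complex.im_div_pos_iff {z w : ℂ} (hz : z ≠ 0) :
    0 < (w / z).im ↔ 0 < z.re * w.im - z.im * w.re := by
  have h := normSq_pos.2 hz
  rw [div_im, ← sub_div, div_pos_iff_of_pos_right h]
  ring_nf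

open Complex in
lemma Complex.im_div_neg_iff {z w : ℂ} (hz : z ≠ 0) :
    (w / z).im < 0 ↔ z.re * w.im - z.im * w.re < 0 := by
  have h := normSq_pos.2 hz
  rw [div_im, ← sub_div, div_lt_iff₀ h, zero_mul]
  ring_nf

open Complex in
lemma Complex.im_div_nonneg_iff {z w : ℂ} (hz : z ≠ 0) :
    0 ≤ (w / z).im ↔ 0 ≤ z.re * w.im - z.im * w.re := by
  have h := im_div_neg_iff (w := w) hz
  rw [← not_lt, h, not_lt]

open Complex in
lemma Complex.im_div_eq_zero_iff {z w : ℂ} (hz : z ≠ 0) :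
    (w / z).im = 0 ↔ z.re * w.im - z.im * w.re = 0 := by
  have h := im_div_neg_iff (w := w) hz
  have h' := im_div_pos_iff (w := w) hz
  constructor <;> intro h1
  · rw [h1] at h h'; simp at h h'; linarith
  · rw [h1] at h h'; simp at h h'; linarith

open Complex in
/-- The two summands of a noncollinear sum split the angle between them. -/
lemma Complex.arg_div_add_arg_div {a b : ℂ} (h : (b / a).im ≠ 0) :
    arg ((a + b) / a) + arg (b / (a + b)) = arg (b / a) := by
  have ha : a ≠ 0 := by rintro rfl; simp at h
  have hb : b ≠ 0 := by rintro rfl; simp at h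
  have h0 : a.re * b.im - a.im * b.re ≠ 0 := fun h' => h ((im_div_eq_zero_iff ha).2 h')
  have hs : a + b ≠ 0 := fun h' => by
    apply h0
    have hb' : b = -a := (neg_eq_of_add_eq_zero_right h').symm
    simp [hb']; ring
  have s1 : (a + b) / a ∈ slitPlane := Or.inr fun h' => h0 (by
    rw [im_div_eq_zero_iff ha] at h'; simp at h'; linarith)
  have s2 : b / (a + b) ∈ slitPlane := Or.inr fun h' => h0 (by
    rw [im_div_eq_zero_iff hs] at h'; simp at h'; linarith)
  have s3 : b / a ∈ slitPlane := Or.inr h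
  -- The half plane is bounded by the line of `b` or of `a`, according to the orientation, so that
  -- it contains both vectors and their sum.
  rcases lt_or_gt_of_ne h0 with h1 | h1
  · have i1 : 0 ≤ (a / b).im := (im_div_nonneg_iff hb).2 (by linarith)
    have i2 : 0 ≤ ((a + b) / b).im := (im_div_nonneg_iff hb).2 (by simp; linarith)
    have i3 : 0 ≤ (b / b).im := by simp [div_self hb]
    rw [arg_div_of_im_nonneg hb i1 i2 s1, arg_div_of_im_nonneg hb i2 i3 s2,
      arg_div_of_im_nonneg hb i1 i3 s3]
    ring
  · have i1 : 0 ≤ (b / a).im := (im_div_nonneg_iff ha).2 (by linarith)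
    have i2 : 0 ≤ ((a + b) / a).im := (im_div_nonneg_iff ha).2 (by simp; linarith)
    have i3 : 0 ≤ (a / a).im := by simp [div_self ha]
    rw [arg_div_of_im_nonneg ha i3 i2 s1, arg_div_of_im_nonneg ha i2 i1 s2]
    simp [ha]

/-- The origin is on the segment exactly when one end is zero or the quotient is a negative real.
The convention `w / 0 = 0` makes the case `z = 0` fit, since `0` is not in the slit plane. -/
lemma zero_notMem_segment_iff {z w : ℂ} : (0 : ℂ) ∉ segment ℝ z w ↔ w / z ∈ Complex.slitPlane := by
  constructor
  · intro h
    have hz : z ≠ 0 := by rintro rfl; exact h (left_mem_segment _ _ _)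
    rw [Complex.mem_slitPlane_iff]
    by_contra! hc
    obtain ⟨h1, h2⟩ := hc
    apply h
    set c := -(w / z).re with hcdef
    have hc0 : 0 ≤ c := by simp [hcdef, h1]
    have hw : w = -(c : ℂ) * z := by
      have : w / z = -(c : ℂ) := by
        apply Complex.ext <;> simp [hcdef, h2]
      rw [← this]; field_simp
    refine ⟨c / (1 + c), 1 / (1 + c), by positivity, by positivity, by field_simp; ring, ?_⟩
    rw [hw]
    simp only [Complex.real_smul]
    push_cast
    ring
  · rintro h ⟨a, b, ha, hb, hab, h0⟩
    obtain ⟨hz, hw⟩ := Complex.ne_zero_of_div_mem_slitPlane h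
    rcases eq_or_lt_of_le hb with rfl | hb
    · simp at hab h0; subst hab; simp at h0; exact hz h0
    have : w / z = ((-(a / b) : ℝ) : ℂ) := by
      rw [div_eq_iff hz]
      have hb' : (b : ℂ) ≠ 0 := by exact_mod_cast hb.ne'
      push_cast
      field_simp
      simp only [Complex.real_smul] at h0
      linear_combination h0
    rw [this, Complex.ofReal_mem_slitPlane] at h
    have : 0 ≤ a / b := by positivity
    linarith

section

-- The segment crosses the real axis once, going down, and the cross product of `z` and `w` tells on
-- which side of the origin. Since `arg w - arg z` lies in `(-2π, 0)`, a crossing on the left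
-- corresponds to the correction by one full turn and a crossing on the right to none.
open Complex in
lemma Complex.exists_arg_div_of_im_nonneg_of_im_neg {z w : ℂ} (h : w / z ∈ slitPlane)
    (hz : 0 ≤ z.im) (hw : w.im < 0) :
    ∃ k : ℤ, arg (w / z) = arg w - arg z + 2 * Real.pi * k ∧
      (Odd k ↔ ∃ t ∈ segment ℝ z w, t.im = 0 ∧ t.re < 0) := by
  obtain ⟨hz0, hw0⟩ := ne_zero_of_div_mem_slitPlane h
  have hpi := Real.pi_pos
  have h1 := arg_nonneg_iff.2 hz
  have h2 := arg_neg_iff.2 hw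
  have h3 := arg_le_pi z
  have h4 := neg_pi_lt_arg w
  have h5 := arg_div_coe_angle hw0 hz0
  rw [← Real.Angle.coe_sub, Real.Angle.angle_eq_iff_two_pi_dvd_sub] at h5
  obtain ⟨k, hk⟩ := h5
  refine ⟨k, by linarith, ?_⟩
  have hcross : (∃ t ∈ segment ℝ z w, t.im = 0 ∧ t.re < 0) ↔
      0 < z.re * w.im - z.im * w.re := by
    constructor
    · rintro ⟨t, ⟨a, b, ha, hb, hab, rfl⟩, him, hre⟩
      simp at him hre
      have e : (a * z.re + b * w.re) * (z.im - w.im) = -(z.re * w.im - z.im * w.re) := by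
        have : b = 1 - a := by linarith
        subst this
        linear_combination (z.re - w.re) * him
      have := mul_neg_of_neg_of_pos hre (show 0 < z.im - w.im by linarith)
      linarith
    · intro hc
      have hd : 0 < z.im - w.im := by linarith
      refine ⟨_, ⟨-w.im / (z.im - w.im), z.im / (z.im - w.im), ?_, ?_, ?_, rfl⟩, ?_, ?_⟩
      · exact div_nonneg (by linarith) hd.le
      · exact div_nonneg hz hd.le
      · field_simp; ring
      · simp only [real_smul, add_im, mul_im, ofReal_re, ofReal_im, zero_mul, add_zero]
        field_simp
        ring
      · simp only [real_smul, add_re, mul_re, ofReal_re, ofReal_im, zero_mul, sub_zero]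
        have : -w.im / (z.im - w.im) * z.re + z.im / (z.im - w.im) * w.re
            = -(z.re * w.im - z.im * w.re) / (z.im - w.im) := by field_simp; ring
        rw [this]
        exact div_neg_of_neg_of_pos (by linarith) hd
  rw [hcross]
  rcases lt_trichotomy (z.re * w.im - z.im * w.re) 0 with hc | hc | hc
  · have i1 := (im_div_neg_iff hz0).2 hc
    have i2 := arg_neg_iff.2 i1
    have i3 := neg_pi_lt_arg (w / z)
    have k1 : (-1 : ℝ) < k := by by_contra! hh; nlinarith
    have k2 : (k : ℝ) < 1 := by by_contra! hh; nlinarith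
    have : k = 0 := by
      have k1' : (-1 : ℤ) < k := by exact_mod_cast k1
      have k2' : k < (1 : ℤ) := by exact_mod_cast k2
      omega
    simpa [this] using hc.le
  · exfalso
    have i1 := (im_div_eq_zero_iff hz0).2 hc
    have i2 : 0 < (w / z).re := by
      rcases h with h | h
      · exact h
      · exact absurd i1 h
    have e : w = (w / z) * z := by field_simp
    have := congrArg Complex.im e
    rw [mul_im, i1] at this
    have : 0 ≤ (w / z).re * z.im := by positivity
    linarith
  · have i1 := (im_div_pos_iff hz0).2 hc
    have i2 := arg_nonneg_iff.2 i1.le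
    have i3 := arg_le_pi (w / z)
    have k1 : (0 : ℝ) < k := by by_contra! hh; nlinarith
    have k2 : (k : ℝ) < 2 := by by_contra! hh; nlinarith
    have : k = 1 := by
      have k1' : (0 : ℤ) < k := by exact_mod_cast k1
      have k2' : k < (2 : ℤ) := by exact_mod_cast k2
      omega
    simp [this, hc]

open Complex in
/-- The angle under which a segment is seen from the origin, compared with the difference of the
principal arguments of its ends: they differ by an odd multiple of `2π` exactly when the segment
crosses the branch cut. -/
lemma Complex.exists_arg_div_eq {z w : ℂ} (h : w / z ∈ slitPlane) :
    ∃ k : ℤ, arg (w / z) = arg w - arg z + 2 * Real.pi * k ∧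
      (Odd k ↔ ((0 ≤ z.im ∧ w.im < 0) ∨ (0 ≤ w.im ∧ z.im < 0)) ∧
        ∃ t ∈ segment ℝ z w, t.im = 0 ∧ t.re < 0) := by
  obtain ⟨hz0, hw0⟩ := ne_zero_of_div_mem_slitPlane h
  rcases le_or_gt 0 z.im with hz | hz <;> rcases le_or_gt 0 w.im with hw | hw
  · refine ⟨0, ?_, ?_⟩
    · have := arg_div_of_im_nonneg (u := 1) one_ne_zero (by simpa using hz) (by simpa using hw) h
      simpa using this
    · simp [hz.not_gt, hw.not_gt]
  · obtain ⟨k, hk, hk'⟩ := exists_arg_div_of_im_nonneg_of_im_neg h hz hw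
    exact ⟨k, hk, by rw [hk']; simp [hz, hw]⟩
  · have hinv : (z / w) = (w / z)⁻¹ := by rw [inv_div]
    have h' : z / w ∈ slitPlane := by
      rwa [← zero_notMem_segment_iff, segment_symm, zero_notMem_segment_iff]
    obtain ⟨k, hk, hk'⟩ := exists_arg_div_of_im_nonneg_of_im_neg h' hw hz
    refine ⟨-k, ?_, ?_⟩
    · rw [hinv, arg_inv, if_neg (mem_slitPlane_iff_arg.1 h).1] at hk
      push_cast; linarith
    · rw [odd_neg, hk', segment_symm]; simp [hz, hw]
  · refine ⟨0, ?_, ?_⟩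
    · have := arg_div_of_im_nonneg (u := -1) (by norm_num)
        (show 0 ≤ (z / -1).im by simp [div_neg]; linarith)
        (show 0 ≤ (w / -1).im by simp [div_neg]; linarith) h
      rw [div_neg, div_neg, div_one, div_one, arg_neg_eq_arg_add_pi_of_im_neg hz,
        arg_neg_eq_arg_add_pi_of_im_neg hw] at this
      rw [this]; push_cast; ring
    · simp [hz.not_ge, hw.not_ge]

/-! ### The winding number of a polygon -/

namespace Plane

/-- The identification of the plane with the complex numbers. -/
noncomputable def toC : Plane →ₗ[ℝ] ℂ where
  toFun x := ⟨x 0, x 1⟩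
  map_add' x y := by apply Complex.ext <;> simp
  map_smul' r x := by apply Complex.ext <;> simp

@[simp] lemma toC_re (x : Plane) : (toC x).re = x 0 := rfl
@[simp] lemma toC_im (x : Plane) : (toC x).im = x 1 := rfl

lemma toC_injective : Function.Injective toC := fun x y h => by
  have h0 := congrArg Complex.re h
  have h1 := congrArg Complex.im h
  ext i
  fin_cases i
  · exact h0
  · exact h1

lemma continuous_toC : Continuous toC := toC.continuous_of_finiteDimensional

lemma notMem_segment_iff {x p q : Plane} :
    x ∉ segment ℝ p q ↔ (toC q - toC x) / (toC p - toC x) ∈ Complex.slitPlane := by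
  rw [← zero_notMem_segment_iff, not_iff_not]
  have h1 : (0 : ℂ) ∈ segment ℝ (toC p - toC x) (toC q - toC x) ↔
      toC x ∈ segment ℝ (toC p) (toC q) := by
    have := mem_segment_translate ℝ (-toC x) (x := toC x) (b := toC p) (c := toC q)
    rw [← this]; simp [neg_add_eq_sub]
  rw [h1]
  have := image_segment ℝ toC.toAffineMap p q
  constructor
  · intro h
    have : toC x ∈ toC.toAffineMap '' segment ℝ p q := ⟨x, h, rfl⟩
    rwa [image_segment] at this
  · intro h
    have h2 : toC x ∈ toC.toAffineMap '' segment ℝ p q := by rwa [image_segment]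
    obtain ⟨y, hy, hxy⟩ := h2
    rwa [← toC_injective hxy]

end Plane

namespace Polygon

open Plane

variable {n : ℕ} [NeZero n]

lemma edgeSet_eq_segment (P : Polygon Plane n) (i : Fin n) :
    P.edgeSet ℝ i = segment ℝ (P i) (P (i + 1)) := by
  rw [edgeSet, affineSegment_eq_segment, finRotate_apply]

lemma notMem_boundary_iff {P : Polygon Plane n} {x : Plane} :
    x ∉ P.boundary ℝ ↔ ∀ i, x ∉ segment ℝ (P i) (P (i + 1)) := by
  simp [boundary, edgeSet_eq_segment]

/-- The total angle under which the boundary is seen from `x`. -/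
noncomputable def windingAngle (P : Polygon Plane n) (x : Plane) : ℝ :=
  ∑ i, Complex.arg ((toC (P (i + 1)) - toC x) / (toC (P i) - toC x))

/-- Using `x - P i` in place of `P i - x` turns the branch cut of the argument into the ray of
`CrossesRay`, with matching half-open conventions. Each summand is then a difference of principal
arguments plus a multiple of `2π` that is odd exactly at a crossing; the differences cancel around
the polygon. -/
lemma exists_windingAngle_eq {P : Polygon Plane n} {x : Plane} (hx : x ∉ P.boundary ℝ) :
    ∃ k : ℤ, P.windingAngle x = 2 * Real.pi * k ∧ (x ∈ P.region ↔ Odd k) := by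
  rw [notMem_boundary_iff] at hx
  have key : ∀ i, ∃ k : ℤ,
      Complex.arg ((toC (P (i + 1)) - toC x) / (toC (P i) - toC x)) =
      Complex.arg (toC x - toC (P (i + 1))) - Complex.arg (toC x - toC (P i)) + 2 * Real.pi * k ∧
      (Odd k ↔ P.CrossesRay x i) := by
    intro i
    have hs := notMem_segment_iff.1 (hx i)
    have e : (toC (P (i + 1)) - toC x) / (toC (P i) - toC x) =
        (toC x - toC (P (i + 1))) / (toC x - toC (P i)) := by
      rw [← neg_sub, ← neg_sub (toC x) (toC (P i)), neg_div_neg_eq]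
    rw [e] at hs ⊢
    obtain ⟨k, hk, hk'⟩ := Complex.exists_arg_div_eq hs
    refine ⟨k, hk, hk'.trans ?_⟩
    unfold CrossesRay
    simp only [Complex.sub_im, toC_im, sub_nonneg, sub_neg]
    refine and_congr Iff.rfl ⟨?_, ?_⟩
    · rintro ⟨t, ⟨a, b, ha, hb, hab, rfl⟩, h1, h2⟩
      refine ⟨_, ⟨a, b, ha, hb, hab, rfl⟩, ?_, ?_⟩
      · simp at h1 ⊢; linear_combination (x 1) * hab - h1
      · simp at h2 ⊢
        have : a * x 0 + b * x 0 = x 0 := by rw [← add_mul, hab, one_mul]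
        linarith
    · rintro ⟨t, ⟨a, b, ha, hb, hab, rfl⟩, h1, h2⟩
      refine ⟨_, ⟨a, b, ha, hb, hab, rfl⟩, ?_, ?_⟩
      · simp at h1 ⊢; linear_combination (x 1) * hab - h1
      · simp at h2 ⊢
        have : a * x 0 + b * x 0 = x 0 := by rw [← add_mul, hab, one_mul]
        linarith
  choose k hk hk' using key
  refine ⟨∑ i, k i, ?_, ?_⟩
  · have h1 : ∑ i, Complex.arg (toC x - toC (P (i + 1))) = ∑ i, Complex.arg (toC x - toC (P i)) :=
      Equiv.sum_comp (Equiv.addRight (1 : Fin n)) fun i => Complex.arg (toC x - toC (P i))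
    simp only [windingAngle, hk, Finset.sum_add_distrib, Finset.sum_sub_distrib, h1]
    push_cast
    rw [Finset.mul_sum]
    ring
  · have h1 : x ∈ P.region ↔ Odd (Set.ncard {i | P.CrossesRay x i}) := by
      have : x ∉ P.boundary ℝ := notMem_boundary_iff.2 hx
      simp [region, this]
    have h2 : {i | P.CrossesRay x i} = ((Finset.univ.filter fun i => Odd (k i)) : Finset (Fin n)) := by
      ext i; simp [hk']
    rw [h1, h2, Set.ncard_coe_finset, ← Int.natAbs_odd]
    -- An integer and its absolute value have the same parity; natural numbers are needed to count
    -- the odd summands.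
    have h3 : ((∑ i, k i : ℤ) : ZMod 2) = ((∑ i, (k i).natAbs : ℕ) : ZMod 2) := by
      push_cast
      refine Finset.sum_congr rfl fun i _ => ?_
      rcases Int.natAbs_eq (k i) with h | h
      · conv_lhs => rw [h]
        simp
      · conv_lhs => rw [h]
        simp
    have h4 : Odd (∑ i, (k i).natAbs) ↔ Odd (∑ i, k i) := by
      rw [← Int.odd_coe_nat, ← ZMod.intCast_eq_one_iff_odd, ← ZMod.intCast_eq_one_iff_odd, h3]
      simp
    rw [Int.natAbs_odd, ← h4, Finset.odd_sum_iff_odd_card_odd]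
    simp [Int.natAbs_odd]

end Polygon

end

/-! ### The signed area form, and sides of the boundary -/

section

namespace Plane

/-- The signed area form, with a chosen sign. -/
noncomputable def wedge (ε : ℝ) : Plane →ₗ[ℝ] Plane →ₗ[ℝ] ℝ :=
  LinearMap.mk₂ ℝ (fun x y => ε * (x 0 * y 1 - x 1 * y 0))
    (by intros; simp; ring) (by intros; simp; ring) (by intros; simp; ring) (by intros; simp; ring)

lemma wedge_apply (ε : ℝ) (x y : Plane) : wedge ε x y = ε * (x 0 * y 1 - x 1 * y 0) := rfl

@[simp] lemma wedge_self (ε : ℝ) (x : Plane) : wedge ε x x = 0 := by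
  rw [wedge_apply]; ring

lemma wedge_swap (ε : ℝ) (x y : Plane) : wedge ε y x = -wedge ε x y := by
  rw [wedge_apply, wedge_apply]; ring

lemma wedge_neg_sign (ε : ℝ) (x y : Plane) : wedge (-ε) x y = -wedge ε x y := by
  rw [wedge_apply, wedge_apply]; ring

/-- Cramer's rule. -/
lemma wedge_smul_eq (ε : ℝ) (a b c : Plane) :
    wedge ε a b • c = wedge ε c b • a + wedge ε a c • b := by
  ext i
  fin_cases i <;> simp [wedge_apply] <;> ring

lemma continuous_wedge (ε : ℝ) (a : Plane) : Continuous (wedge ε a) :=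
  (wedge ε a).continuous_of_finiteDimensional

end Plane

namespace Polygon

open Plane

variable {n : ℕ} [NeZero n]

lemma continuousAt_windingAngle {P : Polygon Plane n} {x : Plane} (hx : x ∉ P.boundary ℝ) :
    ContinuousAt P.windingAngle x := by
  rw [notMem_boundary_iff] at hx
  have hc := continuous_toC
  refine tendsto_finsetSum _ fun i _ => ?_
  have hs := notMem_segment_iff.1 (hx i)
  have h0 := (Complex.ne_zero_of_div_mem_slitPlane hs).1
  have : ContinuousAt (fun y => (toC (P (i + 1)) - toC y) / (toC (P i) - toC y)) x :=
    ContinuousAt.div (by fun_prop) (by fun_prop) h0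
  exact ContinuousAt.comp (f := fun y => (toC (P (i + 1)) - toC y) / (toC (P i) - toC y))
    (Complex.continuousAt_arg hs) this

/-- Points joined by a segment that misses the boundary lie on the same side of it. -/
lemma mem_region_iff_of_segment {P : Polygon Plane n} {x y : Plane}
    (h : ∀ z ∈ segment ℝ x y, z ∉ P.boundary ℝ) : x ∈ P.region ↔ y ∈ P.region := by
  have hpi := Real.pi_pos
  obtain ⟨k, hk, hk'⟩ := exists_windingAngle_eq (h x (left_mem_segment _ _ _))
  obtain ⟨l, hl, hl'⟩ := exists_windingAngle_eq (h y (right_mem_segment _ _ _))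
  suffices k = l by rw [hk', hl', this]
  by_contra hne
  have hc : ContinuousOn P.windingAngle (segment ℝ x y) := fun z hz =>
    (continuousAt_windingAngle (h z hz)).continuousWithinAt
  have hp := ((convex_segment (𝕜 := ℝ) x y).isPreconnected.image _ hc).ordConnected
  -- By connectedness the winding angle would take a value halfway between consecutive multiples of
  -- `2π`, which is not itself such a multiple.
  have aux : ∀ a b : ℤ, a < b → 2 * Real.pi * (a : ℝ) ∈ P.windingAngle '' segment ℝ x y →
      2 * Real.pi * (b : ℝ) ∈ P.windingAngle '' segment ℝ x y → False := by
    intro a b hab ha hb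
    have hab' : (a : ℝ) + 1 ≤ b := by exact_mod_cast hab
    have : 2 * Real.pi * ((a : ℝ) + 1 / 2) ∈ P.windingAngle '' segment ℝ x y :=
      hp.out ha hb ⟨by nlinarith, by nlinarith⟩
    obtain ⟨z, hz, hz'⟩ := this
    obtain ⟨m, hm, -⟩ := exists_windingAngle_eq (h z hz)
    rw [hz'] at hm
    have h2 : (a : ℝ) + 1 / 2 = m := mul_left_cancel₀ (by positivity) hm
    have h3 : (2 * a + 1 : ℤ) = 2 * m := by
      have : (2 * (a : ℝ) + 1) = 2 * m := by linarith
      exact_mod_cast this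
    omega
  rcases lt_or_gt_of_ne hne with hlt | hlt
  · exact aux k l hlt (hk ▸ ⟨x, left_mem_segment _ _ _, rfl⟩) (hl ▸ ⟨y, right_mem_segment _ _ _, rfl⟩)
  · exact aux l k hlt (hl ▸ ⟨y, right_mem_segment _ _ _, rfl⟩) (hk ▸ ⟨x, left_mem_segment _ _ _, rfl⟩)

end Polygon

lemma Plane.im_div_toC_nonneg_iff {d z : Plane} (hd : d ≠ 0) :
    0 ≤ (toC z / toC d).im ↔ 0 ≤ wedge 1 d z := by
  have : toC d ≠ 0 := fun h => hd (toC_injective (by simpa using h))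
  rw [Complex.im_div_nonneg_iff this, wedge_apply, one_mul]
  rfl

/-- Every weak half plane, for either sign of the area form, is given by a complex direction. -/
lemma Plane.exists_halfplane {ε : ℝ} (hε : ε = 1 ∨ ε = -1) {d : Plane} (hd : d ≠ 0) :
    ∃ u : ℂ, u ≠ 0 ∧ ∀ z, 0 ≤ wedge ε d z → 0 ≤ (toC z / u).im := by
  have h0 : toC d ≠ 0 := fun h => hd (toC_injective (by simpa using h))
  rcases hε with rfl | rfl
  · exact ⟨toC d, h0, fun z hz => (im_div_toC_nonneg_iff hd).2 hz⟩
  · refine ⟨toC (-d), by simpa using h0, fun z hz => (im_div_toC_nonneg_iff (by simpa)).2 ?_⟩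
    rw [wedge_neg_sign] at hz
    simpa using hz

namespace Polygon

open Plane

variable {n : ℕ} [NeZero n]

/-- A point off the boundary is outside if a line through it has all vertices on one side. -/
lemma notMem_region_of_halfplane {P : Polygon Plane n} {x d : Plane} {ε : ℝ}
    (hε : ε = 1 ∨ ε = -1) (hx : x ∉ P.boundary ℝ) (hd : d ≠ 0)
    (h : ∀ i, 0 ≤ wedge ε d (P i - x)) : x ∉ P.region := by
  obtain ⟨u, hu, hu'⟩ := exists_halfplane hε hd
  obtain ⟨k, hk, hk'⟩ := exists_windingAngle_eq hx
  rw [notMem_boundary_iff] at hx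
  have h1 : ∀ i, Complex.arg ((toC (P (i + 1)) - toC x) / (toC (P i) - toC x)) =
      Complex.arg ((toC (P (i + 1)) - toC x) / u) - Complex.arg ((toC (P i) - toC x) / u) := by
    intro i
    refine Complex.arg_div_of_im_nonneg hu ?_ ?_ (notMem_segment_iff.1 (hx i))
    · rw [← map_sub]; exact hu' _ (h i)
    · rw [← map_sub]; exact hu' _ (h (i + 1))
  -- Arguments measured from `u` are single-valued on the half plane, so their differences cancel
  -- around the closed boundary.
  have h2 : P.windingAngle x = 0 := by
    simp only [windingAngle, h1, Finset.sum_sub_distrib]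
    rw [sub_eq_zero]
    exact Equiv.sum_comp (Equiv.addRight (1 : Fin n))
      fun i => Complex.arg ((toC (P i) - toC x) / u)
  rw [h2] at hk
  have : k = 0 := by
    have := Real.pi_pos
    have : (k : ℝ) = 0 := by
      rcases mul_eq_zero.1 hk.symm with h | h
      · linarith
      · exact h
    exact_mod_cast this
  rw [hk', this]
  decide

end Polygon

end

/-! ### The sum of the turning angles of a simple polygon -/

open Complex in
/-- The four directions between the ends of two disjoint segments lie in a half plane, so the angles
between them add up. -/
lemma Complex.arg_add_arg_of_disjoint_segment {a b c d : ℂ}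
    (h : Disjoint (segment ℝ a b) (segment ℝ c d)) :
    arg ((c - b) / (c - a)) + arg ((d - b) / (c - b)) =
      arg ((d - a) / (c - a)) + arg ((d - b) / (d - a)) := by
  have hcl : IsClosed (segment ℝ c d) := by
    rw [segment_eq_image_lineMap]
    exact (isCompact_Icc.image (by fun_prop)).isClosed
  have hco : IsCompact (segment ℝ a b) := by
    rw [segment_eq_image_lineMap]
    exact isCompact_Icc.image (by fun_prop)
  -- A separating functional is positive on all four differences of ends. Division by `D⁻¹`, a
  -- direction on which it vanishes, turns it into the imaginary part.
  obtain ⟨f, s, t, h1, h2, h3⟩ := geometric_hahn_banach_compact_closed (convex_segment a b) hco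
    (convex_segment c d) hcl h
  have ha := h1 a (left_mem_segment _ _ _)
  have hb := h1 b (right_mem_segment _ _ _)
  have hc := h3 c (left_mem_segment _ _ _)
  have hd := h3 d (right_mem_segment _ _ _)
  set D : ℂ := ⟨f I, f 1⟩ with hD
  have hf : ∀ z, (z / D⁻¹).im = f z := by
    intro z
    have : z = z.re • (1 : ℂ) + z.im • I := by
      simp [Complex.re_add_im]
    conv_rhs => rw [this]
    rw [div_inv_eq_mul, mul_im, map_add, map_smul, map_smul]
    simp [hD]
  have hD0 : D⁻¹ ≠ 0 := by
    intro h0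
    have := hf (c - a)
    rw [h0] at this
    simp at this
    linarith
  have key : ∀ z w : ℂ, 0 < f z → 0 < f w → arg (w / z) = arg (w / D⁻¹) - arg (z / D⁻¹) := by
    intro z w hz hw
    refine arg_div_of_im_nonneg hD0 (by rw [hf]; exact hz.le) (by rw [hf]; exact hw.le) ?_
    rw [← zero_notMem_segment_iff]
    rintro ⟨x, y, hx, hy, hxy, h0⟩
    have := congrArg f h0
    simp only [map_add, map_smul, smul_eq_mul, map_zero] at this
    rcases eq_or_lt_of_le hx with rfl | hx
    · have : y = 1 := by linarith
      subst this; simp at this; linarith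
    · have := mul_pos hx hz
      have := mul_nonneg hy hw.le
      linarith
  have p1 : 0 < f (c - a) := by rw [map_sub]; linarith
  have p2 : 0 < f (c - b) := by rw [map_sub]; linarith
  have p3 : 0 < f (d - a) := by rw [map_sub]; linarith
  have p4 : 0 < f (d - b) := by rw [map_sub]; linarith
  rw [key _ _ p1 p2, key _ _ p2 p4, key _ _ p1 p3, key _ _ p3 p4]
  ring

open Complex Finset in
/-- In a simple polygon, the turning angles add up to twice the angle swept at a vertex by the other
vertices plus twice the turning angle there. -/
theorem Complex.sum_turning_eq (q : ℕ → ℂ) {m : ℕ} (hm : 2 ≤ m)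
    (h0 : q (m + 1) = q 0) (h1 : q (m + 2) = q 1)
    (hdisj : ∀ i j, i + 1 < j → j ≤ m → ¬ (i = 0 ∧ j = m) →
      Disjoint (segment ℝ (q i) (q (i + 1))) (segment ℝ (q j) (q (j + 1))))
    (hturn : ∀ k, k ≤ m → ((q (k + 2) - q (k + 1)) / (q (k + 1) - q k)).im ≠ 0) :
    ∑ k ∈ range (m + 1), arg ((q (k + 2) - q (k + 1)) / (q (k + 1) - q k)) =
      2 * (∑ k ∈ Ico 1 m, arg ((q (k + 1) - q 0) / (q k - q 0))) +
      2 * arg ((q 1 - q 0) / (q 0 - q m)) := by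
  set τ : ℕ → ℝ := fun k => arg ((q (k + 2) - q (k + 1)) / (q (k + 1) - q k)) with hτ
  set S : ℕ → ℝ := fun i => ∑ k ∈ range i, τ k with hS
  -- `S i + Lr i j` lifts the argument of the chord from `q i` to `q j`, measured from the first
  -- edge: turn along the boundary to edge `i`, then sweep from `q i`. As in Hopf's proof the lift
  -- is consistent over the triangle `i < j`: `vert` says that moving the tail changes it by a
  -- principal angle, because edges `i` and `j` are disjoint. The degenerate chord from `q 0` to `q
  -- (m + 1)` is left out.
  set Lr : ℕ → ℕ → ℝ := fun i j =>
    ∑ k ∈ Ico (i + 1) j, arg ((q (k + 1) - q i) / (q k - q i)) with hL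
  have vert : ∀ i j, i + 2 ≤ j → j ≤ m + 1 → ¬ (i = 0 ∧ j = m + 1) →
      S (i + 1) + Lr (i + 1) j = S i + Lr i j + arg ((q j - q (i + 1)) / (q j - q i)) := by
    intro i j hij
    induction j, hij using Nat.le_induction with
    | base =>
      intro hj _
      have e1 : S (i + 1) = S i + τ i := sum_range_succ _ _
      have e2 : Lr (i + 1) (i + 2) = 0 := by simp [hL]
      have e3 : Lr i (i + 2) = arg ((q (i + 2) - q i) / (q (i + 1) - q i)) := by simp [hL]
      have e4 := arg_div_add_arg_div (hturn i (by omega))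
      have e5 : q (i + 1) - q i + (q (i + 2) - q (i + 1)) = q (i + 2) - q i := by ring
      rw [e5] at e4
      rw [e1, e2, e3]
      simp only [hτ]
      linarith
    | succ j hj ih =>
      intro hj' hne
      have ih := ih (by omega) (by omega)
      have e1 : Lr (i + 1) (j + 1) =
          Lr (i + 1) j + arg ((q (j + 1) - q (i + 1)) / (q j - q (i + 1))) :=
        sum_Ico_succ_top (by omega) _
      have e2 : Lr i (j + 1) = Lr i j + arg ((q (j + 1) - q i) / (q j - q i)) :=
        sum_Ico_succ_top (by omega) _
      have e3 := arg_add_arg_of_disjoint_segment (hdisj i j (by omega) (by omega) (by omega))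
      rw [e1, e2]
      linarith
  set Φ : ℝ := ∑ k ∈ Ico 1 m, arg ((q (k + 1) - q 0) / (q k - q 0)) with hΦ
  -- The chords ending at `q (m + 1) = q 0` are the reversed chords from `q 0`. Quotients do not
  -- notice the reversal, so the sweep occurs a second time; this is the factor `2`.
  have hcol : ∀ i, 1 ≤ i → i ≤ m → S i + Lr i (m + 1) =
      S 1 + Lr 1 (m + 1) + ∑ k ∈ Ico 1 i, arg ((q (k + 1) - q 0) / (q k - q 0)) := by
    intro i hi
    induction i, hi using Nat.le_induction with
    | base => simp
    | succ i hi ih =>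
      intro hi'
      rw [vert i (m + 1) (by omega) le_rfl (by omega), ih (by omega), sum_Ico_succ_top hi, h0,
        ← neg_sub (q (i + 1)) (q 0), ← neg_sub (q i) (q 0), neg_div_neg_eq]
      ring
  have c1 := hcol m (by omega) le_rfl
  have c2 : Lr m (m + 1) = 0 := by simp [hL]
  have c3 : Lr 1 (m + 1) = Lr 1 m + arg ((q 0 - q 1) / (q m - q 1)) := by
    rw [← h0]; exact sum_Ico_succ_top (by omega) _
  have c4 := vert 0 m (by omega) (by omega) (by omega)
  have c5 : S 0 = 0 := by simp [hS]
  have c6 : Lr 0 m = Φ := rfl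
  have c7 : τ m = arg ((q 1 - q 0) / (q 0 - q m)) := by simp only [hτ, h0, h1]
  have c8 : arg ((q m - q 1) / (q m - q 0)) + arg ((q 0 - q 1) / (q m - q 1)) = τ m := by
    have e : (q 0 - q 1) / (q m - q 0) = (q 1 - q 0) / (q 0 - q m) := by
      rw [← neg_sub, ← neg_sub (q 0) (q m), neg_div_neg_eq]
    have := hturn m le_rfl
    rw [h0, h1, ← e] at this
    have := arg_div_add_arg_div this
    rw [show q m - q 0 + (q 0 - q 1) = q m - q 1 by ring] at this
    rw [this, c7, e]
  rw [sum_range_succ]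
  change S m + τ m = _
  rw [← c7]
  simp only [zero_add] at c4
  linarith

open Complex in
lemma Complex.arg_bounds_of_im_ne_zero {z : ℂ} (h : z.im ≠ 0) :
    arg z ≠ 0 ∧ -Real.pi < arg z ∧ arg z < Real.pi := by
  refine ⟨fun h' => h (arg_eq_zero_iff.1 h').2, neg_pi_lt_arg z, ?_⟩
  exact lt_of_le_of_ne (arg_le_pi z) fun h' => h (arg_eq_pi_iff.1 h').2

open Complex in
lemma Complex.arg_neg_of_im_ne_zero {z : ℂ} (h : z.im ≠ 0) :
    arg (-z) = if 0 < arg z then arg z - Real.pi else arg z + Real.pi := by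
  rcases lt_or_gt_of_ne h with h1 | h1
  · rw [if_neg (not_lt.2 (arg_neg_iff.2 h1).le), arg_neg_eq_arg_add_pi_of_im_neg h1]
  · have h2 : 0 < arg z :=
      lt_of_le_of_ne (arg_nonneg_iff.2 h1.le) (arg_bounds_of_im_ne_zero h).1.symm
    rw [if_pos h2, arg_neg_eq_arg_sub_pi_of_im_pos h1]

open Complex in
lemma Complex.arg_pos_iff_im_pos {z : ℂ} (h : z.im ≠ 0) : 0 < arg z ↔ 0 < z.im := by
  rcases lt_or_gt_of_ne h with h1 | h1
  · have := arg_neg_iff.2 h1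
    constructor <;> intro <;> linarith
  · refine ⟨fun _ => h1, fun _ => lt_of_le_of_ne (arg_nonneg_iff.2 h1.le)
      (arg_bounds_of_im_ne_zero h).1.symm⟩

open Complex in
/-- The angle from `-a` to `b` through the outer bisector of the corner with sides `-a` and `b`. -/
lemma Complex.arg_outer {a b : ℂ} (h : (b / a).im ≠ 0) :
    arg ((a - b) / (-a)) + arg (b / (a - b)) =
      if 0 < arg (b / a) then arg (b / a) + Real.pi else arg (b / a) - Real.pi := by
  have ha : a ≠ 0 := by rintro rfl; simp at h
  have h0 : a.re * b.im - a.im * b.re ≠ 0 := fun h' => h ((im_div_eq_zero_iff ha).2 h')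
  have hs : a - b ≠ 0 := fun h' => by
    apply h0
    rw [sub_eq_zero] at h'
    simp [h']; ring
  have h' : ((-b) / a).im ≠ 0 := by rw [neg_div, neg_im]; simpa using h
  have key := arg_div_add_arg_div h'
  rw [← sub_eq_add_neg] at key
  have i1 : ((a - b) / a).im ≠ 0 := fun h1 => h0 (by
    rw [im_div_eq_zero_iff ha] at h1; simp at h1; linarith)
  have i2 : ((-b) / (a - b)).im ≠ 0 := fun h1 => h0 (by
    rw [im_div_eq_zero_iff hs] at h1; simp at h1; linarith)
  have e1 : (a - b) / (-a) = -((a - b) / a) := by rw [div_neg]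
  have e2 : b / (a - b) = -((-b) / (a - b)) := by rw [neg_div, neg_neg]
  have e3 : -b / a = -(b / a) := neg_div _ _
  rw [e1, e2, arg_neg_of_im_ne_zero i1, arg_neg_of_im_ne_zero i2]
  rw [e3, arg_neg_of_im_ne_zero h] at key
  rcases lt_or_gt_of_ne h0 with h1 | h1
  · have j1 : 0 < ((a - b) / a).im := (im_div_pos_iff ha).2 (by simp; linarith)
    have j2 : 0 < ((-b) / (a - b)).im := (im_div_pos_iff hs).2 (by simp; linarith)
    have j3 : ¬ 0 < (b / a).im := by rw [im_div_pos_iff ha]; linarith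
    rw [if_pos ((arg_pos_iff_im_pos i1).2 j1), if_pos ((arg_pos_iff_im_pos i2).2 j2)]
    rw [if_neg (fun hh => j3 ((arg_pos_iff_im_pos h).1 hh))] at key ⊢
    linarith
  · have j1 : ¬ 0 < ((a - b) / a).im := by rw [im_div_pos_iff ha]; simp; linarith
    have j2 : ¬ 0 < ((-b) / (a - b)).im := by rw [im_div_pos_iff hs]; simp; linarith
    have j3 : 0 < (b / a).im := by rw [im_div_pos_iff ha]; linarith
    rw [if_neg (fun hh => j1 ((arg_pos_iff_im_pos i1).1 hh)),
      if_neg (fun hh => j2 ((arg_pos_iff_im_pos i2).1 hh))]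
    rw [if_pos ((arg_pos_iff_im_pos h).2 j3)] at key ⊢
    linarith

section

/-! ### Local orientation of a simple polygon -/

open Fin.CommRing

lemma Fin.sum_add_natCast {n : ℕ} [NeZero n] {M : Type*} [AddCommMonoid M] (i : Fin n)
    (f : Fin n → M) : ∑ k ∈ Finset.range n, f (i + (k : Fin n)) = ∑ j, f j := by
  rw [Finset.sum_range]
  simp only [Fin.cast_val_eq_self]
  exact Equiv.sum_comp (Equiv.addLeft i) f

lemma Fin.natCast_inj_of_lt {n : ℕ} [NeZero n] {a b : ℕ} (ha : a < n) (hb : b < n)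
    (h : (a : Fin n) = (b : Fin n)) : a = b := by
  have := congrArg Fin.val h
  rwa [Fin.val_natCast, Fin.val_natCast, Nat.mod_eq_of_lt ha, Nat.mod_eq_of_lt hb] at this

namespace Plane

lemma collinear_iff_wedge {ε : ℝ} (hε : ε ≠ 0) {x y z : Plane} :
    Collinear ℝ {x, y, z} ↔ wedge ε (y - x) (z - y) = 0 := by
  rw [collinear_iff_of_mem (p₀ := y) (by simp)]
  constructor
  · rintro ⟨v, hv⟩
    obtain ⟨r, hr⟩ := hv x (by simp)
    obtain ⟨s, hs⟩ := hv z (by simp)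
    have h1 : y - x = -(r • v) := by rw [hr]; simp
    have h2 : z - y = s • v := by rw [hs]; simp
    rw [h1, h2]
    simp
  · intro h
    by_cases hxy : y - x = 0
    · have : x = y := (sub_eq_zero.1 hxy).symm
      subst this
      refine ⟨z - x, ?_⟩
      intro p hp
      simp only [Set.mem_insert_iff, Set.mem_singleton_iff] at hp
      rcases hp with rfl | rfl | rfl
      · exact ⟨0, by simp⟩
      · exact ⟨0, by simp⟩
      · exact ⟨1, by simp⟩
    · set a := y - x with ha
      set b := z - y with hb
      rw [wedge_apply, mul_eq_zero, or_iff_right hε] at h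
      have hpos : a 0 ^ 2 + a 1 ^ 2 ≠ 0 := by
        intro h0
        apply hxy
        have h1 : a 0 = 0 := by nlinarith [sq_nonneg (a 0), sq_nonneg (a 1)]
        have h2 : a 1 = 0 := by nlinarith [sq_nonneg (a 0), sq_nonneg (a 1)]
        ext i
        fin_cases i
        · exact h1
        · exact h2
      have hba : b = ((a 0 * b 0 + a 1 * b 1) / (a 0 ^ 2 + a 1 ^ 2)) • a := by
        ext i
        fin_cases i
        · simp; field_simp; linear_combination (-a 1) * h
        · simp; field_simp; linear_combination (a 0) * h
      refine ⟨a, ?_⟩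
      intro p hp
      simp only [Set.mem_insert_iff, Set.mem_singleton_iff] at hp
      rcases hp with rfl | rfl | rfl
      · exact ⟨-1, by simp [ha]⟩
      · exact ⟨0, by simp⟩
      · exact ⟨_, by rw [← hba, hb]; simp⟩

lemma im_div_toC_ne_zero {a b : Plane} (h : wedge 1 a b ≠ 0) : (toC b / toC a).im ≠ 0 := by
  have ha : toC a ≠ 0 := by
    intro h0
    have : a = 0 := toC_injective (by simpa using h0)
    simp [this] at h
  rw [Ne, Complex.im_div_eq_zero_iff ha]
  simpa [wedge_apply] using h

lemma disjoint_segment_toC {a b c d : Plane} (h : Disjoint (segment ℝ a b) (segment ℝ c d)) :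
    Disjoint (segment ℝ (toC a) (toC b)) (segment ℝ (toC c) (toC d)) := by
  have e : ∀ x y, segment ℝ (toC x) (toC y) = toC '' segment ℝ x y := fun x y =>
    (image_segment ℝ toC.toAffineMap x y).symm
  rw [e, e]
  exact (Set.disjoint_image_iff toC_injective).2 h

end Plane

namespace Polygon

open Plane

variable {n : ℕ} [NeZero n]

/-- The turning angle of a polygon at a vertex. -/
noncomputable def turn (P : Polygon Plane n) (i : Fin n) : ℝ :=
  Complex.arg (toC (P (i + 1) - P i) / toC (P i - P (i - 1)))

lemma IsSimple.disjoint_edges {P : Polygon Plane n} (h : P.IsSimple) {i j : Fin n}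
    (h0 : i ≠ j) (h1 : j ≠ i + 1) (h2 : i ≠ j + 1) :
    Disjoint (segment ℝ (P i) (P (i + 1))) (segment ℝ (P j) (P (j + 1))) := by
  rw [Set.disjoint_left]
  intro x hx hy
  rcases h.2.2 i j h0 x (by rw [edgeSet_eq_segment, edgeSet_eq_segment]; exact ⟨hx, hy⟩) with h | h
  · exact h1 h.1
  · exact h2 h.1

lemma IsSimple.vertex_notMem_edge {P : Polygon Plane n} (h : P.IsSimple) {i j : Fin n}
    (h0 : i ≠ j) (h2 : i ≠ j + 1) : P i ∉ segment ℝ (P j) (P (j + 1)) := by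
  intro hx
  rcases h.2.2 i j h0 (P i) (by
    rw [edgeSet_eq_segment, edgeSet_eq_segment]; exact ⟨left_mem_segment _ _ _, hx⟩) with h' | h'
  · exact h0 (h.2.1 h'.2)
  · exact h2 h'.1

/-- The vertices of a polygon, read off from a given one as complex numbers. -/
noncomputable def toCFrom (P : Polygon Plane n) (i : Fin n) (k : ℕ) : ℂ := toC (P (i + (k : Fin n)))

lemma toCFrom_add_self (P : Polygon Plane n) (i : Fin n) (k : ℕ) :
    P.toCFrom i (k + n) = P.toCFrom i k := by
  have : ((k + n : ℕ) : Fin n) = (k : Fin n) := by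
    ext
    simp
  rw [toCFrom, this]
  rfl

lemma toCFrom_zero (P : Polygon Plane n) (i : Fin n) : P.toCFrom i 0 = toC (P i) := by
  simp [toCFrom]

lemma toCFrom_one (P : Polygon Plane n) (i : Fin n) : P.toCFrom i 1 = toC (P (i + 1)) := by
  simp [toCFrom]

lemma toCFrom_succ (P : Polygon Plane n) (i : Fin n) (k : ℕ) :
    P.toCFrom i (k + 1) = toC (P (i + (k : Fin n) + 1)) := by
  simp [toCFrom, add_assoc]

lemma toCFrom_pred (P : Polygon Plane n) (i : Fin n) {m : ℕ} (hm : m + 1 = n) :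
    P.toCFrom i m = toC (P (i - 1)) := by
  have : (m : Fin n) = -1 := by
    rw [eq_neg_iff_add_eq_zero]
    have : ((m + 1 : ℕ) : Fin n) = 0 := by rw [hm]; ext; simp
    exact_mod_cast this
  rw [toCFrom, this, sub_eq_add_neg]

/-- The angle swept by the vertices as seen from one of them. -/
noncomputable def sweep (P : Polygon Plane n) (i : Fin n) : ℝ :=
  ∑ k ∈ Finset.Ico 1 (n - 1),
    Complex.arg ((P.toCFrom i (k + 1) - P.toCFrom i 0) / (P.toCFrom i k - P.toCFrom i 0))

/-- No three consecutive vertices are collinear. -/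
def Bends (P : Polygon Plane n) : Prop :=
  ∀ i, (toC (P (i + 1) - P i) / toC (P i - P (i - 1))).im ≠ 0

lemma sum_turn_eq {P : Polygon Plane n} (h : P.IsSimple) (hb : P.Bends) (i : Fin n) :
    ∑ j, P.turn j = 2 * P.sweep i + 2 * P.turn i := by
  obtain ⟨m, rfl⟩ : ∃ m, n = m + 1 := ⟨n - 1, by have := h.1; omega⟩
  have hm : 2 ≤ m := by have := h.1; omega
  have h0 : P.toCFrom i (m + 1) = P.toCFrom i 0 := by
    have := P.toCFrom_add_self i 0
    rwa [zero_add] at this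
  have h1 : P.toCFrom i (m + 2) = P.toCFrom i 1 := by
    have := P.toCFrom_add_self i 1
    rwa [show 1 + (m + 1) = m + 2 by ring] at this
  have hratio : ∀ k : ℕ, (P.toCFrom i (k + 2) - P.toCFrom i (k + 1)) /
      (P.toCFrom i (k + 1) - P.toCFrom i k) =
      toC (P (i + (k : Fin (m + 1)) + 1 + 1) - P (i + (k : Fin (m + 1)) + 1)) /
      toC (P (i + (k : Fin (m + 1)) + 1) - P (i + (k : Fin (m + 1)) + 1 - 1)) := by
    intro k
    rw [toCFrom_succ P i k, toCFrom_succ P i (k + 1), map_sub, map_sub, add_sub_cancel_right]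
    push_cast
    rw [← add_assoc]
    rfl
  have key := Complex.sum_turning_eq (P.toCFrom i) hm h0 h1 ?_ ?_
  · have e1 : ∑ k ∈ Finset.range (m + 1), Complex.arg
        ((P.toCFrom i (k + 2) - P.toCFrom i (k + 1)) / (P.toCFrom i (k + 1) - P.toCFrom i k)) =
        ∑ j, P.turn j := by
      rw [← Equiv.sum_comp (Equiv.addRight (1 : Fin (m + 1))) P.turn,
        ← Fin.sum_add_natCast i]
      exact Finset.sum_congr rfl fun k _ => by rw [hratio]; rfl
    have e2 : Complex.arg ((P.toCFrom i 1 - P.toCFrom i 0) / (P.toCFrom i 0 - P.toCFrom i m)) =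
        P.turn i := by
      rw [toCFrom_zero, toCFrom_one, toCFrom_pred P i rfl, turn, map_sub, map_sub]
    rw [← e1, key, e2]
    rfl
  · intro a b hab hbm hne
    rw [toCFrom_succ, toCFrom_succ]
    have hs : ∀ x : ℕ, ((x : Fin (m + 1)) + 1) = ((x + 1 : ℕ) : Fin (m + 1)) := by
      intro x; push_cast; rfl
    have hself : ((m + 1 : ℕ) : Fin (m + 1)) = ((0 : ℕ) : Fin (m + 1)) := by ext; simp
    unfold toCFrom
    refine disjoint_segment_toC (h.disjoint_edges ?_ ?_ ?_)
    · intro hh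
      have := Fin.natCast_inj_of_lt (by omega) (by omega) (add_left_cancel hh)
      omega
    · rw [add_assoc, hs]
      intro hh
      have := Fin.natCast_inj_of_lt (by omega) (by omega) (add_left_cancel hh)
      omega
    · rw [add_assoc, hs]
      intro hh
      have hh := add_left_cancel hh
      rcases eq_or_lt_of_le hbm with rfl | hlt
      · rw [hself] at hh
        have := Fin.natCast_inj_of_lt (by omega) (by omega) hh
        omega
      · have := Fin.natCast_inj_of_lt (by omega) (by omega) hh
        omega
  · intro k _
    rw [hratio]
    exact hb _

/-- Edges not incident to a vertex miss it, so they are never seen from there under a straight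
angle. -/
lemma slit_sweep {P : Polygon Plane n} (h : P.IsSimple) (i : Fin n) {k : ℕ} (hk : 1 ≤ k)
    (hk' : k + 1 < n) :
    (P.toCFrom i (k + 1) - P.toCFrom i 0) / (P.toCFrom i k - P.toCFrom i 0) ∈
      Complex.slitPlane := by
  rw [toCFrom_zero, toCFrom_succ, toCFrom, ← notMem_segment_iff]
  have hs : ((k : Fin n) + 1) = ((k + 1 : ℕ) : Fin n) := by push_cast; rfl
  refine h.vertex_notMem_edge ?_ ?_
  · intro hh
    have hh : ((0 : ℕ) : Fin n) = (k : Fin n) := by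
      have := left_eq_add.1 hh
      simpa using this.symm
    have := Fin.natCast_inj_of_lt (by omega) (by omega) hh
    omega
  · intro hh
    rw [add_assoc, hs] at hh
    have hh : ((0 : ℕ) : Fin n) = ((k + 1 : ℕ) : Fin n) := by
      have := left_eq_add.1 hh
      rw [this]; simp
    have := Fin.natCast_inj_of_lt (by omega) (by omega) hh
    omega

/-- The turning angles of a simple polygon add up to `2π` or to `-2π`. -/
theorem exists_sum_turn_eq {P : Polygon Plane n} (h : P.IsSimple) (hb : P.Bends) :
    ∃ ε : ℝ, (ε = 1 ∨ ε = -1) ∧ ∑ j, P.turn j = 2 * Real.pi * ε := by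
  -- Seen from a lowest vertex all others are in the upper half plane, so the sweep is a difference
  -- of two principal arguments. The turn there is minus the sweep, up to `π` or `-π`, which leaves
  -- a total of `±2π`.
  obtain ⟨i, -, hi⟩ := Finset.exists_min_image Finset.univ (fun i => P i 1) ⟨0, Finset.mem_univ _⟩
  have hn := h.1
  have him : ∀ k, 0 ≤ ((P.toCFrom i k - P.toCFrom i 0) / 1).im := by
    intro k
    rw [div_one, toCFrom_zero, toCFrom]
    simpa using hi _ (Finset.mem_univ _)
  have hsw : P.sweep i = Complex.arg (P.toCFrom i (n - 1) - P.toCFrom i 0) -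
      Complex.arg (P.toCFrom i 1 - P.toCFrom i 0) := by
    have := Complex.sum_arg_div_of_im_nonneg (u := 1) one_ne_zero
      (fun k => P.toCFrom i k - P.toCFrom i 0) (show 1 ≤ n - 1 by omega)
      (fun k _ _ => him k) (fun k h1 h2 => slit_sweep h i h1 (by omega))
    rw [div_one, div_one] at this
    exact this
  have hbi := hb i
  have e : toC (P (i + 1) - P i) / toC (P i - P (i - 1)) =
      -((P.toCFrom i 1 - P.toCFrom i 0) / (P.toCFrom i (n - 1) - P.toCFrom i 0)) := by
    rw [toCFrom_zero, toCFrom_one, toCFrom_pred P i (show n - 1 + 1 = n by omega), map_sub, map_sub,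
      ← div_neg, neg_sub]
  have hbi' : ((P.toCFrom i 1 - P.toCFrom i 0) / (P.toCFrom i (n - 1) - P.toCFrom i 0)).im ≠ 0 := by
    rw [e] at hbi
    simpa using hbi
  have h1 := Complex.arg_div_of_im_nonneg one_ne_zero (him (n - 1)) (him 1) (Or.inr hbi')
  rw [div_one, div_one] at h1
  have h2 := sum_turn_eq h hb i
  have h3 := Complex.arg_neg_of_im_ne_zero hbi'
  rw [← e, h1] at h3
  change P.turn i = _ at h3
  split_ifs at h3
  · exact ⟨-1, Or.inr rfl, by rw [h2, h3, hsw]; ring⟩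
  · exact ⟨1, Or.inl rfl, by rw [h2, h3, hsw]; ring⟩

end Polygon

end

/-! ### The winding angle near a vertex, and orientation -/

section

open Fin.CommRing

/-- Positive real factors do not change an argument. This removes the factors `t` and `t⁻¹` by which
the quotients at the approached vertex vanish or blow up. -/
lemma Complex.tendsto_arg_of_pos_mul {f ρ : ℝ → ℂ} {r : ℂ} (hr : r ∈ Complex.slitPlane)
    (hρ : Filter.Tendsto ρ (𝓝[>] 0) (𝓝 r))
    (hf : ∀ t, 0 < t → ∃ c : ℝ, 0 < c ∧ f t = c * ρ t) :
    Filter.Tendsto (fun t => Complex.arg (f t)) (𝓝[>] 0) (𝓝 (Complex.arg r)) ∧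
      ∀ᶠ t in 𝓝[>] 0, f t ∈ Complex.slitPlane := by
  constructor
  · refine Filter.Tendsto.congr' ?_ ((Complex.continuousAt_arg hr).tendsto.comp hρ)
    filter_upwards [self_mem_nhdsWithin] with t ht
    obtain ⟨c, hc, h⟩ := hf t ht
    rw [h, Complex.arg_real_mul _ hc]
    rfl
  · filter_upwards [self_mem_nhdsWithin, hρ (Complex.isOpen_slitPlane.mem_nhds hr)] with t ht ht'
    obtain ⟨c, hc, h⟩ := hf t ht
    have h1 : ρ t ∈ Complex.slitPlane := ht'
    rw [Complex.mem_slitPlane_iff_arg] at h1 ⊢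
    rw [h, Complex.arg_real_mul _ hc]
    exact ⟨h1.1, mul_ne_zero (by exact_mod_cast hc.ne') h1.2⟩

namespace Polygon

open Plane

variable {n : ℕ} [NeZero n]

/-- The points near a vertex on the median there. -/
noncomputable def medianPoint (P : Polygon Plane n) (i : Fin n) (t : ℝ) : Plane :=
  P i + t • ((P (i - 1) - P i) + (P (i + 1) - P i))

lemma windingAngle_eq_sum (P : Polygon Plane n) (i : Fin n) (x : Plane) :
    P.windingAngle x = ∑ k ∈ Finset.range n,
      Complex.arg ((P.toCFrom i (k + 1) - toC x) / (P.toCFrom i k - toC x)) := by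
  rw [windingAngle, ← Fin.sum_add_natCast i]
  exact Finset.sum_congr rfl fun k _ => by rw [toCFrom_succ, toCFrom]

/-- Edges away from the vertex converge to their share of the sweep. The two edges at the vertex
together contribute the angle through the outer bisector, which by `Complex.arg_outer` is the turn
shifted by `π` in the direction of its sign. -/
lemma tendsto_windingAngle_medianPoint {P : Polygon Plane n} (h : P.IsSimple) (hb : P.Bends)
    (i : Fin n) :
    Filter.Tendsto (fun t => P.windingAngle (P.medianPoint i t)) (𝓝[>] 0)
      (𝓝 (P.sweep i + if 0 < P.turn i then P.turn i + Real.pi else P.turn i - Real.pi)) ∧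
    ∀ᶠ t in 𝓝[>] 0, P.medianPoint i t ∉ P.boundary ℝ := by
  have hn := h.1
  obtain ⟨m, rfl⟩ : ∃ m, n = m + 1 := ⟨n - 1, by omega⟩
  set q := P.toCFrom i with hq
  set a := q 0 - q m with ha
  set b := q 1 - q 0 with hbdef
  have hq0 : q 0 = toC (P i) := toCFrom_zero P i
  have hq1 : q 1 = toC (P (i + 1)) := toCFrom_one P i
  have hqm : q m = toC (P (i - 1)) := toCFrom_pred P i rfl
  have hqn : q (m + 1) = q 0 := by
    have := P.toCFrom_add_self i 0
    rwa [zero_add] at this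
  have hX : ∀ t, toC (P.medianPoint i t) = q 0 - t * (a - b) := by
    intro t
    rw [medianPoint, map_add, map_smul, map_add, map_sub, map_sub, ← hq0, ← hq1, ← hqm,
      Complex.real_smul, ha, hbdef]
    ring
  have hbend : (b / a).im ≠ 0 := by
    have := hb i
    rwa [map_sub, map_sub, ← hq0, ← hq1, ← hqm] at this
  have hturn : P.turn i = Complex.arg (b / a) := by
    rw [turn, map_sub, map_sub, ← hq0, ← hq1, ← hqm]
  have ha0 : a ≠ 0 := by intro h0; simp [h0] at hbend
  have h0 : a.re * b.im - a.im * b.re ≠ 0 := fun h' =>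
    hbend ((Complex.im_div_eq_zero_iff ha0).2 h')
  have hs : a - b ≠ 0 := fun h' => by
    apply h0
    rw [sub_eq_zero] at h'
    rw [h']; ring
  have hna : -a ≠ 0 := neg_ne_zero.2 ha0
  have s1 : (a - b) / (-a) ∈ Complex.slitPlane := Or.inr fun h1 => h0 (by
    rw [Complex.im_div_eq_zero_iff hna] at h1; simp at h1; linarith)
  have s2 : b / (a - b) ∈ Complex.slitPlane := Or.inr fun h1 => h0 (by
    rw [Complex.im_div_eq_zero_iff hs] at h1; simp at h1; linarith)
  have ht0 : Filter.Tendsto (fun t : ℝ => (t : ℂ)) (𝓝[>] 0) (𝓝 0) := by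
    have : Filter.Tendsto (fun t : ℝ => (t : ℂ)) (𝓝 0) (𝓝 ((0 : ℝ) : ℂ)) :=
      Complex.continuous_ofReal.tendsto 0
    rw [Complex.ofReal_zero] at this
    exact this.mono_left nhdsWithin_le_nhds
  have hfirst := Complex.tendsto_arg_of_pos_mul
    (f := fun t => (q (0 + 1) - toC (P.medianPoint i t)) / (q 0 - toC (P.medianPoint i t)))
    (ρ := fun t => (b + t * (a - b)) / (a - b)) (r := b / (a - b)) s2 (by
      have : Filter.Tendsto (fun t : ℝ => (b + t * (a - b)) / (a - b)) (𝓝[>] 0)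
          (𝓝 ((b + 0 * (a - b)) / (a - b))) :=
        ((tendsto_const_nhds.add (ht0.mul tendsto_const_nhds))).div_const _
      simpa using this) (by
      intro t ht
      have htc : (t : ℂ) ≠ 0 := by exact_mod_cast ht.ne'
      refine ⟨t⁻¹, inv_pos.2 ht, ?_⟩
      simp only [hX, hbdef, zero_add]
      push_cast
      rw [show q 0 - (q 0 - (t : ℂ) * (a - (q 1 - q 0))) = (t : ℂ) * (a - b) by rw [hbdef]; ring]
      rw [← hbdef]
      field_simp
      rw [hbdef]
      ring)
  have hlast := Complex.tendsto_arg_of_pos_mul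
    (f := fun t => (q (m + 1) - toC (P.medianPoint i t)) / (q m - toC (P.medianPoint i t)))
    (ρ := fun t => (a - b) / (-a + t * (a - b))) (r := (a - b) / (-a)) s1 (by
      have : Filter.Tendsto (fun t : ℝ => (a - b) / (-a + t * (a - b))) (𝓝[>] 0)
          (𝓝 ((a - b) / (-a + 0 * (a - b)))) :=
        tendsto_const_nhds.div (tendsto_const_nhds.add (ht0.mul tendsto_const_nhds))
          (by simpa using ha0)
      simpa using this) (by
      intro t ht
      refine ⟨t, ht, ?_⟩
      simp only [hX, hqn]
      rw [show q 0 - (q 0 - (t : ℂ) * (a - b)) = (t : ℂ) * (a - b) by ring,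
        show q m - (q 0 - (t : ℂ) * (a - b)) = -a + t * (a - b) by rw [ha]; ring, mul_div_assoc])
  have hmid : ∀ k, 1 ≤ k → k < m → Filter.Tendsto
      (fun t => Complex.arg ((q (k + 1) - toC (P.medianPoint i t)) /
        (q k - toC (P.medianPoint i t)))) (𝓝[>] 0)
        (𝓝 (Complex.arg ((q (k + 1) - q 0) / (q k - q 0)))) ∧
      ∀ᶠ t in 𝓝[>] 0, (q (k + 1) - toC (P.medianPoint i t)) /
        (q k - toC (P.medianPoint i t)) ∈ Complex.slitPlane := by
    intro k hk hk'
    have hslit := slit_sweep h i hk (show k + 1 < m + 1 by omega)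
    refine Complex.tendsto_arg_of_pos_mul (ρ := fun t => (q (k + 1) - toC (P.medianPoint i t)) /
      (q k - toC (P.medianPoint i t))) hslit ?_ (fun t _ => ⟨1, one_pos, by simp⟩)
    have hx : Filter.Tendsto (fun t => toC (P.medianPoint i t)) (𝓝[>] 0) (𝓝 (q 0)) := by
      simp only [hX]
      have : Filter.Tendsto (fun t : ℝ => q 0 - (t : ℂ) * (a - b)) (𝓝[>] 0)
          (𝓝 (q 0 - 0 * (a - b))) :=
        tendsto_const_nhds.sub (ht0.mul tendsto_const_nhds)
      simpa using this
    exact (tendsto_const_nhds.sub hx).div (tendsto_const_nhds.sub hx)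
      (Complex.ne_zero_of_div_mem_slitPlane hslit).1
  constructor
  · have e : ∀ x, P.windingAngle x =
        Complex.arg ((q (0 + 1) - toC x) / (q 0 - toC x)) +
        ∑ k ∈ Finset.Ico 1 m, Complex.arg ((q (k + 1) - toC x) / (q k - toC x)) +
        Complex.arg ((q (m + 1) - toC x) / (q m - toC x)) := by
      intro x
      rw [P.windingAngle_eq_sum i x, Finset.sum_range_succ, Finset.range_eq_Ico,
        Finset.sum_eq_sum_Ico_succ_bot (by omega)]
    simp only [e]
    have hlim := (hfirst.1.add (tendsto_finsetSum _ fun k hk =>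
      (hmid k (Finset.mem_Ico.1 hk).1 (Finset.mem_Ico.1 hk).2).1)).add hlast.1
    convert hlim using 2
    have houter := Complex.arg_outer hbend
    rw [hturn, ← houter]
    simp only [sweep, add_tsub_cancel_right]
    ring
  · have hall : ∀ k ∈ Finset.range (m + 1), ∀ᶠ t in 𝓝[>] (0 : ℝ),
        (q (k + 1) - toC (P.medianPoint i t)) / (q k - toC (P.medianPoint i t)) ∈
          Complex.slitPlane := by
      intro k hk
      have hk := Finset.mem_range.1 hk
      rcases Nat.eq_zero_or_pos k with rfl | hk0
      · exact hfirst.2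
      · rcases eq_or_lt_of_le (Nat.lt_succ_iff.1 hk) with rfl | hkm
        · exact hlast.2
        · exact (hmid k hk0 hkm).2
    filter_upwards [(Filter.eventually_all_finset _).2 hall] with t ht
    rw [notMem_boundary_iff]
    intro j
    rw [notMem_segment_iff]
    have h1 := ht (j - i).val (Finset.mem_range.2 (j - i).isLt)
    rw [hq, toCFrom_succ, toCFrom, Fin.cast_val_eq_self] at h1
    simpa using h1

lemma bends_of_not_collinear {P : Polygon Plane n}
    (h : ∀ i, ¬ Collinear ℝ {P (i - 1), P i, P (i + 1)}) : P.Bends := by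
  intro i
  apply im_div_toC_ne_zero
  rw [Ne, ← collinear_iff_wedge one_ne_zero]
  exact h i

/-- In a simple polygon, the convex vertices are those at which the polygon turns in the direction
in which its boundary runs around it. -/
theorem exists_orientation {P : Polygon Plane n} (h : P.IsSimple) (hb : P.Bends) :
    ∃ ε : ℝ, (ε = 1 ∨ ε = -1) ∧ ∑ j, P.turn j = 2 * Real.pi * ε ∧
      ∀ i, (P.IsConvexVertex i → 0 < ε * P.turn i) ∧ (P.IsReflexVertex i → ε * P.turn i < 0) := by
  obtain ⟨ε, hε, hT⟩ := exists_sum_turn_eq h hb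
  refine ⟨ε, hε, hT, fun i => ?_⟩
  have hpi := Real.pi_pos
  obtain ⟨hlim, hbd⟩ := tendsto_windingAngle_medianPoint h hb i
  have h1 := sum_turn_eq h hb i
  have hne : P.turn i ≠ 0 := (Complex.arg_bounds_of_im_ne_zero (hb i)).1
  -- Since sweep plus turn is `πε`, the limit is `π(ε ± 1)` with the sign of the turn: it is `2πε`
  -- if that sign agrees with `ε`, and `0` otherwise.
  obtain ⟨l, hl, hl'⟩ : ∃ l : ℤ, (P.sweep i + if 0 < P.turn i then P.turn i + Real.pi
      else P.turn i - Real.pi) = 2 * Real.pi * l ∧ (Odd l ↔ 0 < ε * P.turn i) := by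
    rcases lt_or_gt_of_ne hne with ht | ht
    · rw [if_neg ht.not_gt]
      rcases hε with rfl | rfl
      · refine ⟨0, by push_cast; linarith, ?_⟩
        simp [ht.le]
      · refine ⟨-1, by push_cast; linarith, ?_⟩
        simp [ht]
    · rw [if_pos ht]
      rcases hε with rfl | rfl
      · refine ⟨1, by push_cast; linarith, ?_⟩
        simp [ht]
      · refine ⟨0, by push_cast; linarith, ?_⟩
        simp [ht.le]
  rw [hl] at hlim
  have hmem : ∀ᶠ t in 𝓝[>] 0, (P.medianPoint i t ∈ P.region ↔ Odd l) := by
    -- Winding angles off the boundary are multiples of `2π`, so within `2π` of the limit they equal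
    -- it.
    have hnear := hlim (Metric.ball_mem_nhds _ (show 0 < 2 * Real.pi by positivity))
    filter_upwards [hbd, hnear] with t ht ht'
    obtain ⟨k, hk, hk'⟩ := exists_windingAngle_eq ht
    have h3 : P.windingAngle (P.medianPoint i t) ∈ Metric.ball (2 * Real.pi * (l : ℝ))
      (2 * Real.pi) := ht'
    rw [Metric.mem_ball, Real.dist_eq, hk, ← mul_sub, abs_mul, abs_of_pos (by positivity)] at h3
    have h4 : |(k : ℝ) - l| < 1 := by
      by_contra! hc
      nlinarith
    have h5 : |k - l| < 1 := by exact_mod_cast h4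
    have : k = l := by
      have := Int.abs_lt_one_iff.1 h5
      omega
    rw [hk', this]
  constructor
  · rintro ⟨-, hc⟩
    obtain ⟨t, ht, ht'⟩ := (hmem.and hc).exists
    exact hl'.1 (ht.1 ht')
  · rintro ⟨-, hc⟩
    obtain ⟨t, ht, ht'⟩ := (hmem.and hc).exists
    have h5 : ¬ 0 < ε * P.turn i := fun h6 => ht' (ht.2 (hl'.2 h6))
    have h6 : ε * P.turn i ≠ 0 := mul_ne_zero (by rcases hε with rfl | rfl <;> norm_num) hne
    exact lt_of_le_of_ne (not_lt.1 h5) h6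

end Polygon

end

section

open Fin.CommRing

/-! ### Three chains -/

/-- The edge vectors of a sequence of points. -/
def step (p : ℤ → Plane) (k : ℤ) : Plane := p (k + 1) - p k

/-- A closed polygonal line of period `n` composed of three chains, from `p 0` to `p β`, from `p β` to
`p γ` and from `p γ` to `p n = p 0`. Each chain bends strictly to one side, and every edge of a chain
is turned to the other side, by less than a straight angle, against every edge of the preceding
chain. -/
structure TriChain (ε : ℝ) (p : ℤ → Plane) (β γ n : ℤ) : Prop where
  sign : ε = 1 ∨ ε = -1
  pos : 0 < β
  lt : β < γ
  lt' : γ < n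
  periodic : ∀ k, p (k + n) = p k
  pos₁₂ : ∀ i j, 0 ≤ i → i < β → β ≤ j → j < γ → 0 < Plane.wedge ε (step p i) (step p j)
  pos₂₃ : ∀ i j, β ≤ i → i < γ → γ ≤ j → j < n → 0 < Plane.wedge ε (step p i) (step p j)
  pos₃₁ : ∀ i j, γ ≤ i → i < n → 0 ≤ j → j < β → 0 < Plane.wedge ε (step p i) (step p j)
  neg₁ : ∀ i j, 0 ≤ i → i < j → j < β → Plane.wedge ε (step p i) (step p j) < 0
  neg₂ : ∀ i j, β ≤ i → i < j → j < γ → Plane.wedge ε (step p i) (step p j) < 0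
  neg₃ : ∀ i j, γ ≤ i → i < j → j < n → Plane.wedge ε (step p i) (step p j) < 0

-- A partial sum is at most the sum of the positive turns in it, and at least `2π` minus the
-- positive turns outside it, each of which is less than `π`. As `j ≤ m`, the turn with index `m` is
-- always outside.
open Finset in
lemma sum_turns_bounds (t : ℕ → ℝ) {b c m : ℕ} (hbc : b < c) (hcm : c < m)
    (hb : 0 < t b ∧ t b < Real.pi) (hc : 0 < t c ∧ t c < Real.pi) (hm : 0 < t m ∧ t m < Real.pi)
    (hneg : ∀ k, k ≤ m → k ≠ b → k ≠ c → k ≠ m → t k < 0)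
    (hsum : ∑ k ∈ range (m + 1), t k = 2 * Real.pi) {i j : ℕ} (hij : i < j) (hj : j ≤ m) :
    ((∀ k, i ≤ k → k < j → k ≠ b ∧ k ≠ c) →
      -Real.pi < ∑ k ∈ Ico i j, t k ∧ ∑ k ∈ Ico i j, t k < 0) ∧
    (i ≤ b → b < j → j ≤ c → 0 < ∑ k ∈ Ico i j, t k ∧ ∑ k ∈ Ico i j, t k < Real.pi) ∧
    (b < i → i ≤ c → c < j → 0 < ∑ k ∈ Ico i j, t k ∧ ∑ k ∈ Ico i j, t k < Real.pi) ∧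
    (i ≤ b → c < j → Real.pi < ∑ k ∈ Ico i j, t k ∧ ∑ k ∈ Ico i j, t k < 2 * Real.pi) := by
  set s : ℕ → ℝ := fun k => if k = b ∨ k = c ∨ k = m then 0 else t k with hs
  have ht : ∀ k, t k = s k + (if k = b then t b else 0) + (if k = c then t c else 0) +
      (if k = m then t m else 0) := by
    intro k
    by_cases h1 : k = b
    · subst h1; simp [hs, hbc.ne, (hbc.trans hcm).ne]
    · by_cases h2 : k = c
      · subst h2; simp [hs, hbc.ne', hcm.ne]
      · by_cases h3 : k = m
        · subst h3; simp [hs, h1, h2]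
        · simp [hs, h1, h2, h3]
  have hs0 : ∀ k, k ≤ m → s k ≤ 0 := by
    intro k hk
    simp only [hs]
    split_ifs with h
    · exact le_rfl
    · push Not at h
      exact (hneg k hk h.1 h.2.1 h.2.2).le
  have hsums : ∀ i j, ∑ k ∈ Ico i j, t k = ∑ k ∈ Ico i j, s k +
      (if i ≤ b ∧ b < j then t b else 0) + (if i ≤ c ∧ c < j then t c else 0) +
      (if i ≤ m ∧ m < j then t m else 0) := by
    intro i j
    rw [sum_congr rfl fun k _ => ht k]
    simp only [sum_add_distrib, sum_ite_eq', mem_Ico]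
  have htot := hsums 0 (m + 1)
  rw [← range_eq_Ico, hsum] at htot
  rw [if_pos ⟨by omega, by omega⟩, if_pos ⟨by omega, by omega⟩, if_pos ⟨by omega, by omega⟩] at htot
  have hle : ∑ k ∈ range (m + 1), s k ≤ ∑ k ∈ Ico i j, s k := by
    rw [range_eq_Ico, ← neg_le_neg_iff, ← sum_neg_distrib, ← sum_neg_distrib]
    refine sum_le_sum_of_subset_of_nonneg (Ico_subset_Ico (by omega) (by omega)) ?_
    intro k hk _
    have := hs0 k (by have := (mem_Ico.1 hk).2; omega)
    linarith
  have hle0 : ∑ k ∈ Ico i j, s k ≤ 0 := sum_nonpos fun k hk =>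
    hs0 k (by have := (mem_Ico.1 hk).2; omega)
  have hpi := Real.pi_pos
  have := hsums i j
  rw [if_neg (show ¬(i ≤ m ∧ m < j) by omega)] at this
  refine ⟨?_, ?_, ?_, ?_⟩
  · intro h
    constructor
    · rw [if_neg (fun h' => (h b h'.1 h'.2).1 rfl), if_neg (fun h' => (h c h'.1 h'.2).2 rfl)] at this
      linarith
    · refine sum_neg (fun k hk => ?_) ⟨i, by simp [hij]⟩
      obtain ⟨h1, h2⟩ := mem_Ico.1 hk
      exact hneg k (by omega) (h k h1 h2).1 (h k h1 h2).2 (by omega)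
  · intro h1 h2 h3
    rw [if_pos ⟨h1, h2⟩, if_neg (by omega)] at this
    constructor <;> linarith
  · intro h1 h2 h3
    rw [if_neg (by omega), if_pos ⟨h2, h3⟩] at this
    constructor <;> linarith
  · intro h1 h2
    rw [if_pos ⟨h1, by omega⟩, if_pos ⟨by omega, h2⟩] at this
    constructor <;> linarith

-- Summed angles are kept as they are, not reduced to principal values, so that bounds beyond `π`
-- remain usable.
open Complex Finset in
lemma Complex.exists_div_eq_mul_exp (z : ℕ → ℂ) (hz : ∀ k, z k ≠ 0) {i j : ℕ} (hij : i ≤ j) :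
    ∃ r : ℝ, 0 < r ∧ z j / z i = r * exp ((∑ k ∈ Ico i j, arg (z (k + 1) / z k) : ℝ) * I) := by
  induction j, hij using Nat.le_induction with
  | base => exact ⟨1, one_pos, by simp [hz]⟩
  | succ j hj ih =>
    obtain ⟨r, hr, h⟩ := ih
    refine ⟨r * ‖z (j + 1) / z j‖, mul_pos hr (norm_pos_iff.2 (div_ne_zero (hz _) (hz _))), ?_⟩
    rw [sum_Ico_succ_top hj, ← div_mul_div_cancel₀ (hz j), h]
    conv_lhs => rw [← norm_mul_exp_arg_mul_I (z (j + 1) / z j)]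
    push_cast
    rw [add_mul, exp_add]
    ring

namespace Polygon

open Plane

variable {n : ℕ} [NeZero n]

/-- The vertices of a polygon, read off periodically from a given one. -/
def unroll (P : Polygon Plane n) (a : Fin n) (k : ℤ) : Plane := P (a + (k : Fin n))

lemma intCast_self : ((n : ℤ) : Fin n) = 0 := by ext; simp

lemma unroll_periodic (P : Polygon Plane n) (a : Fin n) (k : ℤ) :
    P.unroll a (k + n) = P.unroll a k := by
  rw [unroll, Int.cast_add, intCast_self, add_zero, unroll]

lemma unroll_succ (P : Polygon Plane n) (a : Fin n) (k : ℤ) :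
    P.unroll a (k + 1) = P (a + (k : Fin n) + 1) := by
  rw [unroll]; push_cast; rw [add_assoc]

lemma Bends.sub_ne_zero {P : Polygon Plane n} (hb : P.Bends) (i : Fin n) :
    toC (P (i + 1) - P i) ≠ 0 := by
  intro h
  have := hb i
  simp [h] at this

/-- Bounds on sums of turns become signs of areas through the sine. -/
lemma wedge_step_unroll {P : Polygon Plane n} (hb : P.Bends) (a : Fin n) {ε : ℝ}
    (hε : ε = 1 ∨ ε = -1) {i j : ℕ} (hij : i ≤ j) :
    ∃ r : ℝ, 0 < r ∧ wedge ε (step (P.unroll a) i) (step (P.unroll a) j) =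
      r * Real.sin (∑ k ∈ Finset.Ico i j, ε * P.turn (a + ((k + 1 : ℕ) : Fin n))) := by
  have hz : ∀ k : ℕ, toC (step (P.unroll a) k) ≠ 0 := by
    intro k
    rw [step, unroll_succ]
    exact hb.sub_ne_zero _
  obtain ⟨r, hr, h⟩ := Complex.exists_div_eq_mul_exp (fun k : ℕ => toC (step (P.unroll a) k)) hz hij
  have hn := Complex.normSq_pos.2 (hz i)
  have e : ∑ k ∈ Finset.Ico i j, Complex.arg (toC (step (P.unroll a) (k + 1 : ℕ)) /
      toC (step (P.unroll a) k)) =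
      ∑ k ∈ Finset.Ico i j, P.turn (a + ((k + 1 : ℕ) : Fin n)) := by
    refine Finset.sum_congr rfl fun k _ => ?_
    have e1 : a + (k : Fin n) + 1 = a + ((k + 1 : ℕ) : Fin n) := by push_cast; ring
    have e2 : a + (k : Fin n) = a + ((k + 1 : ℕ) : Fin n) - 1 := by push_cast; ring
    rw [turn, step, step, unroll_succ, unroll_succ, unroll, unroll]
    rw [Int.cast_natCast, Int.cast_natCast, e1, ← e2]
  rw [e] at h
  refine ⟨r * Complex.normSq (toC (step (P.unroll a) i)), mul_pos hr hn, ?_⟩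
  have h2 := congrArg Complex.im h
  rw [Complex.im_ofReal_mul, Complex.exp_ofReal_mul_I_im, Complex.div_im, ← sub_div,
    div_eq_iff hn.ne'] at h2
  rw [← Finset.mul_sum, wedge_apply]
  simp only [toC_re, toC_im] at h2
  rcases hε with rfl | rfl
  · rw [one_mul, one_mul]; linarith
  · rw [neg_one_mul, neg_one_mul, Real.sin_neg]; linarith

/-- The side-chains of a pseudo-triangle form three chains. -/
theorem IsPseudoTriangle.exists_triChain {P : Polygon Plane n} {a b c : Fin n}
    (h : P.IsPseudoTriangle a b c) :
    ∃ ε, TriChain ε (P.unroll a) ((b - a).val : ℤ) ((c - a).val : ℤ) n := by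
  obtain ⟨hS, hab, hbc, hA, hB, hC, hR⟩ := h
  have hcol : ∀ i, ¬ Collinear ℝ {P (i - 1), P i, P (i + 1)} := by
    intro i
    by_cases h1 : i = a
    · rw [h1]; exact hA.1
    · by_cases h2 : i = b
      · rw [h2]; exact hB.1
      · by_cases h3 : i = c
        · rw [h3]; exact hC.1
        · exact (hR i h1 h2 h3).1
  have hb := bends_of_not_collinear hcol
  obtain ⟨ε, hε, hT, hloc⟩ := exists_orientation hS hb
  refine ⟨ε, ?_⟩
  have hβ0 : 0 < (b - a).val := hab
  have hβγ : (b - a).val < (c - a).val := hbc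
  have hγn : (c - a).val < n := (c - a).isLt
  set β := (b - a).val with hβ
  set γ := (c - a).val with hγ
  have hbβ : b = a + (β : Fin n) := by rw [hβ, Fin.cast_val_eq_self]; ring
  have hcγ : c = a + (γ : Fin n) := by rw [hγ, Fin.cast_val_eq_self]; ring
  have han : a = a + (n : Fin n) := by
    have := intCast_self (n := n)
    rw [Int.cast_natCast] at this
    rw [this, add_zero]
  set t : ℕ → ℝ := fun k => ε * P.turn (a + ((k + 1 : ℕ) : Fin n)) with ht
  have hlt : ∀ i, ε * P.turn i < Real.pi := by
    intro i
    have := Complex.arg_bounds_of_im_ne_zero (hb i)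
    change P.turn i ≠ 0 ∧ -Real.pi < P.turn i ∧ P.turn i < Real.pi at this
    rcases hε with rfl | rfl <;> linarith
  -- `t k` is the turn between edges `k` and `k + 1`, at vertex `k + 1`; hence the corners `b`, `c`,
  -- `a` have indices `β - 1`, `γ - 1`, `n - 1`.
  obtain ⟨x, hx⟩ : ∃ x, x + 1 = β := ⟨β - 1, by omega⟩
  obtain ⟨y, hy⟩ : ∃ y, y + 1 = γ := ⟨γ - 1, by omega⟩
  obtain ⟨m, hm⟩ : ∃ m, m + 1 = n := ⟨n - 1, by omega⟩
  have tb : 0 < t x ∧ t x < Real.pi :=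
    ⟨by simp only [ht, hx, ← hbβ]; exact (hloc b).1 hB, hlt _⟩
  have tc : 0 < t y ∧ t y < Real.pi :=
    ⟨by simp only [ht, hy, ← hcγ]; exact (hloc c).1 hC, hlt _⟩
  have ta : 0 < t m ∧ t m < Real.pi :=
    ⟨by simp only [ht, hm, ← han]; exact (hloc a).1 hA, hlt _⟩
  have tneg : ∀ k, k ≤ m → k ≠ x → k ≠ y → k ≠ m → t k < 0 := by
    intro k hk h1 h2 h3
    refine (hloc _).2 (hR _ ?_ ?_ ?_)
    · intro hh
      have hh : ((k + 1 : ℕ) : Fin n) = ((0 : ℕ) : Fin n) := by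
        rw [add_eq_left.1 hh]; simp
      have := Fin.natCast_inj_of_lt (by omega) (by omega) hh
      omega
    · rw [hbβ]
      intro hh
      have := Fin.natCast_inj_of_lt (by omega) (by omega) (add_left_cancel hh)
      omega
    · rw [hcγ]
      intro hh
      have := Fin.natCast_inj_of_lt (by omega) (by omega) (add_left_cancel hh)
      omega
  have tsum : ∑ k ∈ Finset.range (m + 1), t k = 2 * Real.pi := by
    have e : ∀ k : ℕ, t k = ε * P.turn ((a + 1) + (k : Fin n)) := by
      intro k
      simp only [ht]
      push_cast
      ring_nf
    rw [hm, Finset.sum_congr rfl fun k _ => e k, ← Finset.mul_sum,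
      Fin.sum_add_natCast (a + 1) P.turn, hT]
    rcases hε with rfl | rfl <;> ring
  have hpi := Real.pi_pos
  have bd := fun i j hij hj => sum_turns_bounds t (show x < y by omega) (show y < m by omega)
    tb tc ta tneg tsum (i := i) (j := j) hij hj
  have key := fun i j hij => wedge_step_unroll hb a hε (i := i) (j := j) hij
  have kpos : ∀ i j : ℕ, i < j → 0 < ∑ k ∈ Finset.Ico i j, t k → ∑ k ∈ Finset.Ico i j, t k < Real.pi →
      0 < wedge ε (step (P.unroll a) i) (step (P.unroll a) j) := by
    intro i j hij h1 h2
    obtain ⟨r, hr, h⟩ := key i j hij.le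
    rw [h]
    exact mul_pos hr (Real.sin_pos_of_pos_of_lt_pi h1 h2)
  have kneg : ∀ i j : ℕ, i < j → -Real.pi < ∑ k ∈ Finset.Ico i j, t k → ∑ k ∈ Finset.Ico i j, t k < 0 →
      wedge ε (step (P.unroll a) i) (step (P.unroll a) j) < 0 := by
    intro i j hij h1 h2
    obtain ⟨r, hr, h⟩ := key i j hij.le
    rw [h]
    exact mul_neg_of_pos_of_neg hr (Real.sin_neg_of_neg_of_neg_pi_lt h2 h1)
  refine ⟨hε, by omega, by omega, by omega, P.unroll_periodic a, ?_, ?_, ?_, ?_, ?_, ?_⟩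
  · intro i j h0 h1 h2 h3
    obtain ⟨i, rfl⟩ := Int.eq_ofNat_of_zero_le (show 0 ≤ i by omega)
    obtain ⟨j, rfl⟩ := Int.eq_ofNat_of_zero_le (show 0 ≤ j by omega)
    obtain ⟨h4, h5⟩ := (bd i j (by omega) (by omega)).2.1 (by omega) (by omega) (by omega)
    exact kpos i j (by omega) h4 h5
  · intro i j h0 h1 h2 h3
    obtain ⟨i, rfl⟩ := Int.eq_ofNat_of_zero_le (show 0 ≤ i by omega)
    obtain ⟨j, rfl⟩ := Int.eq_ofNat_of_zero_le (show 0 ≤ j by omega)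
    obtain ⟨h4, h5⟩ := (bd i j (by omega) (by omega)).2.2.1 (by omega) (by omega) (by omega)
    exact kpos i j (by omega) h4 h5
  · intro j i h0 h1 h2 h3
    obtain ⟨i, rfl⟩ := Int.eq_ofNat_of_zero_le (show 0 ≤ i by omega)
    obtain ⟨j, rfl⟩ := Int.eq_ofNat_of_zero_le (show 0 ≤ j by omega)
    -- From the first chain to the third the turning lies between `π` and `2π`, where the sine is
    -- negative; exchanging the two edges makes the area positive.
    obtain ⟨h4, h5⟩ := (bd i j (by omega) (by omega)).2.2.2 (by omega) (by omega)
    obtain ⟨r, hr, h⟩ := key i j (by omega)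
    rw [wedge_swap, h, Left.neg_pos_iff]
    refine mul_neg_of_pos_of_neg hr ?_
    have e : Real.sin (∑ k ∈ Finset.Ico i j, t k) = Real.sin (∑ k ∈ Finset.Ico i j, t k - 2 * Real.pi) :=
      (Real.sin_sub_two_pi _).symm
    change Real.sin (∑ k ∈ Finset.Ico i j, t k) < 0
    rw [e]
    exact Real.sin_neg_of_neg_of_neg_pi_lt (by linarith) (by linarith)
  · intro i j h0 h1 h2
    obtain ⟨i, rfl⟩ := Int.eq_ofNat_of_zero_le (show 0 ≤ i by omega)
    obtain ⟨j, rfl⟩ := Int.eq_ofNat_of_zero_le (show 0 ≤ j by omega)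
    obtain ⟨h4, h5⟩ := (bd i j (by omega) (by omega)).1 (by omega)
    exact kneg i j (by omega) h4 h5
  · intro i j h0 h1 h2
    obtain ⟨i, rfl⟩ := Int.eq_ofNat_of_zero_le (show 0 ≤ i by omega)
    obtain ⟨j, rfl⟩ := Int.eq_ofNat_of_zero_le (show 0 ≤ j by omega)
    obtain ⟨h4, h5⟩ := (bd i j (by omega) (by omega)).1 (by omega)
    exact kneg i j (by omega) h4 h5
  · intro i j h0 h1 h2
    obtain ⟨i, rfl⟩ := Int.eq_ofNat_of_zero_le (show 0 ≤ i by omega)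
    obtain ⟨j, rfl⟩ := Int.eq_ofNat_of_zero_le (show 0 ≤ j by omega)
    obtain ⟨h4, h5⟩ := (bd i j (by omega) (by omega)).1 (by omega)
    exact kneg i j (by omega) h4 h5

end Polygon

end

section

/-! ### Sides of edges in three chains -/

open Plane

section Step

variable {p : ℤ → Plane} {l h : ℤ}

lemma map_sub_pos_of_step (f : Plane →ₗ[ℝ] ℝ) (hlh : l < h)
    (hf : ∀ j, l ≤ j → j < h → 0 < f (step p j)) : 0 < f (p h - p l) := by
  induction h, (show l + 1 ≤ h by omega) using Int.leInduction with
  | base => exact hf l le_rfl (by omega)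
  | succ h hh ih =>
    have h1 := ih (by omega) fun j h1 h2 => hf j h1 (by omega)
    have h2 := hf h (by omega) (by omega)
    have : p (h + 1) - p l = (p h - p l) + step p h := by rw [step]; abel
    rw [this, map_add]
    linarith

lemma map_sub_nonneg_of_step (f : Plane →ₗ[ℝ] ℝ) (hlh : l ≤ h)
    (hf : ∀ j, l ≤ j → j < h → 0 ≤ f (step p j)) : 0 ≤ f (p h - p l) := by
  induction h, hlh using Int.leInduction with
  | base => simp
  | succ h hh ih =>
    have h1 := ih fun j h1 h2 => hf j h1 (by omega)
    have h2 := hf h (by omega) (by omega)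
    have : p (h + 1) - p l = (p h - p l) + step p h := by rw [step]; abel
    rw [this, map_add]
    linarith

lemma wedge_sub_pos {ε : ℝ} {y : Plane} (hlh : l < h)
    (hf : ∀ j, l ≤ j → j < h → 0 < wedge ε y (step p j)) : 0 < wedge ε y (p h - p l) :=
  map_sub_pos_of_step _ hlh hf

lemma wedge_sub_nonneg {ε : ℝ} {y : Plane} (hlh : l ≤ h)
    (hf : ∀ j, l ≤ j → j < h → 0 ≤ wedge ε y (step p j)) : 0 ≤ wedge ε y (p h - p l) :=
  map_sub_nonneg_of_step _ hlh hf

lemma wedge_sub_pos' {ε : ℝ} {y : Plane} (hlh : l < h)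
    (hf : ∀ j, l ≤ j → j < h → 0 < wedge ε (step p j) y) : 0 < wedge ε (p h - p l) y :=
  map_sub_pos_of_step ((wedge ε).flip y) hlh hf

lemma wedge_sub_nonneg' {ε : ℝ} {y : Plane} (hlh : l ≤ h)
    (hf : ∀ j, l ≤ j → j < h → 0 ≤ wedge ε (step p j) y) : 0 ≤ wedge ε (p h - p l) y :=
  map_sub_nonneg_of_step ((wedge ε).flip y) hlh hf

lemma wedge_sub_neg {ε : ℝ} {y : Plane} (hlh : l < h)
    (hf : ∀ j, l ≤ j → j < h → wedge ε y (step p j) < 0) : wedge ε y (p h - p l) < 0 := by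
  have := map_sub_pos_of_step (-(wedge ε y)) hlh (fun j h1 h2 => by
    simpa using hf j h1 h2)
  simpa using this

lemma wedge_sub_nonpos {ε : ℝ} {y : Plane} (hlh : l ≤ h)
    (hf : ∀ j, l ≤ j → j < h → wedge ε y (step p j) ≤ 0) : wedge ε y (p h - p l) ≤ 0 := by
  have := map_sub_nonneg_of_step (-(wedge ε y)) hlh (fun j h1 h2 => by
    simpa using hf j h1 h2)
  simpa using this

lemma step_add_sub (p : ℤ → Plane) (j k : ℤ) : step p j + (p k - p (j + 1)) = p k - p j := by
  rw [step]; abel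

end Step

/-- The side of an edge on which a point lies. -/
noncomputable def side (ε : ℝ) (p : ℤ → Plane) (j : ℤ) (x : Plane) : ℝ :=
  wedge ε (step p j) (x - p j)

lemma side_eq (ε : ℝ) (p : ℤ → Plane) (j : ℤ) (x y : Plane) :
    side ε p j y = side ε p j x + wedge ε (step p j) (y - x) := by
  rw [side, side, ← map_add]; congr 1; abel

lemma side_self (ε : ℝ) (p : ℤ → Plane) (j : ℤ) : side ε p j (p j) = 0 := by simp [side]

lemma side_succ (ε : ℝ) (p : ℤ → Plane) (j : ℤ) : side ε p j (p (j + 1)) = 0 := by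
  rw [side]; exact wedge_self _ _

lemma side_combo (ε : ℝ) (p : ℤ → Plane) (j : ℤ) (x y : Plane) {a b : ℝ} (hab : a + b = 1) :
    side ε p j (a • x + b • y) = a * side ε p j x + b * side ε p j y := by
  have : a • x + b • y - p j = a • (x - p j) + b • (y - p j) := by
    rw [smul_sub, smul_sub, show a • x + b • y - p j = a • x + b • y - (a + b) • p j by
      rw [hab, one_smul], add_smul]
    abel
  rw [side, this, map_add, map_smul, map_smul]
  rfl

/-- The edges from `l` to `h` all bend strictly to one side. -/
def Bending (ε : ℝ) (p : ℤ → Plane) (l h : ℤ) : Prop :=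
  ∀ i j, l ≤ i → i < j → j < h → wedge ε (step p i) (step p j) < 0

namespace Bending

variable {ε : ℝ} {p : ℤ → Plane} {l h : ℤ}

/-- Bending compares all pairs of edges, not only consecutive ones, so summing along the chain shows
that the line of each edge supports the whole chain. -/
lemma side_neg (H : Bending ε p l h) {j k : ℤ} (hj : l ≤ j) (hj' : j < h) (hk : l ≤ k) (hk' : k ≤ h)
    (h1 : k ≠ j) (h2 : k ≠ j + 1) : side ε p j (p k) < 0 := by
  rcases lt_or_gt_of_ne h1 with hlt | hlt
  · have : 0 < wedge ε (step p j) (p j - p k) := wedge_sub_pos hlt fun i h1 h2 => by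
      rw [wedge_swap]; linarith [H i j (by omega) h2 hj']
    rw [side, ← neg_sub, map_neg]; linarith
  · rw [side, ← step_add_sub, map_add, wedge_self, zero_add]
    exact wedge_sub_neg (by omega) fun i h1 h2 => H j i hj (by omega) (by omega)

lemma side_nonpos (H : Bending ε p l h) {j k : ℤ} (hj : l ≤ j) (hj' : j < h) (hk : l ≤ k)
    (hk' : k ≤ h) : side ε p j (p k) ≤ 0 := by
  by_cases h1 : k = j
  · rw [h1, side_self]
  by_cases h2 : k = j + 1
  · rw [h2, side_succ]
  exact (H.side_neg hj hj' hk hk' h1 h2).le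

/-- Vertices two or more apart are never both on the line of one edge. -/
lemma side_midpoint_neg (H : Bending ε p l h) {j k k' : ℤ} (hj : l ≤ j) (hj' : j < h) (hk : l ≤ k)
    (hkk : k + 2 ≤ k') (hk' : k' ≤ h) :
    side ε p j ((1 / 2 : ℝ) • p k + (1 / 2 : ℝ) • p k') < 0 := by
  rw [side_combo _ _ _ _ _ (by norm_num)]
  have h1 := H.side_nonpos hj hj' hk (by omega)
  have h2 := H.side_nonpos hj hj' (k := k') (by omega) hk'
  by_cases h3 : k = j ∨ k = j + 1
  · have := H.side_neg hj hj' (k := k') (by omega) hk' (by omega) (by omega)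
    linarith
  · have := H.side_neg hj hj' hk (by omega) (by tauto) (by tauto)
    linarith

end Bending

/-- `x` is not cut off by the chain from `l` to `h`. -/
def ChainSide (ε : ℝ) (p : ℤ → Plane) (l h : ℤ) (x : Plane) : Prop :=
  0 ≤ wedge ε (p h - p l) (x - p l) ∧ ∃ j, l ≤ j ∧ j < h ∧ 0 ≤ side ε p j x

/-- The region enclosed by three chains. -/
def enclosed (ε : ℝ) (p : ℤ → Plane) (β γ n : ℤ) : Set Plane :=
  {x | ChainSide ε p 0 β x ∧ ChainSide ε p β γ x ∧ ChainSide ε p γ n x}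

lemma step_shift (p : ℤ → Plane) (b k : ℤ) : step (fun i => p (i + b)) k = step p (k + b) := by
  simp only [step]; rw [add_right_comm]

lemma side_shift (ε : ℝ) (p : ℤ → Plane) (b k : ℤ) (x : Plane) :
    side ε (fun i => p (i + b)) k x = side ε p (k + b) x := by
  rw [side, side, step_shift]

lemma chainSide_shift (ε : ℝ) (p : ℤ → Plane) (b l h : ℤ) (x : Plane) :
    ChainSide ε (fun i => p (i + b)) l h x ↔ ChainSide ε p (l + b) (h + b) x := by
  refine and_congr Iff.rfl ⟨?_, ?_⟩
  · rintro ⟨j, h1, h2, h3⟩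
    exact ⟨j + b, by omega, by omega, by rwa [← side_shift]⟩
  · rintro ⟨j, h1, h2, h3⟩
    exact ⟨j - b, by omega, by omega, by rwa [side_shift, sub_add_cancel]⟩

lemma step_reverse (p : ℤ → Plane) (k : ℤ) : step (fun i => p (-i)) k = -step p (-k - 1) := by
  simp only [step, neg_sub, sub_add_cancel]
  rw [neg_add, sub_eq_add_neg]; rfl

/-- Reversal negates the steps and the sign of the area form is changed with it, so sides are
preserved. The shift by one arises because an edge is indexed by its first end. -/
lemma side_reverse (ε : ℝ) (p : ℤ → Plane) (k : ℤ) (x : Plane) :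
    side (-ε) (fun i => p (-i)) k x = side ε p (-k - 1) x := by
  rw [side, step_reverse, wedge_neg_sign, map_neg, LinearMap.neg_apply, neg_neg]
  rw [side_eq ε p (-k - 1) (p (-k - 1 + 1)) x, side_succ, zero_add, sub_add_cancel]

lemma chainSide_reverse (ε : ℝ) (p : ℤ → Plane) (l h : ℤ) (x : Plane) :
    ChainSide (-ε) (fun i => p (-i)) l h x ↔ ChainSide ε p (-h) (-l) x := by
  refine and_congr ?_ ⟨?_, ?_⟩
  · simp only [wedge_neg_sign]
    have : wedge ε (p (-l) - p (-h)) (x - p (-h)) = -wedge ε (p (-h) - p (-l)) (x - p (-l)) := by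
      rw [← LinearMap.neg_apply, ← map_neg, neg_sub,
        ← sub_add_sub_cancel x (p (-l)) (p (-h)), map_add, wedge_self, add_zero]
    rw [this]
  · rintro ⟨j, h1, h2, h3⟩
    exact ⟨-j - 1, by omega, by omega, by rwa [← side_reverse]⟩
  · rintro ⟨j, h1, h2, h3⟩
    exact ⟨-j - 1, by omega, by omega, by rw [side_reverse]; convert h3 using 2; ring⟩

namespace TriChain

variable {ε : ℝ} {p : ℤ → Plane} {β γ n : ℤ}

lemma step_periodic (H : TriChain ε p β γ n) (k : ℤ) : step p (k + n) = step p k := by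
  rw [step, step, H.periodic, add_right_comm, H.periodic]

lemma side_periodic (H : TriChain ε p β γ n) (k : ℤ) (x : Plane) :
    side ε p (k + n) x = side ε p k x := by
  rw [side, side, H.step_periodic, H.periodic]

lemma period (H : TriChain ε p β γ n) : p n = p 0 := by
  have := H.periodic 0
  rwa [zero_add] at this

lemma bending₁ (H : TriChain ε p β γ n) : Bending ε p 0 β := H.neg₁
lemma bending₂ (H : TriChain ε p β γ n) : Bending ε p β γ := H.neg₂
lemma bending₃ (H : TriChain ε p β γ n) : Bending ε p γ n := H.neg₃

/-- Three chains may be read off from the next corner. -/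
lemma shift (H : TriChain ε p β γ n) : TriChain ε (fun i => p (i + β)) (γ - β) (n - β) n := by
  have h1 := H.pos
  have h2 := H.lt
  have h3 := H.lt'
  have e : ∀ k, step p (k + β) = step p (k + β - n) := fun k => by
    rw [← H.step_periodic (k + β - n), sub_add_cancel]
  refine ⟨H.sign, by omega, by omega, by omega, ?_, ?_, ?_, ?_, ?_, ?_, ?_⟩
  · intro k
    rw [add_right_comm, H.periodic]
  all_goals intro i j
  all_goals intros
  all_goals rw [step_shift, step_shift]
  · exact H.pos₂₃ _ _ (by omega) (by omega) (by omega) (by omega)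
  · rw [e j]
    exact H.pos₃₁ _ _ (by omega) (by omega) (by omega) (by omega)
  · rw [e i]
    exact H.pos₁₂ _ _ (by omega) (by omega) (by omega) (by omega)
  · exact H.neg₂ _ _ (by omega) (by omega) (by omega)
  · exact H.neg₃ _ _ (by omega) (by omega) (by omega)
  · rw [e i, e j]
    exact H.neg₁ _ _ (by omega) (by omega) (by omega)

/-- Three chains may be read off backwards. -/
lemma reverse (H : TriChain ε p β γ n) : TriChain (-ε) (fun i => p (-i)) (n - γ) (n - β) n := by
  have h1 := H.pos
  have h2 := H.lt
  have h3 := H.lt'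
  have e : ∀ k, step p (-k - 1) = step p (-k - 1 + n) := fun k => (H.step_periodic _).symm
  refine ⟨by rcases H.sign with h | h <;> simp [h], by omega, by omega, by omega, ?_, ?_, ?_, ?_, ?_,
    ?_, ?_⟩
  · intro k
    rw [← H.periodic, neg_add, neg_add_cancel_right]
  all_goals intro i j
  all_goals intros
  all_goals rw [step_reverse, step_reverse, e i, e j, wedge_neg_sign, map_neg, map_neg,
    LinearMap.neg_apply, neg_neg, wedge_swap]
  · rw [neg_neg]
    exact H.pos₂₃ _ _ (by omega) (by omega) (by omega) (by omega)
  · rw [neg_neg]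
    exact H.pos₁₂ _ _ (by omega) (by omega) (by omega) (by omega)
  · rw [neg_neg]
    exact H.pos₃₁ _ _ (by omega) (by omega) (by omega) (by omega)
  · rw [neg_neg]
    exact H.neg₃ _ _ (by omega) (by omega) (by omega)
  · rw [neg_neg]
    exact H.neg₂ _ _ (by omega) (by omega) (by omega)
  · rw [neg_neg]
    exact H.neg₁ _ _ (by omega) (by omega) (by omega)

lemma enclosed_reverse (H : TriChain ε p β γ n) :
    enclosed (-ε) (fun i => p (-i)) (n - γ) (n - β) n = enclosed ε p β γ n := by
  have e : ∀ l h x, ChainSide ε p (l + n) (h + n) x ↔ ChainSide ε p l h x := by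
    intro l h x
    rw [← chainSide_shift]
    have : (fun i => p (i + n)) = p := funext H.periodic
    rw [this]
  ext x
  simp only [enclosed, Set.mem_ofPred_eq, chainSide_reverse]
  rw [← e (-(n - γ)) (-0), ← e (-(n - β)) (-(n - γ)), ← e (-n) (-(n - β))]
  ring_nf
  tauto

/-- The chord of a chain is a side of the convex hull. On the chain itself this is its bending;
elsewhere, join the vertex to the nearer end of the chord along the next or the preceding chain,
whose edges turn the right way against all edges of the first. -/
lemma base_side_nonneg (H : TriChain ε p β γ n) {k : ℤ} (h0 : 0 ≤ k) (hn : k ≤ n) :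
    0 ≤ wedge ε (p β - p 0) (p k - p 0) := by
  have h1 := H.pos
  have h2 := H.lt
  have h3 := H.lt'
  rcases le_or_gt k β with hk | hk
  · have : 0 ≤ wedge ε (p k - p 0) (p k - p β) := by
      refine wedge_sub_nonneg' h0 fun i hi hi' => ?_
      have : wedge ε (step p i) (p β - p k) ≤ 0 := wedge_sub_nonpos hk fun j hj hj' =>
        (H.neg₁ i j hi (by omega) hj').le
      rw [← neg_sub, map_neg]; linarith
    rw [← sub_add_sub_cancel (p β) (p k) (p 0), map_add, LinearMap.add_apply, wedge_self, add_zero,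
      wedge_swap, ← map_neg, neg_sub]
    exact this
  · rcases le_or_gt k γ with hk' | hk'
    · rw [← sub_add_sub_cancel (p k) (p β) (p 0), map_add, wedge_self, add_zero]
      refine wedge_sub_nonneg' (by omega) fun i hi hi' => wedge_sub_nonneg (by omega)
        fun j hj hj' => (H.pos₁₂ i j (by omega) (by omega) (by omega) (by omega)).le
    · rw [wedge_swap, ← LinearMap.neg_apply, ← map_neg, neg_sub, ← H.period]
      rw [H.period]
      refine wedge_sub_nonneg (by omega) fun j hj hj' => ?_
      rw [← H.period]
      exact wedge_sub_nonneg' (by omega) fun i hi hi' =>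
        (H.pos₃₁ i j (by omega) (by omega) (by omega) (by omega)).le

/-- The last edge of a chain witnesses `ChainSide` for the following chain, and in `side_first_pos₁`
the first edge does so for the preceding one. -/
lemma side_last_nonneg₁ (H : TriChain ε p β γ n) {k : ℤ} (h0 : β ≤ k) (hn : k ≤ γ) :
    0 ≤ side ε p (β - 1) (p k) := by
  have h1 := H.pos
  rw [side_eq ε p (β - 1) (p (β - 1 + 1)), side_succ, zero_add, sub_add_cancel]
  exact wedge_sub_nonneg h0 fun j hj hj' =>
    (H.pos₁₂ _ j (by omega) (by omega) (by omega) (by omega)).le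

lemma side_first_pos₁ (H : TriChain ε p β γ n) {k : ℤ} (h0 : γ ≤ k) (hn : k < n) :
    0 < side ε p 0 (p k) := by
  have h1 := H.pos
  rw [side, ← H.period, wedge_swap, ← LinearMap.neg_apply, ← map_neg, neg_sub]
  exact wedge_sub_pos' (by omega) fun i hi hi' =>
    H.pos₃₁ i 0 (by omega) (by omega) le_rfl (by omega)

/-- The corners are in general position. -/
lemma wedge_corners_pos (H : TriChain ε p β γ n) :
    0 < wedge ε (p β - p 0) (p γ - p β) := by
  have h1 := H.pos
  have h2 := H.lt
  have h3 := H.lt'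
  exact wedge_sub_pos' (by omega) fun i hi hi' => wedge_sub_pos (by omega)
    fun j hj hj' => H.pos₁₂ i j (by omega) (by omega) (by omega) (by omega)

end TriChain

end

section

open Fin.CommRing

/-! ### The region of a polygon with three chains -/

namespace Plane

lemma wedge_combo_sub (ε : ℝ) (d x y z : Plane) {s t : ℝ} (h : s + t = 1) :
    wedge ε d (s • x + t • y - z) = s * wedge ε d (x - z) + t * wedge ε d (y - z) := by
  have : s • x + t • y - z = s • (x - z) + t • (y - z) := by
    have hz : z = (s + t) • z := by rw [h, one_smul]
    conv_lhs => rw [hz]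
    rw [smul_sub, smul_sub, add_smul]
    abel
  rw [this, map_add, map_smul, map_smul]
  rfl

lemma arg_pos_of_wedge_pos {ε : ℝ} (hε : ε = 1 ∨ ε = -1) {y z : Plane} (h : 0 < wedge ε y z) :
    0 < ε * Complex.arg (toC z / toC y) ∧ ε * Complex.arg (toC z / toC y) < Real.pi := by
  have h1 : wedge 1 y z ≠ 0 := by
    rcases hε with rfl | rfl
    · exact h.ne'
    · rw [wedge_neg_sign] at h; linarith
  have h2 := im_div_toC_ne_zero h1
  obtain ⟨h3, h4, h5⟩ := Complex.arg_bounds_of_im_ne_zero h2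
  have hy : toC y ≠ 0 := by
    intro h0
    rw [h0, div_zero] at h2
    simp at h2
  have h6 := Complex.arg_pos_iff_im_pos h2
  rw [Complex.im_div_pos_iff hy] at h6
  have e : (toC y).re * (toC z).im - (toC y).im * (toC z).re = wedge 1 y z := by
    rw [wedge_apply, one_mul]; rfl
  rw [e] at h6
  rcases hε with rfl | rfl
  · rw [one_mul]; exact ⟨h6.2 h, h5⟩
  · rw [wedge_neg_sign] at h
    have : ¬ 0 < Complex.arg (toC z / toC y) := fun h7 => by linarith [h6.1 h7]
    have := lt_of_le_of_ne (not_lt.1 this) h3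
    constructor <;> linarith

end Plane

namespace Polygon

open Plane

variable {n : ℕ} [NeZero n] {P : Polygon Plane n} {a : Fin n} {ε : ℝ} {β γ : ℤ}

lemma exists_unroll (P : Polygon Plane n) (a i : Fin n) :
    ∃ k : ℤ, 0 ≤ k ∧ k < n ∧ i = a + (k : Fin n) ∧ P i = P.unroll a k ∧
      P (i + 1) = P.unroll a (k + 1) := by
  have e : i = a + (((i - a).val : ℤ) : Fin n) := by
    rw [Int.cast_natCast, Fin.cast_val_eq_self]; ring
  refine ⟨((i - a).val : ℤ), by omega, by exact_mod_cast (i - a).isLt, e, ?_, ?_⟩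
  · rw [unroll, ← e]
  · rw [unroll_succ, ← e]

lemma exists_of_mem_boundary {x : Plane} (a : Fin n) (hx : x ∈ P.boundary ℝ) :
    ∃ k : ℤ, 0 ≤ k ∧ k < n ∧ x ∈ segment ℝ (P.unroll a k) (P.unroll a (k + 1)) := by
  by_contra! h
  refine absurd hx (notMem_boundary_iff.2 fun i => ?_)
  obtain ⟨k, h0, h1, -, h2, h3⟩ := exists_unroll P a i
  rw [h2, h3]
  exact h k h0 h1

lemma segment_unroll_subset_boundary (P : Polygon Plane n) (a : Fin n) (k : ℤ) :
    segment ℝ (P.unroll a k) (P.unroll a (k + 1)) ⊆ P.boundary ℝ := by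
  intro x hx
  rw [boundary, Set.mem_iUnion]
  refine ⟨a + (k : Fin n), ?_⟩
  rwa [edgeSet_eq_segment, ← unroll_succ, ← unroll]

lemma unroll_shift (P : Polygon Plane n) (a : Fin n) (b : ℤ) :
    (fun i => P.unroll a (i + b)) = P.unroll (a + (b : Fin n)) := by
  funext i
  rw [unroll, unroll]
  push_cast
  congr 1
  ring

/-- Beyond the chord, the half-plane criterion applies at once. Otherwise the point is strictly
beyond all edges of the chain. So is the midpoint of the chord, and the convex set of such points
misses the boundary; at the midpoint the line of the chord supports the polygon. -/
lemma notMem_region_of_not_chainSide (H : TriChain ε (P.unroll a) β γ n) {x : Plane}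
    (hx : ¬ ChainSide ε (P.unroll a) 0 β x) : x ∉ P.region := by
  have h1 := H.pos
  have h2 := H.lt
  have h3 := H.lt'
  set p := P.unroll a with hp
  have hhull : ∀ i, 0 ≤ wedge ε (p β - p 0) (P i - p 0) := by
    intro i
    obtain ⟨k, h0, h1, -, h2, -⟩ := exists_unroll P a i
    rw [h2]
    exact H.base_side_nonneg h0 h1.le
  have hhullb : ∀ y ∈ P.boundary ℝ, 0 ≤ wedge ε (p β - p 0) (y - p 0) := by
    intro y hy
    obtain ⟨k, k0, k1, s, t, hs, ht, hst, rfl⟩ := exists_of_mem_boundary a hy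
    rw [wedge_combo_sub _ _ _ _ _ hst]
    have := H.base_side_nonneg k0 k1.le
    have := H.base_side_nonneg (k := k + 1) (by omega) (by omega)
    positivity
  have hd : p β - p 0 ≠ 0 := by
    intro h0
    have := H.wedge_corners_pos
    simp [h0] at this
  rw [ChainSide, not_and_or, not_le] at hx
  by_cases hT : wedge ε (p β - p 0) (x - p 0) < 0
  · have hxb : x ∉ P.boundary ℝ := fun hb => (hhullb x hb).not_gt hT
    refine notMem_region_of_halfplane H.sign hxb hd fun i => ?_
    have : P i - x = (P i - p 0) - (x - p 0) := by abel
    rw [this, map_sub]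
    linarith [hhull i]
  · have hx := hx.resolve_left hT
    push Not at hx
    -- For a single edge, chord and edge coincide and the two conditions contradict each other.
    have hβ : 2 ≤ β := by
      by_contra hlt
      have hb : β = 1 := by omega
      have := hx 0 le_rfl h1
      rw [hb] at hT
      exact hT this
    set M : Plane := (1 / 2 : ℝ) • p 0 + (1 / 2 : ℝ) • p β with hM
    have hMs : ∀ j, 0 ≤ j → j < β → side ε p j M < 0 := fun j hj hj' =>
      H.bending₁.side_midpoint_neg hj hj' le_rfl (by omega) le_rfl
    have hseg : ∀ z ∈ segment ℝ x M, z ∉ P.boundary ℝ := by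
      rintro z ⟨s, t, hs, ht, hst, rfl⟩ hz
      have hneg : ∀ j, 0 ≤ j → j < β → side ε p j (s • x + t • M) < 0 := by
        intro j hj hj'
        rw [side_combo _ _ _ _ _ hst]
        have i1 := hx j hj hj'
        have i2 := hMs j hj hj'
        rcases eq_or_lt_of_le hs with rfl | hs
        · have : t = 1 := by linarith
          subst this; linarith
        · have := mul_neg_of_pos_of_neg hs i1
          have := mul_nonpos_of_nonneg_of_nonpos ht i2.le
          linarith
      obtain ⟨k, k0, k1, u, v, hu, hv, huv, e⟩ := exists_of_mem_boundary a hz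
      have hnn : ∃ j, 0 ≤ j ∧ j < β ∧ 0 ≤ side ε p j (p k) ∧ 0 ≤ side ε p j (p (k + 1)) := by
        rcases lt_or_ge k β with hk | hk
        · exact ⟨k, k0, hk, (side_self _ _ _).ge, (side_succ _ _ _).ge⟩
        · rcases lt_or_ge k γ with hk' | hk'
          · exact ⟨β - 1, by omega, by omega, H.side_last_nonneg₁ hk (by omega),
              H.side_last_nonneg₁ (by omega) (by omega)⟩
          · refine ⟨0, le_rfl, h1, (H.side_first_pos₁ hk' k1).le, ?_⟩
            rcases eq_or_lt_of_le (show k + 1 ≤ n by omega) with hk'' | hk''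
            · rw [hk'', H.period, side_self]
            · exact (H.side_first_pos₁ (by omega) hk'').le
      obtain ⟨j, j0, j1, i1, i2⟩ := hnn
      have := hneg j j0 j1
      rw [← e, side_combo _ _ _ _ _ huv] at this
      have : 0 ≤ u * side ε p j (p k) + v * side ε p j (p (k + 1)) := by positivity
      linarith
    rw [mem_region_iff_of_segment hseg]
    refine notMem_region_of_halfplane H.sign (hseg M (right_mem_segment _ _ _)) hd fun i => ?_
    have e1 : wedge ε (p β - p 0) (M - p 0) = 0 := by
      rw [hM, wedge_combo_sub _ _ _ _ _ (by norm_num), wedge_self, sub_self, map_zero]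
      ring
    have : P i - M = (P i - p 0) - (M - p 0) := by abel
    rw [this, map_sub, e1, sub_zero]
    exact hhull i

lemma region_subset_enclosed (H : TriChain ε (P.unroll a) β γ n) :
    P.region ⊆ enclosed ε (P.unroll a) β γ n := by
  intro x hx
  have H2 := H.shift
  rw [unroll_shift] at H2
  have H3 := H2.shift
  rw [unroll_shift] at H3
  refine ⟨?_, ?_, ?_⟩
  · by_contra h
    exact notMem_region_of_not_chainSide H h hx
  · by_contra h
    refine notMem_region_of_not_chainSide H2 (fun h' => h ?_) hx
    rw [← unroll_shift, chainSide_shift] at h'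
    convert h' using 1 <;> ring
  · by_contra h
    refine notMem_region_of_not_chainSide H3 (fun h' => h ?_) hx
    rw [← unroll_shift, chainSide_shift, ← unroll_shift, chainSide_shift] at h'
    convert h' using 1 <;> ring

/-- A point on no edge that is not cut off by a chain sees the chain under the same angle as the
segment between its ends. -/
lemma exists_sum_arg_chain {p : ℤ → Plane} (hε : ε = 1 ∨ ε = -1) {l h : ℕ} (hlh : l < h)
    (hB : Bending ε p l h) (h0 : ∀ j, step p j ≠ 0) {x C : Plane}
    (hedge : ∀ k : ℤ, x ∉ segment ℝ (p k) (p (k + 1)))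
    (hΔ : 0 < wedge ε (p h - p l) (C - p h)) (hC₁ : 0 ≤ wedge ε (C - p h) (x - p h))
    (hC₂ : 0 ≤ wedge ε (p l - C) (x - C)) (hx : ChainSide ε p l h x) :
    0 < ε * ∑ k ∈ Finset.Ico l h,
      Complex.arg ((toC (p (k + 1 : ℕ)) - toC x) / (toC (p k) - toC x)) ∧
    ε * ∑ k ∈ Finset.Ico l h,
      Complex.arg ((toC (p (k + 1 : ℕ)) - toC x) / (toC (p k) - toC x)) < Real.pi := by
  obtain ⟨hT, j, hj, hj', hs⟩ := hx
  have hne : ∀ k, x ≠ p k := fun k hk => hedge k (hk ▸ left_mem_segment _ _ _)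
  -- A point on the line of the chord would, by `hC₁` and `hC₂`, lie on the chord itself. Being
  -- weakly inside edge `j`, it would force the chain to be that one edge and so lie on it.
  have hpos : 0 < wedge ε (p h - p l) (x - p l) := by
    refine lt_of_le_of_ne hT fun h0 => ?_
    have hcr := wedge_smul_eq ε (p h - p l) (C - p h) (x - p l)
    rw [← h0, zero_smul, add_zero] at hcr
    set Δ := wedge ε (p h - p l) (C - p h) with hΔd
    set s := wedge ε (x - p l) (C - p h) / Δ with hsd
    have hxs : x - p l = s • (p h - p l) := by
      rw [hsd, div_eq_inv_mul, mul_smul, ← hcr, smul_smul, inv_mul_cancel₀ hΔ.ne', one_smul]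
    have s1 : s ≤ 1 := by
      have e : x - p h = (s - 1) • (p h - p l) := by
        rw [sub_smul, one_smul, ← hxs]; abel
      rw [e, map_smul, wedge_swap, smul_eq_mul, ← hΔd] at hC₁
      nlinarith
    have s0 : 0 ≤ s := by
      have e : x - C = (s - 1) • (p h - p l) - (C - p h) := by
        rw [sub_smul, one_smul, ← hxs]; abel
      have e' : p l - C = -(p h - p l) - (C - p h) := by abel
      rw [e, e'] at hC₂
      simp only [map_sub, map_neg, map_smul, LinearMap.sub_apply, LinearMap.neg_apply, wedge_self,
        smul_eq_mul] at hC₂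
      simp only [map_sub, LinearMap.sub_apply] at hΔd
      have e3 := wedge_swap ε (p h) (p l)
      have e4 := wedge_swap ε (p h) C
      have e5 := wedge_swap ε (p l) C
      rw [e3, e4, e5] at hC₂
      rw [e3] at hΔd
      simp only [wedge_self] at hC₂ hΔd
      have : 0 ≤ s * Δ := by rw [hΔd]; linarith
      exact nonneg_of_mul_nonneg_left this hΔ
    have hxc : x = (1 - s) • p l + s • p h := by
      have : x = p l + s • (p h - p l) := by rw [← hxs]; abel
      rw [this, smul_sub, sub_smul, one_smul]; abel
    rw [hxc, side_combo _ _ _ _ _ (by ring)] at hs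
    have i1 := hB.side_nonpos hj hj' le_rfl (by omega)
    have i2 := hB.side_nonpos hj hj' (k := h) (by omega) le_rfl
    have n1 : 0 < 1 - s := by
      refine lt_of_le_of_ne (by linarith) fun h1 => hne h ?_
      rw [hxc, ← h1, show s = 1 by linarith]; simp
    have n2 : 0 < s := by
      refine lt_of_le_of_ne s0 fun h1 => hne l ?_
      rw [hxc, ← h1]; simp
    have z1 : ¬ side ε p j (p l) < 0 := fun hl => by nlinarith
    have z2 : ¬ side ε p j (p h) < 0 := fun hl => by nlinarith
    have e1 : (l : ℤ) = j ∨ (l : ℤ) = j + 1 := by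
      by_contra! hc
      exact z1 (hB.side_neg hj hj' le_rfl (by omega) hc.1 hc.2)
    have e2 : (h : ℤ) = j ∨ (h : ℤ) = j + 1 := by
      by_contra! hc
      exact z2 (hB.side_neg hj hj' (by omega) le_rfl hc.1 hc.2)
    have e3 : (l : ℤ) = j := by omega
    have e4 : (h : ℤ) = j + 1 := by omega
    apply hedge j
    rw [hxc, e3, e4]
    exact ⟨1 - s, s, n1.le, n2.le, by ring, rfl⟩
  -- The line through `x` parallel to edge `j` has the whole chain on one side, since `x` is inside
  -- that edge and the chain is not.
  obtain ⟨u, hu, hu'⟩ := exists_halfplane hε (neg_ne_zero.2 (h0 j))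
  have him : ∀ k : ℕ, l ≤ k → k ≤ h → 0 ≤ ((toC (p k) - toC x) / u).im := by
    intro k hk hk'
    rw [← map_sub]
    refine hu' _ ?_
    have e := side_eq ε p j x (p k)
    have := hB.side_nonpos hj hj' (k := k) (by omega) (by omega)
    rw [map_neg, LinearMap.neg_apply]
    linarith
  have hw : 0 < wedge ε (p l - x) (p h - x) := by
    have e1 : p h - x = (p h - p l) - (x - p l) := by abel
    have e2 : p l - x = -(x - p l) := by abel
    rw [e1, e2, map_neg, LinearMap.neg_apply, map_sub, wedge_self, sub_zero, ← wedge_swap]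
    exact hpos
  have hslit : (toC (p h) - toC x) / (toC (p l) - toC x) ∈ Complex.slitPlane := by
    rw [← map_sub, ← map_sub]
    refine Or.inr (im_div_toC_ne_zero fun h0 => hw.ne' ?_)
    rcases hε with rfl | rfl
    · exact h0
    · rw [wedge_neg_sign, h0, neg_zero]
  have hsum := Complex.sum_arg_div_of_im_nonneg hu (fun k : ℕ => toC (p k) - toC x) hlh.le him
    (fun k hk hk' => by
      have := notMem_segment_iff.1 (hedge k)
      rwa [show ((k : ℤ) + 1) = ((k + 1 : ℕ) : ℤ) by push_cast; rfl] at this)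
  rw [hsum, ← Complex.arg_div_of_im_nonneg hu (him l le_rfl hlh.le) (him h hlh.le le_rfl) hslit,
    ← map_sub, ← map_sub]
  exact arg_pos_of_wedge_pos hε hw

lemma _root_.TriChain.step_ne_zero {p : ℤ → Plane} {N : ℤ} (H : TriChain ε p β γ N) (j : ℤ) :
    step p j ≠ 0 := by
  have h1 := H.pos
  have h2 := H.lt
  have h3 := H.lt'
  have key : ∀ j, 0 ≤ j → j < N → step p j ≠ 0 := by
    intro j hj hj' h0
    rcases lt_or_ge j β with hk | hk
    · have := H.pos₁₂ j β hj hk le_rfl h2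
      simp [h0] at this
    · rcases lt_or_ge j γ with hk' | hk'
      · have := H.pos₂₃ j γ hk hk' le_rfl h3
        simp [h0] at this
      · have := H.pos₃₁ j 0 hk' hj' le_rfl h1
        simp [h0] at this
  have hmul : ∀ (m : ℤ), step p (j + m * N) = step p j := by
    have hper : Function.Periodic (step p) N := H.step_periodic
    exact fun m => hper.int_mul m j
  have e : step p (j % N) = step p j := by
    rw [← hmul (-(j / N))]
    congr 1
    have := Int.emod_add_mul_ediv j N
    linarith
  rw [← e]
  exact key _ (Int.emod_nonneg _ (by omega)) (Int.emod_lt_of_pos _ (by omega))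

lemma _root_.TriChain.wedge_corners_pos₂ {p : ℤ → Plane} {N : ℤ} (H : TriChain ε p β γ N) :
    0 < wedge ε (p γ - p β) (p 0 - p γ) := by
  have := H.shift.wedge_corners_pos
  rwa [sub_add_cancel, sub_add_cancel, zero_add, H.period] at this

lemma _root_.TriChain.wedge_corners_pos₃ {p : ℤ → Plane} {N : ℤ} (H : TriChain ε p β γ N) :
    0 < wedge ε (p 0 - p γ) (p β - p 0) := by
  have := H.shift.wedge_corners_pos₂
  rwa [sub_add_cancel, sub_add_cancel, zero_add, H.period] at this

/-- Up to the sign `ε`, each chain is seen under an angle strictly between `0` and `π`. The total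
lies strictly between `0` and `3π` and is a multiple of `2π`, so it is `2π`, an odd multiple. -/
lemma enclosed_subset_region {β γ : ℕ} (H : TriChain ε (P.unroll a) β γ n) :
    enclosed ε (P.unroll a) β γ n ⊆ P.region := by
  rintro x ⟨hx₁, hx₂, hx₃⟩
  by_cases hxb : x ∈ P.boundary ℝ
  · exact Or.inl hxb
  have h1 := H.pos
  have h2 := H.lt
  have h3 := H.lt'
  have hε := H.sign
  obtain ⟨k, hk, hk'⟩ := exists_windingAngle_eq hxb
  rw [hk']
  have hedge : ∀ k : ℤ, x ∉ segment ℝ (P.unroll a k) (P.unroll a (k + 1)) := fun k h =>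
    hxb (P.segment_unroll_subset_boundary a k h)
  have hW : P.windingAngle x = ∑ k ∈ Finset.range n, Complex.arg
      ((toC (P.unroll a (k + 1 : ℕ)) - toC x) / (toC (P.unroll a k) - toC x)) := by
    rw [P.windingAngle_eq_sum a x]
    simp [toCFrom, unroll]
  set p := P.unroll a with hp
  have s1 := exists_sum_arg_chain hε (l := 0) (h := β) (by omega) (by exact_mod_cast H.bending₁)
    H.step_ne_zero (C := p γ) hedge (by exact_mod_cast H.wedge_corners_pos) hx₂.1
    (by
      have := hx₃.1
      rw [H.period] at this
      exact_mod_cast this) (by exact_mod_cast hx₁)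
  have s2 := exists_sum_arg_chain hε (l := β) (h := γ) (by omega) H.bending₂
    H.step_ne_zero (C := p 0) hedge H.wedge_corners_pos₂ (by
      have := hx₃.1
      rwa [H.period] at this) hx₁.1 hx₂
  have s3 := exists_sum_arg_chain hε (l := γ) (h := n) (by omega) H.bending₃
    H.step_ne_zero (C := p β) hedge (by rw [H.period]; exact H.wedge_corners_pos₃)
    (by rw [H.period]; exact hx₁.1) hx₂.1 hx₃
  rw [hW, Finset.range_eq_Ico, ← Finset.sum_Ico_consecutive _ (Nat.zero_le γ) (by omega),
    ← Finset.sum_Ico_consecutive _ (Nat.zero_le β) (by omega)] at hk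
  have hpi := Real.pi_pos
  have hlow : 0 < ε * (2 * Real.pi * k) := by rw [← hk]; linarith [s1.1, s2.1, s3.1]
  have hhigh : ε * (2 * Real.pi * k) < 3 * Real.pi := by rw [← hk]; linarith [s1.2, s2.2, s3.2]
  have l1 : 0 < ε * k := by
    have : 0 < (2 * Real.pi) * (ε * k) := by linarith
    exact pos_of_mul_pos_right this (by positivity)
  have l2 : ε * k < 2 := by nlinarith
  rcases hε with rfl | rfl
  · rw [one_mul] at l1 l2
    have : 0 < k := by exact_mod_cast l1
    have : k < 2 := by exact_mod_cast l2
    have : k = 1 := by omega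
    rw [this]; exact odd_one
  · have l1' : (k : ℝ) < 0 := by linarith
    have l2' : (-2 : ℝ) < k := by linarith
    have : k < 0 := by exact_mod_cast l1'
    have : -2 < k := by exact_mod_cast l2'
    have : k = -1 := by omega
    rw [this]; decide

/-- The region of a polygon with three chains. -/
theorem region_eq_enclosed {β γ : ℕ} (H : TriChain ε (P.unroll a) β γ n) :
    P.region = enclosed ε (P.unroll a) β γ n :=
  Set.Subset.antisymm (region_subset_enclosed H) (enclosed_subset_region H)

end Polygon

end

section

open Fin.CommRing

/-! ### Three chains form a pseudo-triangle -/

open Plane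

/-- The later edge lies weakly beyond the line of the earlier one and can touch it only with its
first end. -/
lemma Bending.eq_of_mem_edges {ε : ℝ} {p : ℤ → Plane} {l h i j : ℤ} (H : Bending ε p l h)
    (hi : l ≤ i) (hij : i < j) (hj : j < h) {x : Plane} (hx : x ∈ segment ℝ (p i) (p (i + 1)))
    (hx' : x ∈ segment ℝ (p j) (p (j + 1))) : j = i + 1 ∧ x = p j := by
  obtain ⟨s, t, hs, ht, hst, rfl⟩ := hx
  obtain ⟨u, v, hu, hv, huv, e⟩ := hx'
  have h1 : side ε p i (s • p i + t • p (i + 1)) = 0 := by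
    rw [side_combo _ _ _ _ _ hst, side_self, side_succ]; ring
  rw [← e, side_combo _ _ _ _ _ huv] at h1
  have h2 := H.side_nonpos hi (by omega) (k := j) (by omega) hj.le
  have h3 := H.side_neg hi (by omega) (k := j + 1) (by omega) (by omega) (by omega) (by omega)
  have hv0 : v = 0 := by
    by_contra hne
    have := lt_of_le_of_ne hv (Ne.symm hne)
    nlinarith
  have hu1 : u = 1 := by linarith
  subst hv0 hu1
  constructor
  · by_contra hne
    have := H.side_neg hi (by omega) (k := j) (by omega) hj.le (by omega) hne
    linarith
  · rw [← e]; simp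

namespace TriChain

variable {ε : ℝ} {p : ℤ → Plane} {β γ n : ℤ}

/-- The line of the last edge of the first chain separates the chains, and the second chain meets it
only at the corner. -/
lemma eq_of_mem_edges₁₂ (H : TriChain ε p β γ n) {i j : ℤ} (hi : 0 ≤ i) (hi' : i < β)
    (hj : β ≤ j) (hj' : j < γ) {x : Plane} (hx : x ∈ segment ℝ (p i) (p (i + 1)))
    (hx' : x ∈ segment ℝ (p j) (p (j + 1))) : j = i + 1 ∧ x = p j := by
  obtain ⟨s, t, hs, ht, hst, rfl⟩ := hx
  obtain ⟨u, v, hu, hv, huv, e⟩ := hx'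
  have hpos : ∀ k, β < k → k ≤ γ → 0 < side ε p (β - 1) (p k) := by
    intro k hk hk'
    rw [side_eq ε p (β - 1) (p (β - 1 + 1)), side_succ, zero_add, sub_add_cancel]
    exact wedge_sub_pos hk fun m hm hm' => H.pos₁₂ _ _ (by omega) (by omega) hm (by omega)
  have hB := H.bending₁
  have h1 : side ε p (β - 1) (s • p i + t • p (i + 1)) ≤ 0 := by
    rw [side_combo _ _ _ _ _ hst]
    have := hB.side_nonpos (j := β - 1) (by omega) (by omega) hi hi'.le
    have := hB.side_nonpos (j := β - 1) (k := i + 1) (by omega) (by omega) (by omega) (by omega)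
    nlinarith
  have h2 := h1
  rw [← e, side_combo _ _ _ _ _ huv] at h2
  have h3 := H.side_last_nonneg₁ hj hj'.le
  have h4 := hpos (j + 1) (by omega) (by omega)
  have hv0 : v = 0 := by
    by_contra hne
    have := lt_of_le_of_ne hv (Ne.symm hne)
    nlinarith
  have hu1 : u = 1 := by linarith
  subst hv0 hu1
  rw [one_smul, zero_smul, add_zero] at e
  have hjβ : j = β := by
    by_contra hne
    have := hpos j (by omega) (by omega)
    linarith
  subst hjβ
  refine ⟨?_, e.symm⟩
  by_contra hne
  have h5 := hB.side_neg (j := j - 1) (by omega) (by omega) hi hi'.le (by omega) (by omega)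
  have h6 := hB.side_nonpos (j := j - 1) (k := i + 1) (by omega) (by omega) (by omega) (by omega)
  have h7 : side ε p (j - 1) (s • p i + t • p (i + 1)) = 0 := by
    rw [← e]
    conv_lhs => rw [← sub_add_cancel j 1]
    rw [add_sub_cancel_right, side_succ]
  rw [side_combo _ _ _ _ _ hst] at h7
  have hs0 : s = 0 := by
    by_contra hne
    have := lt_of_le_of_ne hs (Ne.symm hne)
    nlinarith
  have ht1 : t = 1 := by linarith
  subst hs0 ht1
  rw [one_smul, zero_smul, zero_add] at e
  have h8 : i + 1 = j - 1 := by
    by_contra hne'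
    have := hB.side_neg (j := j - 1) (k := i + 1) (by omega) (by omega) (by omega) (by omega) hne'
      (by omega)
    linarith
  apply H.step_ne_zero (j - 1)
  rw [step, sub_add_cancel, e, h8, sub_self]

lemma eq_of_mem_edges (H : TriChain ε p β γ n) {i j : ℤ} (hi : 0 ≤ i) (hij : i < j) (hj : j < n)
    {x : Plane} (hx : x ∈ segment ℝ (p i) (p (i + 1))) (hx' : x ∈ segment ℝ (p j) (p (j + 1))) :
    (j = i + 1 ∧ x = p j) ∨ (i = 0 ∧ j + 1 = n ∧ x = p i) := by
  have h1 := H.pos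
  have h2 := H.lt
  have h3 := H.lt'
  rcases lt_or_ge j β with hjβ | hjβ
  · exact Or.inl (H.bending₁.eq_of_mem_edges hi hij hjβ hx hx')
  rcases lt_or_ge i β with hiβ | hiβ
  · rcases lt_or_ge j γ with hjγ | hjγ
    · exact Or.inl (H.eq_of_mem_edges₁₂ hi hiβ hjβ hjγ hx hx')
    · right
      -- The third chain and the first are consecutive after two shifts, once `i` is moved on by a
      -- full period.
      have e1 : p i = p (i + n - γ + (γ - β) + β) := by
        rw [show i + n - γ + (γ - β) + β = i + n by ring, H.periodic]
      have e2 : p (i + 1) = p (i + n - γ + 1 + (γ - β) + β) := by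
        rw [show i + n - γ + 1 + (γ - β) + β = i + 1 + n by ring, H.periodic]
      have e3 : p j = p (j - γ + (γ - β) + β) := by
        rw [show j - γ + (γ - β) + β = j by ring]
      have e4 : p (j + 1) = p (j - γ + 1 + (γ - β) + β) := by
        rw [show j - γ + 1 + (γ - β) + β = j + 1 by ring]
      rw [e1, e2] at hx
      rw [e3, e4] at hx'
      obtain ⟨h4, h5⟩ := H.shift.shift.eq_of_mem_edges₁₂ (i := j - γ) (j := i + n - γ) (by omega)
        (by omega) (by omega) (by omega) hx' hx
      refine ⟨by omega, by omega, ?_⟩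
      rw [e1]; exact h5
  · rcases lt_or_ge j γ with hjγ | hjγ
    · exact Or.inl (H.bending₂.eq_of_mem_edges hiβ hij hjγ hx hx')
    · rcases lt_or_ge i γ with hiγ | hiγ
      · left
        have e : ∀ k, p k = p (k - β + β) := fun k => by rw [sub_add_cancel]
        have e' : ∀ k, p (k + 1) = p (k - β + 1 + β) := fun k => by
          rw [show k - β + 1 + β = k + 1 by ring]
        rw [e i, e' i] at hx
        rw [e j, e' j] at hx'
        obtain ⟨h4, h5⟩ := H.shift.eq_of_mem_edges₁₂ (i := i - β) (j := j - β) (by omega)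
          (by omega) (by omega) (by omega) hx hx'
        exact ⟨by omega, by rw [e j]; exact h5⟩
      · exact Or.inl (H.bending₃.eq_of_mem_edges hiγ hij hj hx hx')

lemma base_side_nonneg₁ (H : TriChain ε p β γ n) (k : ℤ) :
    0 ≤ wedge ε (p β - p 0) (p k - p 0) := by
  have h1 := H.pos
  have h2 := H.lt
  have h3 := H.lt'
  have hper : Function.Periodic p n := H.periodic
  have e : p (k % n) = p k := by
    rw [← hper.int_mul (k / n) (k % n)]
    congr 1
    have := Int.emod_add_mul_ediv k n
    simp only [Int.cast_id]
    linarith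
  rw [← e]
  exact H.base_side_nonneg (Int.emod_nonneg _ (by omega)) (Int.emod_lt_of_pos _ (by omega)).le

lemma base_side_nonneg₂ (H : TriChain ε p β γ n) (k : ℤ) :
    0 ≤ wedge ε (p γ - p β) (p k - p β) := by
  have := H.shift.base_side_nonneg₁ (k - β)
  simpa using this

lemma base_side_nonneg₃ (H : TriChain ε p β γ n) (k : ℤ) :
    0 ≤ wedge ε (p n - p γ) (p k - p γ) := by
  have := H.shift.base_side_nonneg₂ (k - β)
  simpa using this

lemma side_first_pos₂ (H : TriChain ε p β γ n) {k : ℤ} (h0 : n ≤ k) (hn : k < n + β) :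
    0 < side ε p β (p k) := by
  have := H.shift.side_first_pos₁ (k := k - β) (by omega) (by omega)
  rwa [side_shift, sub_add_cancel, zero_add] at this

end TriChain

namespace Polygon

variable {n : ℕ} [NeZero n] {P : Polygon Plane n} {a : Fin n} {ε : ℝ}

lemma triChain_shift {β γ : ℕ} (H : TriChain ε (P.unroll a) β γ n) :
    TriChain ε (P.unroll (a + (β : Fin n))) ((γ - β : ℕ) : ℤ) ((n - β : ℕ) : ℤ) n := by
  have := H.shift
  have h1 := H.lt
  have h2 := H.lt'
  rw [unroll_shift, Int.cast_natCast] at this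
  rw [Nat.cast_sub (by omega), Nat.cast_sub (by omega)]
  exact this

lemma unroll_add_one (P : Polygon Plane n) (a : Fin n) (k : ℤ) :
    P (a + (k : Fin n) + 1) = P.unroll a (k + 1) := (unroll_succ P a k).symm

lemma unroll_sub_one (P : Polygon Plane n) (a : Fin n) (k : ℤ) :
    P (a + (k : Fin n) - 1) = P.unroll a (k - 1) := by
  rw [unroll]; push_cast; rw [add_sub_assoc]

lemma isSimple_of_triChain {β γ : ℕ} (H : TriChain ε (P.unroll a) β γ n) : P.IsSimple := by
  have h1 := H.pos
  have h2 := H.lt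
  have h3 := H.lt'
  have hedge : ∀ i j : Fin n, i ≠ j → ∀ x ∈ segment ℝ (P i) (P (i + 1)) ∩
      segment ℝ (P j) (P (j + 1)), (j = i + 1 ∧ x = P j) ∨ (i = j + 1 ∧ x = P i) := by
    rintro i j hij x ⟨hx, hx'⟩
    obtain ⟨k, k0, k1, ki, kp, kp'⟩ := exists_unroll P a i
    obtain ⟨l, l0, l1, li, lp, lp'⟩ := exists_unroll P a j
    rw [kp, kp'] at hx
    rw [lp, lp'] at hx'
    rw [kp, lp]
    have hkl : k ≠ l := fun h => hij (by rw [ki, li, h])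
    have hlast : ∀ m : ℤ, m + 1 = n → a + (m : Fin n) + 1 = a := by
      intro m hm
      have : ((m + 1 : ℤ) : Fin n) = 0 := by rw [hm, intCast_self]
      push_cast at this
      rw [add_assoc, this, add_zero]
    rcases lt_or_gt_of_ne hkl with hlt | hlt
    · rcases H.eq_of_mem_edges k0 hlt l1 hx hx' with ⟨h4, h5⟩ | ⟨h4, h6, h5⟩
      · left
        refine ⟨?_, h5⟩
        rw [ki, li, h4]; push_cast; ring
      · right
        refine ⟨?_, h5⟩
        rw [ki, li, hlast l h6, h4]; simp
    · rcases H.eq_of_mem_edges l0 hlt k1 hx' hx with ⟨h4, h5⟩ | ⟨h4, h6, h5⟩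
      · right
        refine ⟨?_, h5⟩
        rw [ki, li, h4]; push_cast; ring
      · left
        refine ⟨?_, h5⟩
        rw [ki, li, hlast k h6, h4]; simp
  refine ⟨by omega, ?_, fun i j hij x hx => hedge i j hij x (by
    simpa only [edgeSet_eq_segment] using hx)⟩
  intro i j hP
  by_contra hij
  have hne : ∀ i : Fin n, P i ≠ P (i + 1) := by
    intro i hi
    obtain ⟨k, -, -, -, kp, kp'⟩ := exists_unroll P a i
    apply H.step_ne_zero k
    rw [step, ← kp, ← kp', hi, sub_self]
  have hP : P i = P j := hP
  rcases hedge i j hij (P i) ⟨left_mem_segment _ _ _, hP ▸ left_mem_segment _ _ _⟩ with h | h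
  · exact hne i (by rw [← h.1]; exact hP)
  · exact hne j (by rw [← h.1]; exact hP.symm)

/-- The conditions from the opposite chain are strict at the corner and persist nearby. Those from
the two adjacent chains hold along the median because both neighbours of the corner satisfy them,
with edges `0` and `n - 1` as witnesses. -/
lemma isConvexVertex_of_triChain {β γ : ℕ} (H : TriChain ε (P.unroll a) β γ n) :
    P.IsConvexVertex a := by
  have h1 := H.pos
  have h2 := H.lt
  have h3 := H.lt'
  have hε : ε ≠ 0 := by rcases H.sign with h | h <;> simp [h]
  have hreg := region_eq_enclosed H
  have e0 : P a = P.unroll a 0 := by simp [unroll]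
  have e1 : P (a + 1) = P.unroll a 1 := by simp [unroll]
  have e2 : P (a - 1) = P.unroll a (n - 1) := by
    have := P.unroll_sub_one a n
    rwa [intCast_self, add_zero] at this
  set p := P.unroll a with hp
  have es0 : step p 0 = p 1 - p 0 := by rw [step, zero_add]
  have es1 : step p (n - 1) = p 0 - p (n - 1) := by rw [step, sub_add_cancel, H.period]
  have h30 := H.pos₃₁ (n - 1) 0 (by omega) (by omega) le_rfl (by omega)
  rw [IsConvexVertex, collinear_iff_wedge hε, e0, e1, e2]
  refine ⟨by rw [← es0, ← es1]; exact h30.ne', ?_⟩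
  rw [hreg]
  set m := (p (n - 1) - p 0) + (p 1 - p 0) with hm
  have hcont : ∀ f : Plane →ₗ[ℝ] ℝ, ∀ y, 0 < f (p 0 - y) →
      ∀ᶠ t : ℝ in 𝓝[>] 0, 0 < f (p 0 + t • m - y) := by
    intro f y hf
    have hc : Continuous fun t : ℝ => f (p 0 + t • m - y) :=
      f.continuous_of_finiteDimensional.comp (by fun_prop)
    have : Filter.Tendsto (fun t : ℝ => f (p 0 + t • m - y)) (𝓝[>] 0) (𝓝 (f (p 0 - y))) := by
      have := hc.tendsto 0
      rw [zero_smul, add_zero] at this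
      exact this.mono_left nhdsWithin_le_nhds
    exact this (Ioi_mem_nhds hf)
  have hc1 : 0 < wedge ε (p γ - p β) (p 0 - p β) := by
    have := H.wedge_corners_pos₂
    rw [← sub_add_sub_cancel (p 0) (p γ) (p β), map_add, wedge_self, add_zero]
    exact this
  have hc2 : 0 < wedge ε (step p β) (p 0 - p β) := by
    have := H.side_first_pos₂ (k := n) le_rfl (by omega)
    rwa [H.period] at this
  filter_upwards [self_mem_nhdsWithin, hcont _ _ hc1, hcont _ _ hc2] with t ht ht1 ht2
  have ht : 0 < t := ht
  have em : p 0 + t • m - p 0 = t • (p (n - 1) - p 0) + t • (p 1 - p 0) := by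
    rw [add_sub_cancel_left, hm, smul_add]
  refine ⟨⟨?_, 0, le_rfl, h1, ?_⟩, ⟨ht1.le, β, le_rfl, h2, ht2.le⟩, ⟨?_, n - 1, by omega, by omega, ?_⟩⟩
  · rw [em, map_add, map_smul, map_smul]
    exact add_nonneg (mul_nonneg ht.le (H.base_side_nonneg₁ _))
      (mul_nonneg ht.le (H.base_side_nonneg₁ _))
  · rw [side, em, map_add, map_smul, map_smul, es0, wedge_self, smul_zero, add_zero, ← es0]
    exact mul_nonneg ht.le (H.side_first_pos₁ (by omega) (by omega)).le
  · have e3 : ∀ x, wedge ε (p n - p γ) (x - p γ) = wedge ε (p n - p γ) (x - p 0) := by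
      intro x
      rw [← sub_add_sub_cancel x (p 0) (p γ), map_add, H.period, wedge_self, add_zero]
    rw [e3, em, map_add, map_smul, map_smul, ← e3, ← e3]
    exact add_nonneg (mul_nonneg ht.le (H.base_side_nonneg₃ _))
      (mul_nonneg ht.le (H.base_side_nonneg₃ _))
  · rw [side_eq ε p (n - 1) (p (n - 1 + 1)), side_succ, zero_add, sub_add_cancel, H.period, em, map_add,
      map_smul, map_smul, ← neg_sub (p 0), ← es1, map_neg, wedge_self, neg_zero, smul_zero, zero_add,
      ← es0]
    exact (mul_pos ht h30).le

/-- For `0 < t ≤ 1 / 2` the point on the median is a mixture of the vertex with the midpoint of its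
neighbours, which is strictly beyond every edge of the chain. -/
lemma isReflexVertex_of_triChain {β γ : ℕ} (H : TriChain ε (P.unroll a) β γ n) {k : ℤ} (hk : 0 < k)
    (hk' : k < β) : P.IsReflexVertex (a + (k : Fin n)) := by
  have hε : ε ≠ 0 := by rcases H.sign with h | h <;> simp [h]
  rw [IsReflexVertex, collinear_iff_wedge hε, unroll_add_one, unroll_sub_one]
  change ¬ wedge ε (P.unroll a k - _) (_ - P.unroll a k) = 0 ∧ ∀ᶠ t : ℝ in _, P.unroll a k +
    t • (P.unroll a (k - 1) - P.unroll a k + (P.unroll a (k + 1) - P.unroll a k)) ∉ _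
  set p := P.unroll a with hp
  have e : p k - p (k - 1) = step p (k - 1) := by rw [step, sub_add_cancel]
  refine ⟨?_, ?_⟩
  · rw [e]
    exact (H.neg₁ (k - 1) k (by omega) (by omega) hk').ne
  · filter_upwards [Ioc_mem_nhdsGT (show (0 : ℝ) < 1 / 2 by norm_num)] with t ht
    refine notMem_region_of_not_chainSide H ?_
    rintro ⟨-, j, hj, hj', hs⟩
    have e2 : p k + t • (p (k - 1) - p k + (p (k + 1) - p k)) = (1 - 2 * t) • p k +
        (2 * t) • ((1 / 2 : ℝ) • p (k - 1) + (1 / 2 : ℝ) • p (k + 1)) := by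
      module
    rw [← hp, e2, side_combo _ _ _ _ _ (by ring)] at hs
    have h1 := H.bending₁.side_nonpos hj hj' hk.le hk'.le
    have h2 := H.bending₁.side_midpoint_neg hj hj' (k := k - 1) (k' := k + 1) (by omega) (by omega)
      (by omega)
    have := ht.1
    have := ht.2
    nlinarith

/-- The converse of `IsPseudoTriangle.exists_triChain`, by which pieces cut off by chords are
recognised as towers. -/
theorem isPseudoTriangle_of_triChain {b c : Fin n}
    (H : TriChain ε (P.unroll a) ((b - a).val : ℤ) ((c - a).val : ℤ) n) :
    P.IsPseudoTriangle a b c := by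
  have h1 := H.pos
  have h2 := H.lt
  have h3 := H.lt'
  have H2 := triChain_shift H
  have H3 := triChain_shift H2
  have eb : a + ((b - a).val : Fin n) = b := by rw [Fin.cast_val_eq_self]; ring
  have ec : b + (((c - a).val - (b - a).val : ℕ) : Fin n) = c := by
    rw [Nat.cast_sub (by omega), Fin.cast_val_eq_self, Fin.cast_val_eq_self]; ring
  rw [eb] at H2 H3
  rw [ec] at H3
  refine ⟨isSimple_of_triChain H, by rw [Fin.lt_def]; exact_mod_cast h1,
    by rw [Fin.lt_def]; exact_mod_cast h2, isConvexVertex_of_triChain H,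
    isConvexVertex_of_triChain H2, isConvexVertex_of_triChain H3, ?_⟩
  intro i hia hib hic
  obtain ⟨k, k0, k1, ki, -, -⟩ := exists_unroll P a i
  have hk0 : k ≠ 0 := fun h => hia (by rw [ki, h]; simp)
  have hkb : k ≠ (b - a).val := fun h => hib (by rw [ki, h, Int.cast_natCast, eb])
  have hkc : k ≠ (c - a).val := fun h => hic (by
    rw [ki, h, Int.cast_natCast, Fin.cast_val_eq_self]; ring)
  rcases lt_or_ge k (b - a).val with h4 | h4
  · rw [ki]
    exact isReflexVertex_of_triChain H (by omega) h4
  · rcases lt_or_ge k (c - a).val with h5 | h5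
    · have := isReflexVertex_of_triChain H2 (k := k - (b - a).val) (by omega) (by omega)
      convert this using 1
      rw [ki]
      push_cast
      ring
    · have := isReflexVertex_of_triChain H3 (k := k - (c - a).val) (by omega) (by omega)
      convert this using 1
      rw [ki]
      push_cast
      ring

end Polygon

end

section

/-! ### Visibility in a region enclosed by three chains -/

open Plane

/-- A vector weakly between the directions `-a` and `-b`. -/
lemma Plane.exists_cone {ε : ℝ} {a b d : Plane} (hab : wedge ε a b < 0) (ha : 0 ≤ wedge ε a d)
    (hb : wedge ε b d ≤ 0) : ∃ s t : ℝ, 0 ≤ s ∧ 0 ≤ t ∧ (0 < wedge ε a d → 0 < t) ∧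
      (wedge ε b d < 0 → 0 < s) ∧ -d = s • a + t • b := by
  have h := wedge_smul_eq ε a b d
  refine ⟨-(wedge ε d b / wedge ε a b), -(wedge ε a d / wedge ε a b), ?_, ?_, ?_, ?_, ?_⟩
  · rw [neg_nonneg, wedge_swap]
    exact div_nonpos_of_nonneg_of_nonpos (by linarith) hab.le
  · rw [neg_nonneg]
    exact div_nonpos_of_nonneg_of_nonpos ha hab.le
  · intro h1
    rw [neg_pos]
    exact div_neg_of_pos_of_neg h1 hab
  · intro h1
    rw [neg_pos, wedge_swap]
    exact div_neg_of_pos_of_neg (by linarith) hab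
  · have e : d = (wedge ε a b)⁻¹ • (wedge ε a b • d) := by
      rw [smul_smul, inv_mul_cancel₀ hab.ne, one_smul]
    conv_lhs => rw [e, h]
    rw [smul_add, smul_smul, smul_smul, neg_smul, neg_smul, ← neg_add, div_eq_inv_mul,
      div_eq_inv_mul]

/-- The segment between `p i` and `p k` stays in the region enclosed by three chains. -/
def Sees (ε : ℝ) (p : ℤ → Plane) (β γ n i k : ℤ) : Prop :=
  segment ℝ (p i) (p k) ⊆ enclosed ε p β γ n

lemma Bending.midpoint_not_chainSide {ε : ℝ} {p : ℤ → Plane} {l h k k' : ℤ} (H : Bending ε p l h)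
    (hk : l ≤ k) (hkk : k + 2 ≤ k') (hk' : k' ≤ h) :
    ¬ ChainSide ε p l h ((1 / 2 : ℝ) • p k + (1 / 2 : ℝ) • p k') := by
  rintro ⟨-, j, hj, hj', hs⟩
  exact (H.side_midpoint_neg hj hj' hk hkk hk').not_ge hs

lemma half_smul_add_half_smul_mem_segment (x y : Plane) :
    (1 / 2 : ℝ) • x + (1 / 2 : ℝ) • y ∈ segment ℝ x y :=
  ⟨1 / 2, 1 / 2, by norm_num, by norm_num, by norm_num, rfl⟩

namespace TriChain

variable {ε : ℝ} {p : ℤ → Plane} {β γ n : ℤ}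

lemma sees_reverse (H : TriChain ε p β γ n) (i k : ℤ) :
    Sees (-ε) (fun i => p (-i)) (n - γ) (n - β) n i k ↔ Sees ε p β γ n (n - i) (n - k) := by
  rw [Sees, Sees, H.enclosed_reverse, ← H.periodic (-i), ← H.periodic (-k), neg_add_eq_sub,
    neg_add_eq_sub]

lemma side_reverse (H : TriChain ε p β γ n) (k : ℤ) (x : Plane) :
    side (-ε) (fun i => p (-i)) k x = side ε p (n - k - 1) x := by
  rw [_root_.side_reverse, ← H.side_periodic]
  congr 1
  ring

lemma apply_neg (H : TriChain ε p β γ n) (k : ℤ) : p (-k) = p (n - k) := by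
  rw [← H.periodic, neg_add_eq_sub]

/-- The midpoint is cut off by the chain itself. As the neighbours of an interior vertex of a chain
are two apart on it, such a vertex is never detected. -/
lemma not_sees₁ (H : TriChain ε p β γ n) {k k' : ℤ} (hk : 0 ≤ k) (hkk : k + 2 ≤ k')
    (hk' : k' ≤ β) : ¬ Sees ε p β γ n k k' := fun h =>
  H.bending₁.midpoint_not_chainSide hk hkk hk' (h (half_smul_add_half_smul_mem_segment _ _)).1

lemma not_sees₂ (H : TriChain ε p β γ n) {k k' : ℤ} (hk : β ≤ k) (hkk : k + 2 ≤ k')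
    (hk' : k' ≤ γ) : ¬ Sees ε p β γ n k k' := fun h =>
  H.bending₂.midpoint_not_chainSide hk hkk hk' (h (half_smul_add_half_smul_mem_segment _ _)).2.1

lemma not_sees₃ (H : TriChain ε p β γ n) {k k' : ℤ} (hk : γ ≤ k) (hkk : k + 2 ≤ k')
    (hk' : k' ≤ n) : ¬ Sees ε p β γ n k k' := fun h =>
  H.bending₃.midpoint_not_chainSide hk hkk hk' (h (half_smul_add_half_smul_mem_segment _ _)).2.2

/-- Vertices see each other if in each chain there is an edge with both on its inner side. -/
lemma sees_of_sides (H : TriChain ε p β γ n) {i k : ℤ} {j₁ j₂ j₃ : ℤ} (h₁ : 0 ≤ j₁) (h₁' : j₁ < β)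
    (h₂ : β ≤ j₂) (h₂' : j₂ < γ) (h₃ : γ ≤ j₃) (h₃' : j₃ < n)
    (i₁ : 0 ≤ side ε p j₁ (p i)) (k₁ : 0 ≤ side ε p j₁ (p k))
    (i₂ : 0 ≤ side ε p j₂ (p i)) (k₂ : 0 ≤ side ε p j₂ (p k))
    (i₃ : 0 ≤ side ε p j₃ (p i)) (k₃ : 0 ≤ side ε p j₃ (p k)) : Sees ε p β γ n i k := by
  rintro x ⟨s, t, hs, ht, hst, rfl⟩
  have hc : ∀ j, 0 ≤ side ε p j (p i) → 0 ≤ side ε p j (p k) →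
      0 ≤ side ε p j (s • p i + t • p k) := by
    intro j hi hk
    rw [side_combo _ _ _ _ _ hst]
    positivity
  refine ⟨⟨?_, j₁, h₁, h₁', hc _ i₁ k₁⟩, ⟨?_, j₂, h₂, h₂', hc _ i₂ k₂⟩, ⟨?_, j₃, h₃, h₃', hc _ i₃ k₃⟩⟩
  · rw [wedge_combo_sub _ _ _ _ _ hst]
    exact add_nonneg (mul_nonneg hs (H.base_side_nonneg₁ _)) (mul_nonneg ht (H.base_side_nonneg₁ _))
  · rw [wedge_combo_sub _ _ _ _ _ hst]
    exact add_nonneg (mul_nonneg hs (H.base_side_nonneg₂ _)) (mul_nonneg ht (H.base_side_nonneg₂ _))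
  · rw [wedge_combo_sub _ _ _ _ _ hst]
    exact add_nonneg (mul_nonneg hs (H.base_side_nonneg₃ _)) (mul_nonneg ht (H.base_side_nonneg₃ _))

lemma side_last_nonneg₂ (H : TriChain ε p β γ n) {k : ℤ} (h0 : γ ≤ k) (hn : k ≤ n) :
    0 ≤ side ε p (γ - 1) (p k) := by
  have := H.shift.side_last_nonneg₁ (k := k - β) (by omega) (by omega)
  rw [side_shift, sub_add_cancel] at this
  convert this using 2
  ring

lemma side_last_nonneg₃ (H : TriChain ε p β γ n) {k : ℤ} (h0 : 0 ≤ k) (hn : k ≤ β) :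
    0 ≤ side ε p (n - 1) (p k) := by
  have h2 := H.lt'
  have h1 := H.lt
  rw [side_eq ε p (n - 1) (p (n - 1 + 1)), side_succ, zero_add, sub_add_cancel, H.period]
  exact wedge_sub_nonneg h0 fun j hj hj' =>
    (H.pos₃₁ _ j (by omega) (by omega) (by omega) (by omega)).le

lemma side_β_one (H : TriChain ε p β γ n) : 0 ≤ side ε p β (p 1) ∧
    (1 < β → 0 < side ε p β (p 1)) := by
  have h1 := H.pos
  have key : 1 < β → 0 < side ε p β (p 1) := by
    intro hβ
    have := H.side_first_pos₂ (k := 1 + n) (by omega) (by omega)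
    rwa [H.periodic] at this
  refine ⟨?_, key⟩
  rcases eq_or_lt_of_le (show 1 ≤ β by omega) with h | h
  · rw [h, side_self]
  · exact (key h).le

/-- The first vertex of the middle chain at which it turns away from the neighbour of the corner. -/
lemma exists_tangent (H : TriChain ε p β γ n) : ∃ m, β < m ∧ m ≤ γ ∧
    (∀ j, β < j → j < m → 0 < side ε p j (p 1)) ∧ (m < γ → side ε p m (p 1) ≤ 0) := by
  have h2 := H.lt
  obtain ⟨m, ⟨h3, h4, h5⟩, hmin⟩ := Int.exists_least_of_bdd
    (P := fun m => β < m ∧ m ≤ γ ∧ (m < γ → side ε p m (p 1) ≤ 0))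
    ⟨β, fun z hz => hz.1.le⟩ ⟨γ, h2, le_rfl, fun h => absurd h (lt_irrefl _)⟩
  refine ⟨m, h3, h4, fun j hj hj' => ?_, h5⟩
  by_contra hc
  have := hmin j ⟨hj, by omega, fun _ => not_lt.1 hc⟩
  omega

end TriChain

/-- The middle chain blocks the view between the neighbours `p 1` and `p (n - 1)` of the corner, and
`p m` and `p m'` are the vertices at which it is touched by the shortest path between them. -/
structure Tangents (ε : ℝ) (p : ℤ → Plane) (β γ n m m' : ℤ) : Prop where
  lt : β < m
  le : m ≤ m'
  lt' : m' < γ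
  pos : ∀ j, β < j → j < m → 0 < side ε p j (p 1)
  nonpos : side ε p m (p 1) ≤ 0
  pos' : ∀ j, m' ≤ j → j < γ - 1 → 0 < side ε p j (p (n - 1))
  nonpos' : side ε p (m' - 1) (p (n - 1)) ≤ 0
  blocked : ∃ s t : ℝ, 0 ≤ s ∧ 0 ≤ t ∧ s + t = 1 ∧ ∀ j, β ≤ j → j < γ →
    s * side ε p j (p 1) + t * side ε p j (p (n - 1)) < 0

/-- If the neighbours of a corner do not see each other, then the opposite chain is in the way. -/
theorem TriChain.exists_tangents {ε : ℝ} {p : ℤ → Plane} {β γ n : ℤ} (H : TriChain ε p β γ n)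
    (h : ¬ Sees ε p β γ n 1 (n - 1)) : ∃ m m', Tangents ε p β γ n m m' := by
  have h1 := H.pos
  have h2 := H.lt
  have h3 := H.lt'
  -- At a point of the segment outside the region all conditions on chords hold, and edges `0` and
  -- `n - 1` witness those of the adjacent chains, so the point is strictly beyond every edge of the
  -- opposite chain.
  have hblock : ∃ s t : ℝ, 0 ≤ s ∧ 0 ≤ t ∧ s + t = 1 ∧ ∀ j, β ≤ j → j < γ →
      s * side ε p j (p 1) + t * side ε p j (p (n - 1)) < 0 := by
    rw [Sees, Set.not_subset] at h
    obtain ⟨x, ⟨s, t, hs, ht, hst, rfl⟩, hx⟩ := h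
    refine ⟨s, t, hs, ht, hst, ?_⟩
    by_contra! hc
    obtain ⟨j, hj, hj', hc⟩ := hc
    apply hx
    refine ⟨⟨?_, 0, le_rfl, h1, ?_⟩, ⟨?_, j, hj, hj', ?_⟩, ⟨?_, n - 1, by omega, by omega, ?_⟩⟩
    · rw [wedge_combo_sub _ _ _ _ _ hst]
      exact add_nonneg (mul_nonneg hs (H.base_side_nonneg₁ _))
        (mul_nonneg ht (H.base_side_nonneg₁ _))
    · have e := side_succ ε p 0
      rw [zero_add] at e
      rw [side_combo _ _ _ _ _ hst, e]
      have := H.side_first_pos₁ (k := n - 1) (by omega) (by omega)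
      positivity
    · rw [wedge_combo_sub _ _ _ _ _ hst]
      exact add_nonneg (mul_nonneg hs (H.base_side_nonneg₂ _))
        (mul_nonneg ht (H.base_side_nonneg₂ _))
    · rw [side_combo _ _ _ _ _ hst]
      exact hc
    · rw [wedge_combo_sub _ _ _ _ _ hst]
      exact add_nonneg (mul_nonneg hs (H.base_side_nonneg₃ _))
        (mul_nonneg ht (H.base_side_nonneg₃ _))
    · rw [side_combo _ _ _ _ _ hst, side_self]
      have := H.side_last_nonneg₃ (k := 1) (by omega) (by omega)
      positivity
  obtain ⟨s, t, hs, ht, hst, hb⟩ := hblock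
  obtain ⟨m, m1, m2, m3, m4⟩ := H.exists_tangent
  -- The second contact vertex is the first one of the reversed sequence, with index `n - k` in the
  -- original order.
  obtain ⟨k, k1, k2, k3, k4⟩ := H.reverse.exists_tangent
  have hβu := H.side_β_one.1
  have hγv := H.side_last_nonneg₂ (k := n - 1) (by omega) (by omega)
  have hβv : side ε p β (p (n - 1)) < 0 := by
    by_contra! hc
    have := hb β le_rfl h2
    nlinarith
  have hγu : side ε p (γ - 1) (p 1) < 0 := by
    by_contra! hc
    have := hb (γ - 1) (by omega) (by omega)
    nlinarith
  have e1 : p (-1) = p (n - 1) := by rw [H.apply_neg]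
  have k3' : ∀ j, n - k ≤ j → j < γ - 1 → 0 < side ε p j (p (n - 1)) := by
    intro j hj hj'
    have := k3 (n - j - 1) (by omega) (by omega)
    rw [H.side_reverse, e1] at this
    convert this using 2
    ring
  have k4' : β < n - k → side ε p (n - k - 1) (p (n - 1)) ≤ 0 := by
    intro hj
    have := k4 (by omega)
    rwa [H.side_reverse, e1] at this
  have hmγ : m < γ := by
    by_contra hc
    have hβγ : β < γ - 1 := by
      by_contra hc'
      have e : γ - 1 = β := by omega
      rw [e] at hγu
      linarith
    have := m3 (γ - 1) hβγ (by omega)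
    linarith
  have hmβ : β < n - k := by
    by_contra hc
    have hβγ : β < γ - 1 := by
      by_contra hc'
      have e : γ - 1 = β := by omega
      rw [e] at hγu
      linarith
    have := k3' β (by omega) hβγ
    linarith
  -- In the wrong order, edge `m - 1` would have both neighbours of the corner on its inner side and
  -- nothing would be blocked.
  have hmm : m ≤ n - k := by
    by_contra hc
    have i1 : 0 ≤ side ε p (m - 1) (p 1) := by
      rcases eq_or_lt_of_le (show β ≤ m - 1 by omega) with h | h
      · rw [← h]; exact hβu
      · exact (m3 _ h (by omega)).le
    have i2 := k3' (m - 1) (by omega) (by omega)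
    have := hb (m - 1) (by omega) (by omega)
    nlinarith
  exact ⟨m, n - k, m1, hmm, by omega, m3, m4 hmγ, k3', k4' hmβ, s, t, hs, ht, hst, hb⟩

/-! ### Consequences of a blocked view -/

namespace Tangents

variable {ε : ℝ} {p : ℤ → Plane} {β γ n m m' : ℤ}

lemma reverse (T : Tangents ε p β γ n m m') (H : TriChain ε p β γ n) :
    Tangents (-ε) (fun i => p (-i)) (n - γ) (n - β) n (n - m') (n - m) := by
  have h1 := T.lt
  have h2 := T.le
  have h3 := T.lt'
  have e1 : p (-1) = p (n - 1) := H.apply_neg 1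
  have e2 : p (-(n - 1)) = p 1 := by rw [H.apply_neg]; congr 1; ring
  refine ⟨by omega, by omega, by omega, ?_, ?_, ?_, ?_, ?_⟩
  · intro j hj hj'
    rw [H.side_reverse, e1]
    exact T.pos' _ (by omega) (by omega)
  · rw [H.side_reverse, e1]
    convert T.nonpos' using 2
    ring
  · intro j hj hj'
    rw [H.side_reverse, e2]
    exact T.pos _ (by omega) (by omega)
  · rw [H.side_reverse, e2]
    convert T.nonpos using 2
    ring
  · obtain ⟨s, t, hs, ht, hst, hb⟩ := T.blocked
    refine ⟨t, s, ht, hs, by linarith, fun j hj hj' => ?_⟩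
    rw [H.side_reverse, H.side_reverse, e1, e2]
    have := hb (n - j - 1) (by omega) (by omega)
    linarith

lemma side_pred_nonneg (T : Tangents ε p β γ n m m') (H : TriChain ε p β γ n) :
    0 ≤ side ε p (m - 1) (p 1) ∧ (1 < β → 0 < side ε p (m - 1) (p 1)) := by
  have h1 := T.lt
  rcases eq_or_lt_of_le (show β ≤ m - 1 by omega) with h | h
  · rw [← h]; exact H.side_β_one
  · have := T.pos _ h (by omega)
    exact ⟨this.le, fun _ => this⟩

lemma side_β_neg (T : Tangents ε p β γ n m m') (H : TriChain ε p β γ n) :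
    side ε p β (p (n - 1)) < 0 := by
  obtain ⟨s, t, hs, ht, hst, hb⟩ := T.blocked
  by_contra! hc
  have := hb β le_rfl H.lt
  have := H.side_β_one.1
  nlinarith

/-- The direction of the first segment of the shortest path lies between those of the two edges at
its end. -/
lemma exists_cone (T : Tangents ε p β γ n m m') (H : TriChain ε p β γ n) :
    ∃ s t : ℝ, 0 ≤ s ∧ 0 ≤ t ∧ 0 < s + t ∧ (1 < β → 0 < t) ∧
      p m - p 1 = s • step p (m - 1) + t • step p m := by
  have h0 := H.pos
  have h1 := T.lt
  have h2 := T.le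
  have h3 := T.lt'
  have e : wedge ε (step p (m - 1)) (p 1 - p m) = side ε p (m - 1) (p 1) := by
    rw [side_eq ε p (m - 1) (p (m - 1 + 1)), side_succ, zero_add, sub_add_cancel]
  obtain ⟨s, t, hs, ht, h4, h5, h6⟩ := Plane.exists_cone
    (H.neg₂ (m - 1) m (by omega) (by omega) (by omega)) (d := p 1 - p m)
    (by rw [e]; exact (T.side_pred_nonneg H).1) T.nonpos
  rw [e] at h4
  refine ⟨s, t, hs, ht, ?_, fun h => h4 ((T.side_pred_nonneg H).2 h), by rw [← h6, neg_sub]⟩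
  rcases eq_or_lt_of_le (show 1 ≤ β by omega) with h | h
  · have := h5 (by
      have := H.bending₂.side_neg (j := m) (k := β) (by omega) (by omega) le_rfl (by omega)
        (by omega) (by omega)
      rwa [← h] at this)
    linarith
  · have := h4 ((T.side_pred_nonneg H).2 h)
    linarith

/-- The segment to the contact vertex is a nonnegative combination of two edges of the second chain,
so it turns against the first chain as they do. This makes it fit as the base of a tower. -/
lemma wedge_first_pos (T : Tangents ε p β γ n m m') (H : TriChain ε p β γ n) {i : ℤ} (hi : 0 ≤ i)
    (hi' : i < β) : 0 < wedge ε (step p i) (p m - p 1) := by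
  have h1 := T.lt
  have h2 := T.le
  have h3 := T.lt'
  obtain ⟨s, t, hs, ht, hst, -, e⟩ := T.exists_cone H
  rw [e, map_add, map_smul, map_smul, smul_eq_mul, smul_eq_mul]
  have i1 := H.pos₁₂ i (m - 1) hi hi' (by omega) (by omega)
  have i2 := H.pos₁₂ i m hi hi' (by omega) (by omega)
  rcases eq_or_lt_of_le hs with rfl | hs
  · have : 0 < t := by linarith
    positivity
  · positivity

lemma wedge_middle_pos (T : Tangents ε p β γ n m m') (H : TriChain ε p β γ n) (hβ : 1 < β) {i : ℤ}
    (hi : β ≤ i) (hi' : i < m) : 0 < wedge ε (step p i) (p 1 - p m) := by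
  have h1 := T.lt
  have h2 := T.le
  have h3 := T.lt'
  rcases eq_or_lt_of_le (show i ≤ m - 1 by omega) with h | h
  · subst h
    have := (T.side_pred_nonneg H).2 hβ
    rwa [side_eq ε p (m - 1) (p (m - 1 + 1)), side_succ, zero_add, sub_add_cancel] at this
  · obtain ⟨s, t, hs, ht, -, ht', e⟩ := T.exists_cone H
    rw [← neg_sub, e, map_neg, map_add, map_smul, map_smul, smul_eq_mul, smul_eq_mul]
    have i1 := H.neg₂ i (m - 1) hi h (by omega)
    have i2 := H.neg₂ i m hi (by omega) (by omega)
    have := ht' hβ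
    nlinarith

lemma side_zero_pos (T : Tangents ε p β γ n m m') (H : TriChain ε p β γ n) :
    0 < side ε p 0 (p m) := by
  rw [side_eq ε p 0 (p (0 + 1)), side_succ, zero_add, zero_add]
  exact T.wedge_first_pos H le_rfl H.pos

lemma side_last_nonneg (T : Tangents ε p β γ n m m') (H : TriChain ε p β γ n) {k : ℤ} (hk : 0 ≤ k)
    (hk' : k ≤ m') : 0 ≤ side ε p (n - 1) (p k) := by
  have h2 := H.lt'
  have h3 := T.lt'
  rcases le_or_gt k β with h | h
  · exact H.side_last_nonneg₃ hk h
  · have h4 := (T.reverse H).side_zero_pos H.reverse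
    rw [H.side_reverse, H.apply_neg, sub_zero, sub_sub_cancel] at h4
    have h5 : wedge ε (step p (n - 1)) (p m' - p k) ≤ 0 := wedge_sub_nonpos hk' fun j hj hj' => by
      rw [wedge_swap]
      linarith [H.pos₂₃ j (n - 1) (by omega) (by omega) (by omega) (by omega)]
    rw [side_eq ε p (n - 1) (p m'), ← neg_sub (p m') (p k), map_neg]
    linarith

lemma sees_first (T : Tangents ε p β γ n m m') (H : TriChain ε p β γ n) : Sees ε p β γ n 1 m := by
  have h0 := H.pos
  have h1 := T.lt
  have h2 := T.le
  have h3 := T.lt'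
  have h4 := H.lt'
  have e := side_succ ε p 0
  have e' := side_succ ε p (m - 1)
  rw [zero_add] at e
  rw [sub_add_cancel] at e'
  exact H.sees_of_sides (j₁ := 0) (j₂ := m - 1) (j₃ := n - 1) le_rfl h0 (by omega) (by omega)
    (by omega) (by omega) e.ge (T.side_zero_pos H).le (T.side_pred_nonneg H).1 e'.ge
    (T.side_last_nonneg H (by omega) (by omega)) (T.side_last_nonneg H (by omega) h2)

lemma sees_last (T : Tangents ε p β γ n m m') (H : TriChain ε p β γ n) :
    Sees ε p β γ n (n - 1) m' := by
  have := (T.reverse H).sees_first H.reverse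
  rwa [H.sees_reverse, sub_sub_cancel] at this

/-- The two edges at the corner are the witnesses for their own chains. The third chain cannot
interfere: its last edge has every vertex from `p 0` up to `p m'` on its inner side. -/
lemma sees_around (T : Tangents ε p β γ n m m') (H : TriChain ε p β γ n) :
    Sees ε p β γ n (β - 1) (β + 1) := by
  have h0 := H.pos
  have h1 := T.lt
  have h2 := T.le
  have h3 := T.lt'
  have h4 := H.lt'
  refine H.sees_of_sides (j₁ := β - 1) (j₂ := β) (j₃ := n - 1) (by omega) (by omega) le_rfl (by omega)
    (by omega) (by omega) (side_self _ _ _).ge (H.side_last_nonneg₁ (by omega) (by omega)) ?_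
    (side_succ _ _ _).ge (T.side_last_nonneg H (by omega) (by omega))
    (T.side_last_nonneg H (by omega) (by omega))
  have e : p (β - 1) - p β = -step p (β - 1) := by rw [step, sub_add_cancel, neg_sub]
  rw [side, e, map_neg, ← wedge_swap]
  exact (H.pos₁₂ _ _ (by omega) (by omega) le_rfl (by omega)).le

lemma sees_around' (T : Tangents ε p β γ n m m') (H : TriChain ε p β γ n) :
    Sees ε p β γ n (γ + 1) (γ - 1) := by
  have := (T.reverse H).sees_around H.reverse
  rw [H.sees_reverse] at this
  convert this using 1 <;> ring

/-- Like `p (n - 1)`, the vertex `p k` is strictly beyond the line of edge `β`; the segment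
therefore starts at `p β` into the part cut off by the second chain. -/
lemma not_sees (T : Tangents ε p β γ n m m') (H : TriChain ε p β γ n) {k : ℤ} (hk : γ < k)
    (hk' : k < n) : ¬ Sees ε p β γ n β k := by
  intro h
  have h1 := T.lt
  have h2 := T.le
  have h3 := T.lt'
  have hneg : side ε p β (p k) < 0 := by
    rw [side_eq ε p β (p (n - 1)), ← neg_sub (p (n - 1)) (p k), map_neg]
    have := T.side_β_neg H
    have : 0 ≤ wedge ε (step p β) (p (n - 1) - p k) := wedge_sub_nonneg (by omega) fun j hj hj' =>
      (H.pos₂₃ β j le_rfl (by omega) (by omega) (by omega)).le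
    linarith
  -- Edge `β` is settled by `hneg`; all other edges of the chain already have `p β` strictly on
  -- their outer side.
  have hev : ∀ j ∈ Finset.Ico β γ, ∀ᶠ t : ℝ in 𝓝[>] 0,
      side ε p j ((1 - t) • p β + t • p k) < 0 := by
    intro j hj
    obtain ⟨hj, hj'⟩ := Finset.mem_Ico.1 hj
    simp only [side_combo ε p j (p β) (p k) (show (1 - _) + _ = (1 : ℝ) by ring)]
    rcases eq_or_lt_of_le hj with rfl | hj
    · filter_upwards [self_mem_nhdsWithin] with t ht
      rw [side_self, mul_zero, zero_add]
      exact mul_neg_of_pos_of_neg ht hneg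
    · have hs := H.bending₂.side_neg (j := j) (k := β) (by omega) hj' le_rfl (by omega) (by omega)
        (by omega)
      have hc : Continuous fun t : ℝ => (1 - t) * side ε p j (p β) + t * side ε p j (p k) := by
        fun_prop
      have ht := hc.tendsto 0
      simp only [sub_zero, one_mul, zero_mul, add_zero] at ht
      exact (ht.mono_left nhdsWithin_le_nhds) (Iio_mem_nhds hs)
  have hall := (Filter.eventually_all_finset _).2 hev
  obtain ⟨t, ht, ht0⟩ := (hall.and (Ioc_mem_nhdsGT (show (0 : ℝ) < 1 by norm_num))).exists
  obtain ⟨-, ⟨-, j, hj, hj', hs⟩, -⟩ := h (⟨1 - t, t, by linarith [ht0.2], ht0.1.le, by ring, rfl⟩ :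
    (1 - t) • p β + t • p k ∈ segment ℝ (p β) (p k))
  exact (ht j (Finset.mem_Ico.2 ⟨hj, hj'⟩)).not_ge hs

lemma not_sees' (T : Tangents ε p β γ n m m') (H : TriChain ε p β γ n) {k : ℤ} (hk : 0 < k)
    (hk' : k < β) : ¬ Sees ε p β γ n γ k := by
  have := (T.reverse H).not_sees H.reverse (k := n - k) (by omega) (by omega)
  rwa [H.sees_reverse, sub_sub_cancel, sub_sub_cancel] at this

end Tangents

end

section

open Fin.CommRing

/-! ### Towers -/

open Plane

namespace TriChain

variable {ε : ℝ} {p : ℤ → Plane} {β γ n : ℤ}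

/-- A tower is cut off at a corner by a chord. -/
lemma of_chord {p' : ℤ → Plane} {l c r : ℤ} (hε : ε = 1 ∨ ε = -1) (hlc : l < c) (hcr : c < r)
    (hl : Bending ε p l c) (hr : Bending ε p c r)
    (hlr : ∀ i j, l ≤ i → i < c → c ≤ j → j < r → 0 < wedge ε (step p i) (step p j))
    (hl' : ∀ i, l ≤ i → i < c → 0 < wedge ε (p l - p r) (step p i))
    (hr' : ∀ j, c ≤ j → j < r → 0 < wedge ε (step p j) (p l - p r))
    (hper : ∀ k, p' (k + (r - l + 1)) = p' k) (h₁ : ∀ k, 0 ≤ k → k ≤ r - c → p' k = p (c + k))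
    (h₂ : ∀ k, r - c < k → k ≤ r - l + 1 → p' k = p (c + k - (r - l + 1))) :
    TriChain ε p' (r - c) (r - c + 1) (r - l + 1) := by
  -- The tower is read from its corner `c`: the chain from `c` to `r`, the base as a middle chain
  -- with one edge, then the chain from `l` back to `c`.
  have s₁ : ∀ k, 0 ≤ k → k < r - c → step p' k = step p (c + k) := by
    intro k hk hk'
    rw [step, step, h₁ _ hk (by omega), h₁ _ (by omega) (by omega), add_assoc]
  have s₂ : ∀ k, r - c < k → k < r - l + 1 → step p' k = step p (c + k - (r - l + 1)) := by
    intro k hk hk'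
    rw [step, step, h₂ _ hk (by omega), h₂ _ (by omega) (by omega)]
    congr 2
    ring
  have s₀ : step p' (r - c) = p l - p r := by
    rw [step, h₁ _ (by omega) le_rfl, h₂ _ (by omega) (by omega)]
    congr 2 <;> ring
  refine ⟨hε, by omega, by omega, by omega, hper, ?_, ?_, ?_, ?_, ?_, ?_⟩
  · intro i j hi hi' hj hj'
    obtain rfl : j = r - c := by omega
    rw [s₀, s₁ i hi hi']
    exact hr' _ (by omega) (by omega)
  · intro i j hi hi' hj hj'
    obtain rfl : i = r - c := by omega
    rw [s₀, s₂ j (by omega) hj']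
    exact hl' _ (by omega) (by omega)
  · intro i j hi hi' hj hj'
    rw [s₂ i (by omega) hi', s₁ j hj hj']
    exact hlr _ _ (by omega) (by omega) (by omega) (by omega)
  · intro i j hi hij hj
    rw [s₁ i hi (by omega), s₁ j (by omega) hj]
    exact hr _ _ (by omega) (by omega) (by omega)
  · intro i j hi hij hj
    omega
  · intro i j hi hij hj
    rw [s₂ i (by omega) (by omega), s₂ j (by omega) hj]
    exact hl _ _ (by omega) (by omega) (by omega)

/-- A vertex lies in the triangle of the corners, so by Cramer's rule the vectors to the corners
have a nontrivial nonnegative relation. The two ends of its own chain are weakly beyond edge `k`,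
hence the third corner cannot be strictly beyond it. -/
lemma side_nonneg_of_hull (H : TriChain ε p β γ n) {k : ℤ} (hk : 0 < k) (hk' : k < β) :
    0 ≤ side ε p k (p γ) := by
  have h2 := H.lt
  have h3 := H.lt'
  set y := p k with hy
  have hab : 0 < wedge ε (p 0 - y) (p β - y) := by
    rw [← neg_sub y, map_neg, LinearMap.neg_apply, neg_pos]
    have : 0 < wedge ε (y - p 0) (y - p β) := by
      refine wedge_sub_pos' hk fun i hi hi' => ?_
      rw [← neg_sub, map_neg, neg_pos]
      exact wedge_sub_neg hk' fun j hj hj' => H.neg₁ i j hi (by omega) hj'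
    rw [← neg_sub (p β), map_neg] at this
    linarith
  have hbc : 0 ≤ wedge ε (p β - y) (p γ - y) := by
    have := H.base_side_nonneg₂ k
    rw [← sub_add_sub_cancel (p γ) (p β) y, map_add, wedge_self, add_zero, wedge_swap,
      ← map_neg, neg_sub]
    exact this
  have hca : 0 ≤ wedge ε (p γ - y) (p 0 - y) := by
    have := H.base_side_nonneg₃ k
    rw [H.period] at this
    rw [← sub_add_sub_cancel (p 0) (p γ) y, map_add, wedge_self, add_zero, wedge_swap,
      ← map_neg, neg_sub]
    exact this
  have e := congrArg (wedge ε (step p k)) (wedge_smul_eq ε (p 0 - y) (p β - y) (p γ - y))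
  rw [map_add, map_smul, map_smul, map_smul, smul_eq_mul, smul_eq_mul, smul_eq_mul] at e
  have h4 : wedge ε (step p k) (p 0 - y) ≤ 0 :=
    H.bending₁.side_nonpos hk.le hk' le_rfl (by omega)
  have h5 : wedge ε (step p k) (p β - y) ≤ 0 :=
    H.bending₁.side_nonpos hk.le hk' (by omega) le_rfl
  have h6 : wedge ε (p γ - y) (p β - y) ≤ 0 := by rw [wedge_swap]; linarith
  have h7 : wedge ε (p 0 - y) (p γ - y) ≤ 0 := by rw [wedge_swap]; linarith
  rw [side, ← hy]
  by_contra! hc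
  nlinarith [mul_neg_of_pos_of_neg hab hc, mul_nonneg_of_nonpos_of_nonpos h6 h4,
    mul_nonneg_of_nonpos_of_nonpos h7 h5]

/-- In a tower, every interior vertex of a side-chain at the corner sees a vertex of the other
one. -/
lemma exists_sees (H : TriChain ε p β (β + 1) n) {k : ℤ} (hk : 0 < k) (hk' : k < β) :
    ∃ l, β < l ∧ l < n ∧ Sees ε p β (β + 1) n k l := by
  have h3 := H.lt'
  have hlast : 0 < side ε p (n - 1) (p k) := by
    rw [side_eq ε p (n - 1) (p (n - 1 + 1)), side_succ, zero_add, sub_add_cancel, H.period]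
    exact wedge_sub_pos hk fun j hj hj' => H.pos₃₁ _ _ (by omega) (by omega) hj (by omega)
  -- `p l` starts the first edge of the opposite chain that has `p k` strictly inside. By minimality
  -- `p l - p k` is, up to sign, in the cone of the edges before and after `p l`, which puts `p l`
  -- on the inner side of edge `k`; if no edge precedes, `side_nonneg_of_hull` is used.
  obtain ⟨l, ⟨h4, h5, h6⟩, hmin⟩ := Int.exists_least_of_bdd
    (P := fun l => β < l ∧ l < n ∧ 0 < side ε p l (p k))
    ⟨β, fun z hz => hz.1.le⟩ ⟨n - 1, by omega, by omega, hlast⟩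
  refine ⟨l, h4, h5, H.sees_of_sides (j₁ := k) (j₂ := β) (j₃ := l) hk.le hk' le_rfl (by omega)
    (by omega) h5 (side_self _ _ _).ge ?_ (H.base_side_nonneg₂ k) (H.base_side_nonneg₂ l) h6.le
    (side_self _ _ _).ge⟩
  rcases eq_or_lt_of_le (show β + 1 ≤ l by omega) with h | h
  · rw [← h]
    exact H.side_nonneg_of_hull hk hk'
  · have h7 : side ε p (l - 1) (p k) ≤ 0 := by
      by_contra! hc
      have := hmin (l - 1) ⟨by omega, by omega, hc⟩
      omega
    rw [side_eq ε p (l - 1) (p (l - 1 + 1)), side_succ, zero_add, sub_add_cancel, ← neg_sub (p l),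
      map_neg, neg_nonpos] at h7
    rw [side, ← neg_sub (p l), map_neg, neg_pos] at h6
    obtain ⟨s, t, hs, ht, -, -, e⟩ := Plane.exists_cone
      (H.neg₃ (l - 1) l (by omega) (by omega) h5) h7 h6.le
    rw [side, ← neg_neg (p l - p k), e, map_neg, map_add, map_smul, map_smul, smul_eq_mul,
      smul_eq_mul, wedge_swap ε (step p (l - 1)), wedge_swap ε (step p l)]
    have i1 := H.pos₃₁ (l - 1) k (by omega) (by omega) hk.le hk'
    have i2 := H.pos₃₁ l k (by omega) (by omega) hk.le hk'
    have := mul_nonneg hs i1.le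
    have := mul_nonneg ht i2.le
    linarith

/-- In a tower, every interior vertex of a side-chain at the corner sees a vertex of the other
one, also with the side-chains exchanged. -/
lemma exists_sees' (H : TriChain ε p β (β + 1) n) {k : ℤ} (hk : β + 1 < k) (hk' : k < n) :
    ∃ l, 0 < l ∧ l ≤ β ∧ Sees ε p β (β + 1) n k l := by
  have H' := H.reverse
  rw [show n - β = n - (β + 1) + 1 by ring] at H'
  obtain ⟨l, h1, h2, h3⟩ := H'.exists_sees (k := n - k) (by omega) (by omega)
  rw [show n - (β + 1) + 1 = n - β by ring, H.sees_reverse, sub_sub_cancel] at h3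
  exact ⟨n - l, by omega, by omega, h3⟩

lemma sees_corner (H : TriChain ε p β (β + 1) n) {k : ℤ} (hk : 0 < k) (hk' : k < n)
    (h : Sees ε p β (β + 1) n 0 k) : k = 1 ∨ k = n - 1 := by
  by_contra hc
  rcases le_or_gt k β with h4 | h4
  · exact H.not_sees₁ le_rfl (by omega) h4 h
  · refine H.not_sees₃ (k := k) (k' := n) (by omega) (by omega) le_rfl ?_
    rw [Sees, segment_symm, H.period]
    exact h

end TriChain

lemma Fin.val_add_intCast {n : ℕ} [NeZero n] (a : Fin n) {k : ℤ} (hk : 0 ≤ k) (hk' : k < n) :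
    (((a + (k : Fin n)).val : ℕ) : ℤ) = if a.val + k < n then a.val + k else a.val + k - n := by
  obtain ⟨m, rfl⟩ := Int.eq_ofNat_of_zero_le hk
  have h1 := a.isLt
  have h2 : m < n := by omega
  rw [Int.cast_natCast, Fin.val_add, Fin.val_natCast, Nat.mod_eq_of_lt h2]
  split_ifs with h
  · rw [Nat.mod_eq_of_lt (by omega)]; push_cast; rfl
  · rw [Nat.mod_eq_sub_mod (by omega), Nat.mod_eq_of_lt (by omega), Nat.cast_sub (by omega)]
    push_cast; rfl

namespace Polygon

variable {n : ℕ} [NeZero n] {P : Polygon Plane n} {ε : ℝ}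

lemma visibilityGraph_adj_iff {a i j : Fin n} {β γ : ℕ} (H : TriChain ε (P.unroll a) β γ n)
    {k l : ℤ} (hi : i = a + (k : Fin n)) (hj : j = a + (l : Fin n)) :
    P.visibilityGraph.Adj i j ↔ i ≠ j ∧ Sees ε (P.unroll a) β γ n k l := by
  subst hi hj
  rw [Sees, ← region_eq_enclosed H]
  rfl

/-- A tower whose base is the last edge. -/
lemma isTower_of_triChain {N : ℕ} {Q : Polygon Plane (N + 1)} {x : Fin (N + 1)}
    (hx : 0 < x.val)
    (H : TriChain ε (Q.unroll x) (N - x.val : ℕ) (N - x.val + 1 : ℕ) (N + 1 : ℕ)) :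
    Q.IsTower x (Fin.last N) 0 ∧
      ∀ y, (Q.visibilityGraph \ SimpleGraph.pathGraph _).IsIsolated y ↔ y = x := by
  have hxN := x.isLt
  have h1 := H.pos
  have h3 := H.lt'
  have hl : (Fin.last N - x).val = N - x.val := Fin.sub_val_of_le (Fin.le_last x)
  have h0 : (0 - x).val = N - x.val + 1 := by
    rw [Fin.val_sub, Fin.val_zero, add_zero, Nat.mod_eq_of_lt (by omega)]; omega
  refine ⟨⟨isPseudoTriangle_of_triChain (ε := ε) (by rw [hl, h0]; exact H),
    (Fin.last_add_one N).symm⟩, fun y => ?_⟩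
  have H' := H
  rw [Nat.cast_add, Nat.cast_one] at H'
  have hadj : ∀ {i j k l}, i = x + ((k : ℤ) : Fin (N + 1)) → j = x + ((l : ℤ) : Fin (N + 1)) → _ :=
    @fun i j k l => visibilityGraph_adj_iff (i := i) (j := j) H (k := k) (l := l)
  rw [Nat.cast_add (N - x.val), Nat.cast_one] at hadj
  obtain ⟨k, k0, k1, rfl, -, -⟩ := exists_unroll Q x y
  have hval := fun k => Fin.val_add_intCast x (k := k)
  have vk := hval k k0 k1
  constructor
  · intro hiso
    by_contra hne
    have hk0 : k ≠ 0 := fun h => hne (by rw [h]; simp)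
    obtain ⟨l, l0, l1, hor, hs⟩ : ∃ l : ℤ, 0 < l ∧ l < (N + 1 : ℕ) ∧
        ((k ≤ (N - x.val : ℕ) ∧ (N - x.val : ℕ) < l) ∨
          (l ≤ (N - x.val : ℕ) ∧ (N - x.val : ℕ) < k)) ∧
        Sees ε (Q.unroll x) (N - x.val : ℕ) ((N - x.val : ℕ) + 1) (N + 1 : ℕ) k l := by
      have hedge : Sees ε (Q.unroll x) (N - x.val : ℕ) ((N - x.val : ℕ) + 1) (N + 1 : ℕ)
          (N - x.val : ℕ) ((N - x.val : ℕ) + 1) := by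
        have := region_eq_enclosed H
        rw [Nat.cast_add, Nat.cast_one] at this
        rw [Sees, ← this]
        exact (segment_unroll_subset_boundary Q x _).trans Set.subset_union_left
      rcases lt_trichotomy k (N - x.val : ℕ) with h | h | h
      · obtain ⟨l, h4, h5, h6⟩ := H'.exists_sees (by omega) h
        exact ⟨l, by omega, h5, Or.inl ⟨h.le, h4⟩, h6⟩
      · refine ⟨(N - x.val : ℕ) + 1, by omega, by omega, Or.inl ⟨h.le, by omega⟩, ?_⟩
        rw [h]
        exact hedge
      · rcases eq_or_lt_of_le (show (N - x.val : ℕ) + 1 ≤ k by omega) with h' | h'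
        · refine ⟨(N - x.val : ℕ), by omega, by omega, Or.inr ⟨le_rfl, by omega⟩, ?_⟩
          rw [← h', Sees, segment_symm]
          exact hedge
        · obtain ⟨l, h4, h5, h6⟩ := H'.exists_sees' h' k1
          exact ⟨l, h4, by omega, Or.inr ⟨h5, h⟩, h6⟩
    have vl := hval l l0.le l1
    refine hiso (x + (l : Fin (N + 1))) ?_
    rw [SimpleGraph.sdiff_adj, hadj rfl rfl, SimpleGraph.pathGraph_adj]
    -- The corner lies strictly between vertices of opposite side-chains in the linear numbering, so
    -- they are not neighbours on the path; the base joins the two ends of the numbering.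
    have hd : (x + (k : Fin (N + 1))).val + 1 < (x + (l : Fin (N + 1))).val ∨
        (x + (l : Fin (N + 1))).val + 1 < (x + (k : Fin (N + 1))).val := by
      split_ifs at vk vl <;> omega
    refine ⟨⟨fun h => ?_, hs⟩, by omega⟩
    rw [h] at hd
    omega
  · intro he z hz
    have hk0 : k = 0 := by
      have := congrArg (fun y : Fin (N + 1) => (y.val : ℤ)) he
      split_ifs at vk <;> omega
    subst hk0
    obtain ⟨l, l0, l1, rfl, -, -⟩ := exists_unroll Q x z
    have vl := hval l l0 l1
    rw [SimpleGraph.sdiff_adj, hadj rfl rfl, SimpleGraph.pathGraph_adj] at hz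
    have hl0 : l ≠ 0 := fun h => hz.1.1 (by rw [h])
    apply hz.2
    rcases H'.sees_corner (by omega) l1 hz.1.2 with h | h
    · split_ifs at vk vl <;> omega
    · split_ifs at vk vl <;> omega

/-- A chord between the side-chains at a corner cuts off a tower. -/
lemma cutsOffTower_of_chord {i x j : Fin n} {p : ℤ → Plane} {l c r : ℤ}
    (hp : ∀ k : ℕ, P (i + (k : Fin n)) = p (l + k)) (hx : ((x - i).val : ℤ) = c - l)
    (hj : ((j - i).val : ℤ) = r - l) (hε : ε = 1 ∨ ε = -1) (hlc : l < c) (hcr : c < r)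
    (hl : Bending ε p l c) (hr : Bending ε p c r)
    (hlr : ∀ i j, l ≤ i → i < c → c ≤ j → j < r → 0 < wedge ε (step p i) (step p j))
    (hl' : ∀ i, l ≤ i → i < c → 0 < wedge ε (p l - p r) (step p i))
    (hr' : ∀ j, c ≤ j → j < r → 0 < wedge ε (step p j) (p l - p r)) :
    P.CutsOffTower i j x := by
  have hv : (Fin.ofNat ((j - i).val + 1) (x - i).val).val = (x - i).val := by
    rw [Fin.val_ofNat, Nat.mod_eq_of_lt (by omega)]
  refine ⟨by rw [Fin.le_def]; omega, isTower_of_triChain (ε := ε) (by omega) ?_⟩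
  set y := Fin.ofNat ((j - i).val + 1) (x - i).val with hy
  have hu : ∀ k : ℤ, 0 ≤ k → k < ((j - i).val + 1 : ℕ) → (P.subPolygon i j).unroll y k =
      p (l + if y.val + k < ((j - i).val + 1 : ℕ) then y.val + k
        else y.val + k - ((j - i).val + 1 : ℕ)) := by
    intro k h0 h1
    rw [← Fin.val_add_intCast y h0 h1, ← hp]
    rfl
  have hper := unroll_periodic (P.subPolygon i j) y
  have := TriChain.of_chord (p' := (P.subPolygon i j).unroll y) hε hlc hcr hl hr hlr hl' hr' ?_ ?_ ?_
  · convert this using 1 <;> omega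
  · intro k
    rw [← hper k]
    congr 1
    omega
  · intro k h0 h1
    rw [hu k h0 (by omega), if_pos (by omega)]
    congr 1
    omega
  · intro k h0 h1
    rcases eq_or_lt_of_le h1 with h | h
    · have e : k = 0 + (((j - i).val + 1 : ℕ) : ℤ) := by omega
      rw [e, hper, hu 0 le_rfl (by omega), if_pos (by omega)]
      congr 1
      omega
    · rw [hu k (by omega) (by omega), if_neg (by omega)]
      congr 1
      omega

end Polygon

end

section

/-! ### Shortest paths around a chain -/

open Plane

/-- A curve that ends behind the tip `y` of a segment, and cannot cross the ray from `y` through `M`,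
crosses the line of the segment in front of `y`. -/
lemma exists_mem_ray_of_curve {ε : ℝ} {S : Set Plane} {x y v M : Plane} {f : ℝ → Plane} {t₁ : ℝ}
    (ht₁ : t₁ ≤ 1) (hf : ContinuousOn f (Set.Icc t₁ 1)) (hfS : ∀ t ∈ Set.Icc t₁ 1, f t ∈ S)
    (hf₁ : f 1 = v) (h₀ : 0 ≤ wedge ε (y - x) (f t₁ - x)) (hv : wedge ε (y - x) (v - y) ≤ 0)
    (hMv : 0 < wedge ε (M - y) (v - y)) (hM : wedge ε (y - x) (M - y) < 0)
    (hray : ∀ s : ℝ, 0 < s → y + s • (M - y) ∉ S) :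
    ∃ t ∈ Set.Icc t₁ 1, ∃ s : ℝ, 0 ≤ s ∧ f t = y + s • (y - x) := by
  have hx : ∀ z, wedge ε (y - x) (z - x) = wedge ε (y - x) (z - y) := by
    intro z
    rw [← sub_add_sub_cancel z y x, map_add, wedge_self, add_zero]
  set g := y - x with hg
  have hc : ∀ a b : Plane, ContinuousOn (fun t => wedge ε a (f t - b)) (Set.Icc t₁ 1) := fun a b =>
    (continuous_wedge ε a).comp_continuousOn (hf.sub continuousOn_const)
  rw [hx] at h₀
  -- The last time at which the curve is weakly on the front side of the line through `x` and `y`;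
  -- there it is on the line.
  obtain ⟨t, ⟨htI, ht0⟩, htmax⟩ := (isCompact_Icc.of_isClosed_subset
    ((hc g y).preimage_isClosed_of_isClosed isClosed_Icc isClosed_Ici)
    Set.inter_subset_left).exists_isGreatest ⟨t₁, ⟨le_rfl, ht₁⟩, h₀⟩
  have hafter : ∀ t', t < t' → t' ≤ 1 → wedge ε g (f t' - y) < 0 := by
    intro t' h1 h2
    by_contra! hcon
    exact (htmax ⟨⟨htI.1.trans h1.le, h2⟩, hcon⟩).not_gt h1
  have hsub : Set.Icc t 1 ⊆ Set.Icc t₁ 1 := Set.Icc_subset_Icc_left htI.1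
  have hzero : wedge ε g (f t - y) = 0 := by
    refine le_antisymm ?_ ht0
    obtain ⟨t', h1, h2⟩ := intermediate_value_Icc' htI.2 ((hc g y).mono hsub)
      (show (0 : ℝ) ∈ Set.Icc _ _ from ⟨by rw [hf₁]; exact hv, ht0⟩)
    rcases eq_or_lt_of_le h1.1 with h | h
    · rw [h]; exact h2.le
    · exact absurd h2 (hafter t' h h1.2).ne
  have hW := hM.ne
  set s := (wedge ε g (M - y))⁻¹ * wedge ε (f t - y) (M - y) with hs
  have e : f t - y = s • g := by
    have := wedge_smul_eq ε g (M - y) (f t - y)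
    rw [hzero, zero_smul, add_zero] at this
    rw [hs, mul_smul, ← this, smul_smul, inv_mul_cancel₀ hW, one_smul]
  refine ⟨t, htI, s, ?_, by rw [← e]; abel⟩
  -- Behind `y` the curve would be on the wrong side of the line through `y` and `M`. On its way to
  -- `v` it would cross that line, and since it stays beyond the first line, it would do so on the
  -- forbidden ray.
  by_contra! hs0
  have hneg : wedge ε (M - y) (f t - y) < 0 := by
    rw [e, map_smul, smul_eq_mul, wedge_swap]
    nlinarith
  obtain ⟨t', h1, h2⟩ := intermediate_value_Icc htI.2 ((hc (M - y) y).mono hsub)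
    (show (0 : ℝ) ∈ Set.Icc _ _ from ⟨hneg.le, by rw [hf₁]; exact hMv.le⟩)
  have h3 : t < t' := by
    refine lt_of_le_of_ne h1.1 fun h => hneg.ne ?_
    rw [h]; exact h2
  set r := (wedge ε g (M - y))⁻¹ * wedge ε g (f t' - y) with hr
  have e' : f t' - y = r • (M - y) := by
    have h2 : wedge ε (f t' - y) (M - y) = 0 := by
      rw [wedge_swap, neg_eq_zero]; exact h2
    have := wedge_smul_eq ε g (M - y) (f t' - y)
    rw [h2, zero_smul, zero_add] at this
    rw [hr, mul_smul, ← this, smul_smul, inv_mul_cancel₀ hW, one_smul]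
  have hr0 : 0 < r := by
    rw [hr]
    exact mul_pos_of_neg_of_neg (inv_lt_zero.2 hM) (hafter t' h3 h1.2)
  apply hray r hr0
  rw [← e', add_sub_cancel]
  exact hfS t' (hsub h1)

lemma map_range_succ_append {α : Type*} (q : ℕ → α) (r : ℕ) (l : List α) :
    (List.range (r + 1)).map q ++ l = q 0 :: ((List.range r).map (fun i => q (i + 1)) ++ l) := by
  rw [List.range_succ_eq_map]
  simp [Function.comp_def]

/-- A path that wraps around obstacles, each of which blocks the view beyond a vertex, is no longer
than any curve with the same ends. -/
lemma polylineLength_le_of_turns {ε : ℝ} {S : Set Plane} {v M : Plane} {f : ℝ → Plane} (r : ℕ)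
    (q : ℕ → Plane) {t₁ : ℝ} (ht₁ : t₁ ≤ 1) (hf : ContinuousOn f (Set.Icc t₁ 1))
    (hfS : ∀ t ∈ Set.Icc t₁ 1, f t ∈ S) (hf₁ : f 1 = v)
    (h₀ : 0 < r → 0 ≤ wedge ε (q 1 - q 0) (f t₁ - q 0))
    (hturn : ∀ k, k + 1 < r → wedge ε (q (k + 1) - q k) (q (k + 2) - q (k + 1)) ≤ 0)
    (hv : ∀ k < r, wedge ε (q (k + 1) - q k) (v - q (k + 1)) ≤ 0)
    (hMv : ∀ k < r, 0 < wedge ε (M - q (k + 1)) (v - q (k + 1)))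
    (hM : ∀ k < r, wedge ε (q (k + 1) - q k) (M - q (k + 1)) < 0)
    (hray : ∀ k < r, ∀ s : ℝ, 0 < s → q (k + 1) + s • (M - q (k + 1)) ∉ S) :
    polylineLength ((List.range (r + 1)).map q ++ [v]) ≤
      eVariationOn f (Set.Icc t₁ 1) + edist (q 0) (f t₁) := by
  induction r generalizing q t₁ with
  | zero =>
    have h1 : edist (f t₁) (f 1) ≤ eVariationOn f (Set.Icc t₁ 1) :=
      eVariationOn.edist_le f ⟨le_rfl, ht₁⟩ ⟨ht₁, le_rfl⟩
    have h2 : polylineLength ((List.range (0 + 1)).map q ++ [v]) = edist (q 0) v := by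
      simp [polylineLength]
    rw [h2, ← hf₁, add_comm]
    exact (edist_triangle _ (f t₁) _).trans (by gcongr)
  | succ r ih =>
    -- The curve reaches the extension of the first segment at `f t`, with `q 1` between `q 0` and
    -- `f t`. The extra term in the bound pays for restarting the induction at `f t` instead of at
    -- `q 1`.
    obtain ⟨t, ht, s, hs, e⟩ := exists_mem_ray_of_curve ht₁ hf hfS hf₁ (h₀ r.succ_pos)
      (hv 0 r.succ_pos) (hMv 0 r.succ_pos) (hM 0 r.succ_pos) (hray 0 r.succ_pos)
    have hsub : Set.Icc t 1 ⊆ Set.Icc t₁ 1 := Set.Icc_subset_Icc_left ht.1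
    have ih' := ih (fun i => q (i + 1)) ht.2 (hf.mono hsub) (fun t' h => hfS t' (hsub h))
      (fun hr => by
        rw [zero_add]
        rw [e, add_sub_cancel_left, map_smul, smul_eq_mul, wedge_swap]
        have := hturn 0 (by omega)
        rw [zero_add, zero_add] at this
        exact mul_nonneg hs (by linarith))
      (fun k hk => hturn (k + 1) (by omega)) (fun k hk => hv (k + 1) (by omega))
      (fun k hk => hMv (k + 1) (by omega)) (fun k hk => hM (k + 1) (by omega))
      (fun k hk => hray (k + 1) (by omega))
    rw [map_range_succ_append, map_range_succ_append, polylineLength,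
      ← map_range_succ_append (fun i => q (i + 1))]
    have hvar : eVariationOn f (Set.Icc t₁ t) + eVariationOn f (Set.Icc t 1) =
        eVariationOn f (Set.Icc t₁ 1) := by
      have := eVariationOn.Icc_add_Icc f ht.1 ht.2 (Set.mem_univ t)
      simpa only [Set.univ_inter] using this
    have h1 : edist (f t₁) (f t) ≤ eVariationOn f (Set.Icc t₁ t) :=
      eVariationOn.edist_le f ⟨le_rfl, ht.1⟩ ⟨ht.1, le_rfl⟩
    have h2 : edist (q 0) (f t) = edist (q 0) (q 1) + edist (q 1) (f t) := by
      have e1 : dist (q 0) (f t) = dist (q 0) (q 1) + dist (q 1) (f t) := by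
        rw [e, dist_eq_norm, dist_eq_norm, dist_eq_norm,
          show q 0 - (q 1 + s • (q 1 - q 0)) = -((1 + s) • (q 1 - q 0)) by module,
          show q 0 - q 1 = -(q 1 - q 0) by abel,
          show q 1 - (q 1 + s • (q 1 - q 0)) = -(s • (q 1 - q 0)) by abel, norm_neg, norm_neg,
          norm_neg, norm_smul, norm_smul, Real.norm_of_nonneg hs,
          Real.norm_of_nonneg (by linarith : (0 : ℝ) ≤ 1 + s)]
        ring
      rw [edist_dist, edist_dist, edist_dist, e1, ENNReal.ofReal_add dist_nonneg dist_nonneg]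
    calc edist (q 0) (q 1) + polylineLength _
        ≤ edist (q 0) (q 1) + (eVariationOn f (Set.Icc t 1) + edist (q 1) (f t)) := by
          gcongr
      _ = eVariationOn f (Set.Icc t 1) + edist (q 0) (f t) := by rw [h2]; ring
      _ ≤ eVariationOn f (Set.Icc t 1) + (edist (q 0) (f t₁) + eVariationOn f (Set.Icc t₁ t)) := by
          gcongr
          exact (edist_triangle _ (f t₁) _).trans (by gcongr)
      _ = _ := by rw [← hvar]; ring

lemma isChain_map_range_append {α : Type*} {R : α → α → Prop} (r : ℕ) (q : ℕ → α) {v : α}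
    (h : ∀ k < r, R (q k) (q (k + 1))) (hv : R (q r) v) :
    ((List.range (r + 1)).map q ++ [v]).IsChain R := by
  induction r generalizing q with
  | zero => simpa using hv
  | succ r ih =>
    rw [map_range_succ_append, map_range_succ_append, List.isChain_cons_cons,
      ← map_range_succ_append (fun i => q (i + 1))]
    exact ⟨h 0 r.succ_pos, ih _ (fun k hk => h (k + 1) (by omega)) hv⟩

theorem isShortestPath_of_turns {ε : ℝ} {S : Set Plane} {v M : Plane} (r : ℕ) (q : ℕ → Plane)
    (hseg : ∀ k < r, segment ℝ (q k) (q (k + 1)) ⊆ S) (hseg' : segment ℝ (q r) v ⊆ S)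
    (hturn : ∀ k, k + 1 < r → wedge ε (q (k + 1) - q k) (q (k + 2) - q (k + 1)) ≤ 0)
    (hv : ∀ k < r, wedge ε (q (k + 1) - q k) (v - q (k + 1)) ≤ 0)
    (hMv : ∀ k < r, 0 < wedge ε (M - q (k + 1)) (v - q (k + 1)))
    (hM : ∀ k < r, wedge ε (q (k + 1) - q k) (M - q (k + 1)) < 0)
    (hray : ∀ k < r, ∀ s : ℝ, 0 < s → q (k + 1) + s • (M - q (k + 1)) ∉ S) :
    IsShortestPath S (q 0) v ((List.range (r + 1)).map q ++ [v]) := by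
  refine ⟨by rw [map_range_succ_append]; rfl, by simp, isChain_map_range_append r q hseg hseg',
    fun f hf h0 h1 hfS => ?_⟩
  have := polylineLength_le_of_turns (f := f) r q zero_le_one hf hfS h1
    (fun _ => by rw [h0, sub_self, map_zero]) hturn hv hMv hM hray
  rwa [h0, edist_self, add_zero] at this

lemma Bending.hull_pos {ε : ℝ} {p : ℤ → Plane} {l h k : ℤ} (H : Bending ε p l h) (hk : l < k)
    (hk' : k < h) : 0 < wedge ε (p h - p l) (p k - p l) := by
  have : 0 < wedge ε (p k - p l) (p k - p h) := by
    refine wedge_sub_pos' hk fun i hi hi' => ?_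
    rw [← neg_sub, map_neg, neg_pos]
    exact wedge_sub_neg hk' fun j hj hj' => H i j hi (by omega) hj'
  rw [← neg_sub (p h), map_neg] at this
  rw [← sub_add_sub_cancel (p h) (p k) (p l), map_add, LinearMap.add_apply, wedge_self, add_zero,
    wedge_swap]
  exact this

namespace Tangents

variable {ε : ℝ} {p : ℤ → Plane} {β γ n m m' : ℤ}

lemma exists_cone_last (T : Tangents ε p β γ n m m') (H : TriChain ε p β γ n) :
    ∃ s t : ℝ, 0 ≤ s ∧ 0 ≤ t ∧ (m' - 1 = β → 0 < s) ∧ 0 < s + t ∧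
      p (n - 1) - p m' = s • step p m' + t • step p (m' - 1) := by
  obtain ⟨s, t, hs, ht, hst, -, e⟩ := (T.reverse H).exists_cone H.reverse
  have h : p (n - 1) - p m' = s • step p m' + t • step p (m' - 1) := by
    have e1 : step p (m' - n) = step p m' := by rw [← H.step_periodic, sub_add_cancel]
    have e2 : step p (m' - n - 1) = step p (m' - 1) := by
      rw [← H.step_periodic]; congr 1; ring
    rw [step_reverse, step_reverse, H.apply_neg, H.apply_neg, sub_sub_cancel,
      show -(n - m' - 1) - 1 = m' - n by ring, show -(n - m') - 1 = m' - n - 1 by ring, e1, e2] at e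
    rw [← neg_sub, e]
    module
  refine ⟨s, t, hs, ht, fun hm => ?_, hst, h⟩
  refine lt_of_le_of_ne hs fun h0 => (T.side_β_neg H).ne ?_
  rw [side_eq ε p β (p (β + 1)), side_succ, zero_add, show β + 1 = m' by omega, h, ← h0, hm,
    zero_smul, zero_add, map_smul, wedge_self, smul_zero]

/-- From a vertex of the shortest path, the end lies between the directions that follow. -/
lemma wedge_end_nonpos (T : Tangents ε p β γ n m m') (H : TriChain ε p β γ n) {k : ℤ} {y : Plane}
    (hk : k ≤ m') (hy : ∀ j, k ≤ j → j ≤ m' → wedge ε y (step p j) ≤ 0)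
    (hy' : wedge ε y (step p (m' - 1)) ≤ 0) : wedge ε y (p (n - 1) - p k) ≤ 0 := by
  obtain ⟨s, t, hs, ht, -, -, e⟩ := T.exists_cone_last H
  rw [← sub_add_sub_cancel _ (p m'), e, map_add, map_add, map_smul, map_smul, smul_eq_mul,
    smul_eq_mul]
  have h1 : wedge ε y (p m' - p k) ≤ 0 := wedge_sub_nonpos hk fun j hj hj' => hy j hj hj'.le
  have h2 := hy m' hk le_rfl
  nlinarith [mul_nonneg hs (neg_nonneg.2 h2), mul_nonneg ht (neg_nonneg.2 hy')]

/-- Half of the condition that the end of the path is on the right side of the ray from `p k`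
through the midpoint of `p β` and `p γ`. -/
lemma wedge_corner_end_pos (T : Tangents ε p β γ n m m') (H : TriChain ε p β γ n) {k : ℤ}
    (hk : m ≤ k) (hk' : k ≤ m') : 0 < wedge ε (p β - p k) (p (n - 1) - p k) := by
  have h1 := T.lt
  have h3 := T.lt'
  have hpos : ∀ j, k ≤ j → j ≤ m' → 0 < wedge ε (p β - p k) (step p j) := by
    intro j hj hj'
    rw [← neg_sub, map_neg, LinearMap.neg_apply, neg_pos, wedge_swap, neg_lt_zero]
    exact wedge_sub_pos (by omega) fun i hi hi' => by
      rw [wedge_swap, neg_pos]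
      exact H.neg₂ i j hi (by omega) (by omega)
  obtain ⟨s, t, hs, ht, hs', hst, e⟩ := T.exists_cone_last H
  rw [← sub_add_sub_cancel (p (n - 1)) (p m') (p k), map_add]
  rcases eq_or_lt_of_le hk' with rfl | hlt
  · rw [sub_self, map_zero, add_zero, e, map_add, map_smul, map_smul, smul_eq_mul, smul_eq_mul]
    have i1 := hpos k le_rfl le_rfl
    rcases eq_or_lt_of_le (show β ≤ k - 1 by omega) with h | h
    · have : wedge ε (p β - p k) (step p (k - 1)) = 0 := by
        rw [← h, step, show k = β + 1 by omega, ← neg_sub, map_neg, LinearMap.neg_apply, wedge_self,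
          neg_zero]
      rw [this, mul_zero, add_zero]
      exact mul_pos (hs' h.symm) i1
    · have i2 : 0 < wedge ε (p β - p k) (step p (k - 1)) := by
        have : wedge ε (p (k - 1) - p k) (step p (k - 1)) = 0 := by
          rw [step, sub_add_cancel, ← neg_sub, map_neg, LinearMap.neg_apply, wedge_self, neg_zero]
        rw [← sub_add_sub_cancel _ (p (k - 1)), map_add, LinearMap.add_apply, this, add_zero,
          ← neg_sub, map_neg, LinearMap.neg_apply, neg_pos, wedge_swap, neg_lt_zero]
        exact wedge_sub_pos (by omega) fun i hi hi' => by
          rw [wedge_swap, neg_pos]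
          exact H.neg₂ i (k - 1) hi (by omega) (by omega)
      rcases eq_or_lt_of_le hs with rfl | hs
      · have : 0 < t := by linarith
        positivity
      · positivity
  · have i1 : 0 < wedge ε (p β - p k) (p m' - p k) := wedge_sub_pos hlt fun j hj hj' =>
      hpos j hj hj'.le
    rw [e, map_add, map_smul, map_smul, smul_eq_mul, smul_eq_mul]
    have i2 := hpos m' (by omega) le_rfl
    have i3 := hpos (m' - 1) (by omega) (by omega)
    positivity

/-- The path around the middle chain does not turn back at its only inner vertex. -/
lemma wedge_first_end_nonpos (T : Tangents ε p β γ n m m') (H : TriChain ε p β γ n) :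
    wedge ε (p m - p 1) (p (n - 1) - p m) ≤ 0 := by
  have h1 := T.lt
  have h2 := T.le
  have h3 := T.lt'
  obtain ⟨s, t, hs, ht, hst, -, e⟩ := T.exists_cone H
  have hW := H.neg₂ (m - 1) m (by omega) (by omega) (by omega)
  rcases eq_or_lt_of_le h2 with rfl | hlt
  · obtain ⟨s', t', hs', ht', -, hst', e'⟩ := T.exists_cone_last H
    -- In coordinates along the two edges at the single contact vertex the claim is `t * t' ≤ s *
    -- s'`. Blocking at edges `m` and `m - 1` gives `τ * t' < σ * s` and `σ * t < τ * s'`; multiply.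
    obtain ⟨σ, τ, hσ, hτ, hστ, hb⟩ := T.blocked
    have hb1 := hb m (by omega) (by omega)
    have hb2 := hb (m - 1) (by omega) (by omega)
    have ev : ∀ j, side ε p j (p (n - 1)) = side ε p j (p m) +
        wedge ε (step p j) (p (n - 1) - p m) := fun j => side_eq _ _ _ _ _
    have eu : ∀ j, side ε p j (p 1) = side ε p j (p m) - wedge ε (step p j) (p m - p 1) := by
      intro j
      rw [side_eq ε p j (p m) (p 1), ← neg_sub (p m) (p 1), map_neg]
      ring
    have es : side ε p (m - 1) (p m) = 0 := by
      have := side_succ ε p (m - 1)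
      rwa [sub_add_cancel] at this
    rw [ev, eu, e, e', side_self, map_add, map_add, map_smul, map_smul, map_smul, map_smul,
      wedge_self, wedge_swap ε (step p (m - 1)) (step p m)] at hb1
    rw [ev, eu, e, e', es, map_add, map_add, map_smul, map_smul, map_smul, map_smul,
      wedge_self] at hb2
    rw [e, e']
    simp only [map_add, map_smul, LinearMap.add_apply, LinearMap.smul_apply, wedge_self,
      wedge_swap ε (step p (m - 1)) (step p m), smul_eq_mul, mul_zero, add_zero, zero_add,
      zero_sub] at hb1 hb2 ⊢
    set W := wedge ε (step p (m - 1)) (step p m) with hWdef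
    have i1 : τ * t' < σ * s := by
      by_contra! hc
      nlinarith
    have i2 : σ * t < τ * s' := by
      by_contra! hc
      nlinarith
    have hσ' : 0 < σ := by
      by_contra! hc
      have : 0 ≤ τ * t' := by positivity
      nlinarith
    have hτ' : 0 < τ := by
      by_contra! hc
      have : 0 ≤ σ * t := by positivity
      nlinarith
    have i3 : t * t' ≤ s * s' := by
      have h5 : (τ * t') * (σ * t) ≤ (σ * s) * (τ * s') :=
        mul_le_mul i1.le i2.le (by positivity) (by positivity)
      have h6 : 0 < σ * τ := by positivity
      by_contra! hc
      nlinarith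
    nlinarith
  · refine T.wedge_end_nonpos H h2 (fun j hj hj' => ?_) ?_
    · rw [e, map_add, map_smul, map_smul, LinearMap.add_apply, LinearMap.smul_apply,
        LinearMap.smul_apply, smul_eq_mul, smul_eq_mul]
      have i1 := H.neg₂ (m - 1) j (by omega) (by omega) (by omega)
      rcases eq_or_lt_of_le hj with rfl | hj
      · rw [wedge_self]
        nlinarith
      · have i2 := H.neg₂ m j (by omega) (by omega) (by omega)
        nlinarith
    · rw [e, map_add, map_smul, map_smul, LinearMap.add_apply, LinearMap.smul_apply,
        LinearMap.smul_apply, smul_eq_mul, smul_eq_mul]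
      have i1 := H.neg₂ (m - 1) (m' - 1) (by omega) (by omega) (by omega)
      rcases eq_or_lt_of_le (show m ≤ m' - 1 by omega) with hj | hj
      · rw [← hj, wedge_self]
        nlinarith
      · have i2 := H.neg₂ m (m' - 1) (by omega) (by omega) (by omega)
        nlinarith

/-- The path around the middle chain is a shortest path. -/
theorem isShortestPath (T : Tangents ε p β γ n m m') (H : TriChain ε p β γ n) {S : Set Plane}
    (hS : S = enclosed ε p β γ n) (hedge : ∀ k, Sees ε p β γ n k (k + 1)) {r : ℕ} {q : ℕ → Plane}
    (hr : m' - m = r) (hq₀ : q 0 = p 1) (hq : ∀ k : ℕ, q (k + 1) = p (m + k)) :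
    IsShortestPath S (p 1) (p (n - 1)) ((List.range (r + 2)).map q ++ [p (n - 1)]) := by
  have h1 := T.lt
  have h2 := T.le
  have h3 := T.lt'
  subst hS
  -- The midpoint of the chord is hidden behind the chain, strictly beyond all of its edges.
  set M := (1 / 2 : ℝ) • p β + (1 / 2 : ℝ) • p γ with hMdef
  have hMside : ∀ j, β ≤ j → j < γ → side ε p j M < 0 := fun j hj hj' =>
    H.bending₂.side_midpoint_neg hj hj' le_rfl (by omega) le_rfl
  have hMs : ∀ j, β ≤ j → j + 1 < γ → wedge ε (step p j) (M - p (j + 1)) < 0 := by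
    intro j hj hj'
    have := hMside j hj (by omega)
    rwa [side_eq ε p j (p (j + 1)), side_succ, zero_add] at this
  obtain ⟨s, t, hs, ht, hst, -, e⟩ := T.exists_cone H
  have hstep : ∀ k : ℕ, q (k + 1 + 1) - q (k + 1) = step p (m + k) := by
    intro k
    rw [hq, hq, step, Nat.cast_add, Nat.cast_one, add_assoc]
  have hstep₀ : q (0 + 1) - q 0 = s • step p (m - 1) + t • step p m := by
    rw [hq, hq₀, ← e, Nat.cast_zero, add_zero]
  rw [← hq₀]
  refine isShortestPath_of_turns (M := M) (ε := ε) (r + 1) q ?_ ?_ ?_ ?_ ?_ ?_ ?_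
  · rintro (_ | k) hk
    · rw [hq, hq₀, Nat.cast_zero, add_zero]
      exact T.sees_first H
    · rw [hq, hq, Nat.cast_add, Nat.cast_one, ← add_assoc]
      exact hedge _
  · rw [hq, ← hr, add_sub_cancel, segment_symm]
    exact T.sees_last H
  · rintro (_ | k) hk
    · rw [hstep₀, hstep, Nat.cast_zero, add_zero, map_add, map_smul, map_smul,
        LinearMap.add_apply, LinearMap.smul_apply, LinearMap.smul_apply, wedge_self, smul_zero,
        add_zero, smul_eq_mul]
      have := H.neg₂ (m - 1) m (by omega) (by omega) (by omega)
      nlinarith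
    · rw [hstep, hstep]
      exact (H.neg₂ _ _ (by omega) (by omega) (by omega)).le
  · rintro (_ | k) hk
    · rw [hq, hq₀, Nat.cast_zero, add_zero]
      exact T.wedge_first_end_nonpos H
    · rw [hstep, hq]
      have hneg : ∀ j, m + k ≤ j → j ≤ m' → wedge ε (step p (m + k)) (step p j) ≤ 0 := by
        intro j hj hj'
        rcases eq_or_lt_of_le hj with rfl | hj
        · rw [wedge_self]
        · exact (H.neg₂ _ _ (by omega) hj (by omega)).le
      exact T.wedge_end_nonpos H (by omega) (fun j hj hj' => hneg j (by omega) hj')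
        (hneg _ (by omega) (by omega))
  · intro k hk
    rw [hq]
    set l := m + (k : ℤ) with hl
    have hc1 := T.wedge_corner_end_pos H (k := l) (by omega) (by omega)
    have hc2 : 0 ≤ wedge ε (p γ - p l) (p (n - 1) - p l) := by
      rw [← sub_add_sub_cancel (p (n - 1)) (p γ) (p l), map_add, wedge_self, add_zero]
      exact wedge_sub_nonneg' (by omega) fun i hi hi' => wedge_sub_nonneg (by have := H.lt'; omega)
        fun j hj hj' => (H.pos₂₃ i j (by omega) hi' hj (by omega)).le
    have eM : M - p l = (1 / 2 : ℝ) • (p β - p l) + (1 / 2 : ℝ) • (p γ - p l) := by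
      rw [hMdef]; module
    rw [eM, map_add, map_smul, map_smul, LinearMap.add_apply, LinearMap.smul_apply,
      LinearMap.smul_apply, smul_eq_mul, smul_eq_mul]
    linarith
  · rintro (_ | k) hk
    · rw [hstep₀, hq, Nat.cast_zero, add_zero, map_add, map_smul, map_smul,
        LinearMap.add_apply, LinearMap.smul_apply, LinearMap.smul_apply, smul_eq_mul, smul_eq_mul]
      have i1 := hMs (m - 1) (by omega) (by omega)
      have i2 := hMside m (by omega) (by omega)
      rw [sub_add_cancel] at i1
      rw [side] at i2
      rcases eq_or_lt_of_le hs with rfl | hs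
      · have : 0 < t := by linarith
        nlinarith
      · nlinarith
    · rw [hstep, hq, Nat.cast_add, Nat.cast_one, ← add_assoc]
      exact hMs _ (by omega) (by omega)
  -- Up to `M` the ray is strictly beyond every edge of the chain, past `M` it is beyond the chord.
  · intro k hk u hu
    rw [hq]
    set l := m + (k : ℤ) with hl
    rintro ⟨-, ⟨hb, j, hj, hj', hjs⟩, -⟩
    have ex : p l + u • (M - p l) = (1 - u) • p l + u • M := by module
    rw [ex] at hb hjs
    rw [wedge_combo_sub _ _ _ _ _ (by ring)] at hb
    rw [side_combo _ _ _ _ _ (by ring)] at hjs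
    have eM : M - p β = (1 / 2 : ℝ) • (p γ - p β) := by
      rw [hMdef]; module
    rw [eM, map_smul, wedge_self, smul_zero, mul_zero, add_zero] at hb
    have h5 := H.bending₂.hull_pos (k := l) (by omega) (by omega)
    have h6 := hMside j hj hj'
    have h7 := H.bending₂.side_nonpos hj hj' (k := l) (by omega) (by omega)
    have h8 : u ≤ 1 := by
      by_contra! hc
      nlinarith
    nlinarith

end Tangents

end

section

open Fin.CommRing

/-! ### Visibility graphs of pseudo-triangles -/

open Plane

lemma Fin.val_add_intCast_sub {n : ℕ} [NeZero n] (a : Fin n) {k l : ℤ} (h : k ≤ l)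
    (h' : l - k < n) : (((a + (l : Fin n) - (a + (k : Fin n))).val : ℕ) : ℤ) = l - k := by
  have e : a + (l : Fin n) - (a + (k : Fin n)) = 0 + ((l - k : ℤ) : Fin n) := by push_cast; ring
  rw [e, Fin.val_add_intCast 0 (by omega) h', Fin.val_zero, Nat.cast_zero, zero_add, if_pos h']

lemma Fin.add_intCast_ne {n : ℕ} [NeZero n] (a : Fin n) {k l : ℤ} (h : k < l) (h' : l - k < n) :
    a + (k : Fin n) ≠ a + (l : Fin n) := by
  intro e
  have := Fin.val_add_intCast_sub a h.le h'
  rw [e, sub_self, Fin.val_zero] at this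
  omega

lemma SimpleGraph.cycleGraph_adj_iff_eq {n : ℕ} [NeZero n] (hn : 2 ≤ n) {x y : Fin n} :
    (cycleGraph n).Adj x y ↔ y = x + 1 ∨ y = x - 1 := by
  have h1 : ∀ z : Fin n, z.val = 1 ↔ z = 1 := by
    intro z
    rw [Fin.ext_iff, Fin.val_one', Nat.mod_eq_of_lt (by omega)]
  rw [cycleGraph_adj', h1, h1, or_comm]
  exact or_congr (sub_eq_iff_eq_add'.trans Iff.rfl)
    ⟨fun h => by rw [← h]; ring, fun h => by rw [h]; ring⟩

lemma mem_detected_cycleGraph {n : ℕ} [NeZero n] (hn : 3 ≤ n) {G : SimpleGraph (Fin n)} {x : Fin n} :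
    x ∈ detected G (SimpleGraph.cycleGraph n) ↔ G.Adj (x - 1) (x + 1) := by
  have hne : x - 1 ≠ x + 1 := by
    have := Fin.add_intCast_ne x (k := -1) (l := 1) (by omega) (by omega)
    push_cast at this
    rwa [← sub_eq_add_neg] at this
  simp only [detected, Set.mem_ofPred_eq, SimpleGraph.cycleGraph_adj_iff_eq (n := n) (by omega)]
  constructor
  · rintro ⟨y, z, h, rfl | rfl, rfl | rfl, hadj⟩
    · exact absurd rfl h
    · exact hadj.symm
    · exact hadj
    · exact absurd rfl h
  · intro h
    exact ⟨x - 1, x + 1, hne, Or.inr rfl, Or.inl rfl, h⟩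

namespace Polygon

variable {n : ℕ} [NeZero n] {P : Polygon Plane n} {a b c : Fin n} {ε : ℝ}

lemma IsPseudoTriangle.rotate (h : P.IsPseudoTriangle a b c) : P.IsPseudoTriangle b c a := by
  obtain ⟨hS, hab, hbc, hA, hB, hC, hR⟩ := h
  rw [Fin.lt_def, Fin.val_zero] at hab
  have h1 : (c - b).val = (c - a).val - (b - a).val := by
    rw [← Fin.sub_val_of_le hbc.le]
    congr 1; ring
  have h2 : (a - b).val = n - (b - a).val := by
    rw [← neg_sub, Fin.val_neg, if_neg]
    intro h0
    rw [h0] at hab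
    simp at hab
  have h3 := (c - a).isLt
  rw [Fin.lt_def] at hbc
  refine ⟨hS, ?_, ?_, hB, hC, hA, fun i h1 h2 h3 => hR i h3 h1 h2⟩
  · rw [Fin.lt_def, Fin.val_zero, h1]; omega
  · rw [Fin.lt_def, h1, h2]; omega

variable {β γ : ℕ}

lemma mem_detected_iff_sees (H : TriChain ε (P.unroll a) β γ n) (k : ℤ) :
    a + (k : Fin n) ∈ detected P.visibilityGraph (SimpleGraph.cycleGraph n) ↔
      Sees ε (P.unroll a) β γ n (k - 1) (k + 1) := by
  have h1 := H.pos
  have h2 := H.lt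
  have h3 := H.lt'
  rw [mem_detected_cycleGraph (by omega),
    visibilityGraph_adj_iff H (k := k - 1) (l := k + 1) (by push_cast; ring) (by push_cast; ring)]
  refine and_iff_right ?_
  have := Fin.add_intCast_ne a (k := k - 1) (l := k + 1) (by omega) (by omega)
  convert this using 1 <;> push_cast <;> ring

lemma eq_of_mem_detected (H : TriChain ε (P.unroll a) β γ n) {k : ℤ} (hk : 0 ≤ k) (hk' : k < n)
    (h : a + (k : Fin n) ∈ detected P.visibilityGraph (SimpleGraph.cycleGraph n)) :
    k = 0 ∨ k = β ∨ k = γ := by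
  rw [mem_detected_iff_sees H] at h
  by_contra! hc
  rcases lt_or_gt_of_ne hc.2.1 with h1 | h1
  · exact H.not_sees₁ (by omega) (by omega) (by omega) h
  · rcases lt_or_gt_of_ne hc.2.2 with h2 | h2
    · exact H.not_sees₂ (by omega) (by omega) (by omega) h
    · exact H.not_sees₃ (by omega) (by omega) (by omega) h

lemma IsPseudoTriangle.detected_subset (h : P.IsPseudoTriangle a b c) :
    detected P.visibilityGraph (SimpleGraph.cycleGraph n) ⊆ {a, b, c} := by
  obtain ⟨ε, H⟩ := h.exists_triChain
  intro i hi
  obtain ⟨k, k0, k1, rfl, -, -⟩ := exists_unroll P a i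
  rcases eq_of_mem_detected H k0 k1 hi with h | h | h
  · left; rw [h]; simp
  · right; left; rw [h, Int.cast_natCast, Fin.cast_val_eq_self]; ring
  · right; right; rw [h, Int.cast_natCast, Fin.cast_val_eq_self]
    rw [Set.mem_singleton_iff]; ring

section Missed

variable {m m' : ℤ}

lemma isIsolated_of_tangents (H : TriChain ε (P.unroll a) β γ n)
    (T : Tangents ε (P.unroll a) β γ n m m') :
    (P.visibilityGraph \ SimpleGraph.cycleGraph n).IsIsolated (a + ((β : ℤ) : Fin n)) := by
  have h1 := H.pos
  have h2 := H.lt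
  have h3 := H.lt'
  intro z hz
  obtain ⟨k, k0, k1, rfl, -, -⟩ := exists_unroll P a z
  rw [SimpleGraph.sdiff_adj, visibilityGraph_adj_iff H rfl rfl,
    SimpleGraph.cycleGraph_adj_iff_eq (by omega)] at hz
  obtain ⟨⟨hne, hs⟩, hcyc⟩ := hz
  have hk : k ≠ β := fun h => hne (by rw [h])
  have hk1 : k ≠ β + 1 := fun h => hcyc (Or.inl (by rw [h]; push_cast; ring))
  have hk2 : k ≠ β - 1 := fun h => hcyc (Or.inr (by rw [h]; push_cast; ring))
  rcases lt_or_gt_of_ne hk with h | h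
  · refine H.not_sees₁ k0 (by omega) le_rfl ?_
    rw [Sees, segment_symm]
    exact hs
  · rcases le_or_gt k γ with h' | h'
    · exact H.not_sees₂ le_rfl (by omega) h' hs
    · exact T.not_sees H h' k1 hs

lemma isIsolated_of_tangents' (H : TriChain ε (P.unroll a) β γ n)
    (T : Tangents ε (P.unroll a) β γ n m m') :
    (P.visibilityGraph \ SimpleGraph.cycleGraph n).IsIsolated (a + ((γ : ℤ) : Fin n)) := by
  have h1 := H.pos
  have h2 := H.lt
  have h3 := H.lt'
  intro z hz
  obtain ⟨k, k0, k1, rfl, -, -⟩ := exists_unroll P a z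
  rw [SimpleGraph.sdiff_adj, visibilityGraph_adj_iff H rfl rfl,
    SimpleGraph.cycleGraph_adj_iff_eq (by omega)] at hz
  obtain ⟨⟨hne, hs⟩, hcyc⟩ := hz
  have hk : k ≠ γ := fun h => hne (by rw [h])
  have hk1 : k ≠ γ + 1 := fun h => hcyc (Or.inl (by rw [h]; push_cast; ring))
  have hk2 : k ≠ γ - 1 := fun h => hcyc (Or.inr (by rw [h]; push_cast; ring))
  rcases eq_or_lt_of_le k0 with rfl | k0
  · have hγ : (γ : ℤ) + 1 ≠ n := fun h => hcyc (Or.inl (by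
      have := intCast_self (n := n)
      rw [← h] at this
      push_cast at this ⊢
      rw [add_assoc, this]))
    refine H.not_sees₃ le_rfl (by omega) le_rfl (k := γ) (k' := n) ?_
    rw [Sees, H.period]
    exact hs
  · rcases lt_or_gt_of_ne hk with h | h
    · rcases lt_or_ge k β with h' | h'
      · exact T.not_sees' H k0 h' hs
      · refine H.not_sees₂ h' (by omega) le_rfl ?_
        rw [Sees, segment_symm]
        exact hs
    · exact H.not_sees₃ le_rfl (by omega) k1.le hs

lemma cutsOffTower_of_tangents (H : TriChain ε (P.unroll a) β γ n)
    (T : Tangents ε (P.unroll a) β γ n m m') :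
    (a + ((β : ℤ) : Fin n) ≠ a + 1 ∧
      P.CutsOffTower (a + 1) (a + (m : Fin n)) (a + ((β : ℤ) : Fin n))) ∨
    (a + ((β : ℤ) : Fin n) = a + 1 ∧ m = β + 1) := by
  have h1 := H.pos
  have h2 := H.lt
  have h3 := H.lt'
  have t1 := T.lt
  have t2 := T.le
  have t3 := T.lt'
  have e1 : a + 1 = a + ((1 : ℤ) : Fin n) := by push_cast; rfl
  rcases eq_or_lt_of_le (show 1 ≤ (β : ℤ) by omega) with h | h
  · right
    refine ⟨by rw [← h, e1], ?_⟩
    -- Here `p 1` is the corner `p β` itself, which edge `β + 1` has strictly on its outer side; so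
    -- the search for the contact vertex stops at once.
    by_contra hne
    have i1 := T.pos (β + 1) (by omega) (by omega)
    have i2 := H.bending₂.side_neg (j := β + 1) (k := β) (by omega) (by omega) le_rfl (by omega)
      (by omega) (by omega)
    rw [← h] at i1 i2
    linarith
  · left
    rw [e1]
    refine ⟨(Fin.add_intCast_ne a h (by omega)).symm, cutsOffTower_of_chord (p := P.unroll a)
      (l := 1) (c := β) (r := m) ?_ (Fin.val_add_intCast_sub a h.le (by omega))
      (Fin.val_add_intCast_sub a (by omega) (by omega)) H.sign h t1 ?_ ?_ ?_ ?_ ?_⟩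
    · intro k
      rw [unroll]; push_cast; rw [add_assoc]
    · exact fun i j hi hij hj => H.neg₁ i j (by omega) hij hj
    · exact fun i j hi hij hj => H.neg₂ i j (by omega) hij (by omega)
    · exact fun i j hi hi' hj hj' => H.pos₁₂ i j (by omega) hi' hj (by omega)
    · intro i hi hi'
      have := T.wedge_first_pos H (i := i) (by omega) hi'
      rwa [← neg_sub, map_neg, LinearMap.neg_apply, wedge_swap, neg_neg]
    · exact fun j hj hj' => T.wedge_middle_pos H h hj hj'

lemma cutsOffTower_of_tangents' (H : TriChain ε (P.unroll a) β γ n)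
    (T : Tangents ε (P.unroll a) β γ n m m') :
    (a + ((γ : ℤ) : Fin n) ≠ a - 1 ∧
      P.CutsOffTower (a + (m' : Fin n)) (a - 1) (a + ((γ : ℤ) : Fin n))) ∨
    (a + ((γ : ℤ) : Fin n) = a - 1 ∧ m' = γ - 1) := by
  have h1 := H.pos
  have h2 := H.lt
  have h3 := H.lt'
  have t1 := T.lt
  have t2 := T.le
  have t3 := T.lt'
  have e1 : a - 1 = a + (((n : ℤ) - 1 : ℤ) : Fin n) := by
    rw [Int.cast_sub, intCast_self]; push_cast; ring
  rcases eq_or_lt_of_le (show (γ : ℤ) ≤ n - 1 by omega) with h | h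
  · right
    refine ⟨by rw [h, e1], ?_⟩
    by_contra hne
    have i1 := T.pos' (γ - 2) (by omega) (by omega)
    have i2 := H.bending₂.side_neg (j := γ - 2) (k := γ) (by omega) (by omega) (by omega) le_rfl
      (by omega) (by omega)
    rw [← h] at i1
    linarith
  · left
    rw [e1]
    have T' := T.reverse H
    have H' := H.reverse
    have hs : ∀ j, step (fun i => P.unroll a (-i)) (n - j - 1) = -step (P.unroll a) j := by
      intro j
      rw [step_reverse, ← H.step_periodic]
      congr 2
      ring
    have hp1 : P.unroll a (-1) = P.unroll a (n - 1) := H.apply_neg 1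
    have hpm : P.unroll a (-(n - m')) = P.unroll a m' := by
      rw [H.apply_neg, sub_sub_cancel]
    refine ⟨Fin.add_intCast_ne a h (by omega), cutsOffTower_of_chord (p := P.unroll a)
      (l := m') (c := γ) (r := n - 1) ?_ (Fin.val_add_intCast_sub a t3.le (by omega))
      (Fin.val_add_intCast_sub a (by omega) (by omega)) H.sign t3 h ?_ ?_ ?_ ?_ ?_⟩
    · intro k
      rw [unroll]; push_cast; rw [add_assoc]
    · exact fun i j hi hij hj => H.neg₂ i j (by omega) hij hj
    · exact fun i j hi hij hj => H.neg₃ i j (by omega) hij (by omega)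
    · exact fun i j hi hi' hj hj' => H.pos₂₃ i j (by omega) hi' hj (by omega)
    · intro i hi hi'
      have := T'.wedge_middle_pos H' (by omega) (i := n - i - 1) (by omega) (by omega)
      rw [hs, hp1, hpm, wedge_neg_sign, map_neg, LinearMap.neg_apply, neg_neg, ← neg_sub, map_neg,
        ← wedge_swap] at this
      exact this
    · intro j hj hj'
      have := T'.wedge_first_pos H' (i := n - j - 1) (by omega) (by omega)
      rwa [hs, hp1, hpm, wedge_neg_sign, map_neg, LinearMap.neg_apply, neg_neg] at this

lemma isShortestPath_of_tangents (H : TriChain ε (P.unroll a) β γ n)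
    (T : Tangents ε (P.unroll a) β γ n m m') :
    IsShortestPath P.region (P (a + 1)) (P (a - 1))
      (P (a + 1) :: P.boundaryChain (a + (m : Fin n)) (a + (m' : Fin n)) ++ [P (a - 1)]) := by
  have h1 := H.pos
  have h2 := H.lt
  have h3 := H.lt'
  have t1 := T.lt
  have t2 := T.le
  have t3 := T.lt'
  have e1 : P (a + 1) = P.unroll a 1 := by rw [unroll]; push_cast; rfl
  have e2 : P (a - 1) = P.unroll a (n - 1) := by
    rw [unroll, Int.cast_sub, intCast_self, Int.cast_one, zero_sub, sub_eq_add_neg]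
  have hr := Fin.val_add_intCast_sub a t2 (by omega)
  have hreg := region_eq_enclosed H
  have key := T.isShortestPath H hreg (r := (a + (m' : Fin n) - (a + (m : Fin n))).val)
    (q := fun i => P.unroll a (if i = 0 then 1 else m + (i - 1 : ℕ)))
    (fun k => by
      rw [Sees, ← hreg]
      exact (segment_unroll_subset_boundary P a k).trans Set.subset_union_left)
    hr.symm (by simp) (by simp)
  rw [map_range_succ_append] at key
  rw [e1, e2]
  convert key using 1
  rw [boundaryChain, List.cons_append]
  congr 2
  refine List.map_congr_left fun k _ => ?_
  rw [if_neg (by omega), unroll, add_tsub_cancel_right]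
  push_cast
  rw [← add_assoc]
  rfl

end Missed

theorem IsPseudoTriangle.of_notMem_detected (h : P.IsPseudoTriangle a b c)
    (ha : a ∉ detected P.visibilityGraph (SimpleGraph.cycleGraph n)) :
    b ∈ detected P.visibilityGraph (SimpleGraph.cycleGraph n) ∧
    c ∈ detected P.visibilityGraph (SimpleGraph.cycleGraph n) ∧
    (P.visibilityGraph \ SimpleGraph.cycleGraph n).IsIsolated b ∧
    (P.visibilityGraph \ SimpleGraph.cycleGraph n).IsIsolated c ∧
    ∃ s t : ℕ, 0 < s ∧ s ≤ t ∧ t < (c - b).val ∧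
      ∃ w w' : Fin n, w = b + Fin.ofNat n s ∧ w' = b + Fin.ofNat n t ∧
        P.visibilityGraph.Adj (a + 1) w ∧ P.visibilityGraph.Adj w' (a - 1) ∧
        IsShortestPath P.region (P (a + 1)) (P (a - 1))
          (P (a + 1) :: P.boundaryChain w w' ++ [P (a - 1)]) ∧
        ((b ≠ a + 1 ∧ P.CutsOffTower (a + 1) w b) ∨ (b = a + 1 ∧ w = b + 1)) ∧
        ((c ≠ a - 1 ∧ P.CutsOffTower w' (a - 1) c) ∨ (c = a - 1 ∧ w' = c - 1)) := by
  obtain ⟨ε, H⟩ := h.exists_triChain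
  have eb : b = a + (((b - a).val : ℤ) : Fin n) := by
    rw [Int.cast_natCast, Fin.cast_val_eq_self]; ring
  have ec : c = a + (((c - a).val : ℤ) : Fin n) := by
    rw [Int.cast_natCast, Fin.cast_val_eq_self]; ring
  generalize (b - a).val = β at H eb
  generalize (c - a).val = γ at H ec
  subst eb ec
  have h1 := H.pos
  have h2 := H.lt
  have h3 := H.lt'
  have ha' : ¬ Sees ε (P.unroll a) β γ n 1 (n - 1) := by
    intro hs
    apply ha
    have := (mem_detected_iff_sees H 0).2 (by
      rw [Sees, segment_symm, zero_sub, zero_add, H.apply_neg]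
      exact hs)
    rwa [Int.cast_zero, add_zero] at this
  obtain ⟨m, m', T⟩ := H.exists_tangents ha'
  have t1 := T.lt
  have t2 := T.le
  have t3 := T.lt'
  obtain ⟨s, hs⟩ := Int.eq_ofNat_of_zero_le (show 0 ≤ m - β by omega)
  obtain ⟨t, ht⟩ := Int.eq_ofNat_of_zero_le (show 0 ≤ m' - β by omega)
  have hcb := Fin.val_add_intCast_sub a h2.le (by omega)
  have ew : a + (m : Fin n) = a + ((β : ℤ) : Fin n) + Fin.ofNat n s := by
    rw [show m = β + s by omega]; push_cast; rw [add_assoc]; rfl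
  have ew' : a + (m' : Fin n) = a + ((β : ℤ) : Fin n) + Fin.ofNat n t := by
    rw [show m' = β + t by omega]; push_cast; rw [add_assoc]; rfl
  have e1 : a + 1 = a + ((1 : ℤ) : Fin n) := by push_cast; rfl
  have e2 : a - 1 = a + (((n : ℤ) - 1 : ℤ) : Fin n) := by
    rw [Int.cast_sub, intCast_self]; push_cast; ring
  refine ⟨(mem_detected_iff_sees H _).2 (T.sees_around H),
    (mem_detected_iff_sees H _).2 ?_, isIsolated_of_tangents H T, isIsolated_of_tangents' H T,
    s, t, by omega, by omega, by omega, _, _, ew, ew', ?_, ?_, isShortestPath_of_tangents H T, ?_, ?_⟩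
  · rw [Sees, segment_symm]
    exact T.sees_around' H
  · exact (visibilityGraph_adj_iff H e1 rfl).2
      ⟨by rw [e1]; exact Fin.add_intCast_ne a (by omega) (by omega), T.sees_first H⟩
  · refine (visibilityGraph_adj_iff H rfl e2).2
      ⟨by rw [e2]; exact Fin.add_intCast_ne a (by omega) (by omega), ?_⟩
    rw [Sees, segment_symm]
    exact T.sees_last H
  · rcases cutsOffTower_of_tangents H T with h | ⟨h, hm⟩
    · exact Or.inl h
    · exact Or.inr ⟨h, by rw [hm]; push_cast; ring⟩
  · rcases cutsOffTower_of_tangents' H T with h | ⟨h, hm⟩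
    · exact Or.inl h
    · exact Or.inr ⟨h, by rw [hm]; push_cast; ring⟩

/-- By rotation, any missed corner forces the other two to be detected. -/
theorem IsPseudoTriangle.two_le_ncard_detected (h : P.IsPseudoTriangle a b c) :
    2 ≤ (detected P.visibilityGraph (SimpleGraph.cycleGraph n)).ncard := by
  have hab : a ≠ b := fun e => by simpa [e] using h.2.1
  have hbc : b ≠ c := fun e => by simpa [e] using h.rotate.2.1
  have hca : c ≠ a := fun e => by simpa [e] using h.rotate.rotate.2.1
  have key : ∀ x y, x ≠ y → x ∈ detected P.visibilityGraph (SimpleGraph.cycleGraph n) →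
      y ∈ detected P.visibilityGraph (SimpleGraph.cycleGraph n) →
      2 ≤ (detected P.visibilityGraph (SimpleGraph.cycleGraph n)).ncard := by
    intro x y hxy hx hy
    rw [← Set.ncard_pair hxy]
    exact Set.ncard_le_ncard (by rintro z (rfl | rfl) <;> assumption) (Set.toFinite _)
  by_cases ha : a ∈ detected P.visibilityGraph (SimpleGraph.cycleGraph n)
  · by_cases hb : b ∈ detected P.visibilityGraph (SimpleGraph.cycleGraph n)
    · exact key a b hab ha hb
    · obtain ⟨h1, h2, -⟩ := h.rotate.of_notMem_detected hb
      exact key c a hca h1 h2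
  · obtain ⟨h1, h2, -⟩ := h.of_notMem_detected ha
    exact key b c hbc h1 h2

end Polygon

end

/-- `P` is any pseudo-triangle, `G` its visibility graph and `H` its boundary cycle. The hypothesis is
invariant under rotating `a`, `b`, `c`, so the last part applies to each of the three corners.
There `a + 1` and `a - 1` are the boundary neighbours of the missed corner `a`, and `b + s`, `b + t`
are interior vertices of the side-chain from `b` to `c`. -/
theorem lemma1 {n : ℕ} [NeZero n] (P : Polygon Plane n) (a b c : Fin n)
    (hP : P.IsPseudoTriangle a b c) (G H : SimpleGraph (Fin n))
    (hG : G = P.visibilityGraph) (hH : H = SimpleGraph.cycleGraph n) :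
    detected G H ⊆ {a, b, c} ∧
    2 ≤ (detected G H).ncard ∧
    (a ∉ detected G H →
      b ∈ detected G H ∧ c ∈ detected G H ∧
      (G \ H).IsIsolated b ∧ (G \ H).IsIsolated c ∧
      ∃ s t : ℕ, 0 < s ∧ s ≤ t ∧ t < (c - b).val ∧
        ∃ w w' : Fin n, w = b + Fin.ofNat n s ∧ w' = b + Fin.ofNat n t ∧
          G.Adj (a + 1) w ∧ G.Adj w' (a - 1) ∧
          IsShortestPath P.region (P (a + 1)) (P (a - 1))
            (P (a + 1) :: P.boundaryChain w w' ++ [P (a - 1)]) ∧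
          ((b ≠ a + 1 ∧ P.CutsOffTower (a + 1) w b) ∨ (b = a + 1 ∧ w = b + 1)) ∧
          ((c ≠ a - 1 ∧ P.CutsOffTower w' (a - 1) c) ∨ (c = a - 1 ∧ w' = c - 1))) := by
  subst hG hH
  exact ⟨hP.detected_subset, hP.two_le_ncard_detected, hP.of_notMem_detected⟩
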